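/- Let $Q=[0,1)^3$ and let $\mu$ be a $\mathbb{Z}^3$-periodic Borel measure on $\mathbb{R}^3$ with $\mu(Q)=1$ and $\int_Q\partial_j\phi\,d\mu=0$ for all smooth $Q$-periodic $\phi$ and $j=1,2,3$. For $\varepsilon>0$ put $\mu^\varepsilon(B)=\varepsilon^3\mu(\varepsilon^{-1}B)$. Let $A$ be a differentiable, $Q$-periodic function on $\mathbb{R}^3$ with values in the real symmetric positive definite $3\times3$ matrices, and write $e_\kappa(y)=e^{i\kappa\cdot y}$. *Problem.* Let $H^1_{\operatorname{curl}A^{1/2}}(\mathbb{R}^3,d\mu^\varepsilon)$ be the closure in $L^2(\mathbb{R}^3,d\mu^\varepsilon)^3\oplus L^2(\mathbb{R}^3,d\mu^\varepsilon)^3$ of the pairs $(\phi,\operatorname{curl}(A^{1/2}(\cdot/\varepsilon)\phi))$ with $A^{1/2}(\cdot/\varepsilon)\phi\in C_0^\infty(\mathbb{R}^3)^3$. Let $g\in L^2(\mathbb{R}^3,d\mu^\varepsilon)^3$ be divergence free, i.e. $\int g\cdot\overline{\nabla\phi}\,d\mu^\varepsilon=0$ for all $\phi\in C_0^\infty(\mathbb{R}^3)$.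 A solution of $$A^{1/2}(\cdot/\varepsilon)\operatorname{curl}\operatorname{curl}A^{1/2}(\cdot/\varepsilon)D_\varepsilon+D_\varepsilon=-A^{1/2}(\cdot/\varepsilon)g$$ is a pair $(D_\varepsilon,v)\in H^1_{\operatorname{curl}A^{1/2}}(\mathbb{R}^3,d\mu^\varepsilon)$ with $\int v\cdot\overline{w}\,d\mu^\varepsilon+\int D_\varepsilon\cdot\overline{\phi}\,d\mu^\varepsilon=-\int A^{1/2}(\cdot/\varepsilon)g\cdot\overline{\phi}\,d\mu^\varepsilon$ for all $(\phi,w)\in H^1_{\operatorname{curl}A^{1/2}}(\mathbb{R}^3,d\mu^\varepsilon)$. *Symbol.* Let $C^\infty_{\#,0}(Q)$ be the smooth $Q$-periodic functions with zero $\mu$-mean over $Q$. For $\kappa\in\mathbb{R}^3$ let the vector function $\Psi_\kappa\in H^1_{\#,0}(Q,d\mu)$ solve $\overline{e_\kappa}\operatorname{div}A^{-1}(\nabla(e_\kappa\Psi_\kappa)+e_\kappa I)=0$, that is, for $j=1,2,3$, $\int_Q A^{-1}(\nabla(e_\kappa\Psi_{\kappa,j})+e_\kappa \mathbf{e}_j)\cdot\overline{\nabla(e_\kappa\phi)}\,d\mu=0$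 for all $\phi\in C^\infty_{\#,0}(Q)$, where $\mathbf{e}_j$ is the $j$-th unit vector, $(\Psi_{\kappa,j},\overline{e_\kappa}\nabla(e_\kappa\Psi_{\kappa,j}))$ lies in the $L^2(Q,d\mu)\oplus L^2(Q,d\mu)^3$-closure of $\{(\phi,\overline{e_\kappa}\nabla(e_\kappa\phi)):\phi\in C^\infty_{\#,0}(Q)\}$, and $\nabla(e_\kappa\Psi_{\kappa,j})$ is the $j$-th column of $\nabla(e_\kappa\Psi_\kappa)$. Put $$\widehat A^{\rm hom}_\kappa=\int_Q A^{-1}\bigl(\overline{e_\kappa}\nabla(e_\kappa\Psi_\kappa)+I\bigr)d\mu,\qquad \mathfrak{A}^{\rm hom}_\theta=i\theta\times i\theta\times\bigl(\widehat A^{\rm hom}_{\varepsilon\theta}\bigr)^{-1},\qquad \widehat g(\theta)=(2\pi)^{-3/2}\int_{\mathbb{R}^3}g\,\overline{e_\theta}\,d\mu^\varepsilon,$$ the last one extended to $g\in L^2(\mathbb{R}^3,d\mu^\varepsilon)^3$ as the $L^2_{\rm loc}(\mathbb{R}^3,d\theta)$-limit of the transforms of $g\mathbf{1}_{\{|x|<n\}}$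 as $n\to\infty$. *Claim.* Such $\Psi_\kappa$ exist for all $\kappa\in\mathbb{R}^3$, and there is a constant $C>0$, depending only on $\mu$ and $A$, such that for all $\varepsilon>0$, all $g$ and all solutions $D_\varepsilon$ as above $$\Bigl\|D_\varepsilon+(2\pi)^{-3/2}\int_{\mathbb{R}^3}A^{-1/2}\bigl(\overline{e_{\varepsilon\theta}}\nabla(e_{\varepsilon\theta}\Psi_{\varepsilon\theta})+I\bigr)\bigl(\widehat A^{\rm hom}_{\varepsilon\theta}\bigr)^{-1}\bigl(\mathfrak{A}^{\rm hom}_\theta+I\bigr)^{-1}\widehat g(\theta)\,e_\theta\,d\theta\Bigr\|_{L^2(\mathbb{R}^3,d\mu^\varepsilon)}\le C\varepsilon\|g\|_{L^2(\mathbb{R}^3,d\mu^\varepsilon)},$$ where $A^{-1/2}$ and $\overline{e_{\varepsilon\theta}}\nabla(e_{\varepsilon\theta}\Psi_{\varepsilon\theta})$ are evaluated at $x/\varepsilon$. The integral defines an element of $L^2(\mathbb{R}^3,d\mu^\varepsilon)^3$; it is understood weakly, i.e. it converges absolutely in $\theta$ after pairing in $L^2(\mathbb{R}^3,d\mu^\varepsilon)^3$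 with any field in $C_0^\infty(\mathbb{R}^3)^3$. -/

import Mathlib

open MeasureTheory Filter Topology
open scoped ENNReal ContDiff Matrix ComplexConjugate MatrixOrder

namespace MaxwellHom

/-- Euclidean space `ℝ³`. -/
abbrev R3 : Type := EuclideanSpace ℝ (Fin 3)

/-- The Hermitian space `ℂ³`; `inner ℂ v u = ∑ i, u i * conj (v i)`, i.e. `u · v̄`. -/
abbrev C3 : Type := EuclideanSpace ℂ (Fin 3)

/-- Real `3 × 3` matrices. -/
abbrev MatR : Type := Matrix (Fin 3) (Fin 3) ℝ

/-- Complex `3 × 3` matrices. -/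
abbrev MatC : Type := Matrix (Fin 3) (Fin 3) ℂ

noncomputable section

/-! ### Vector calculus for complex-valued fields -/

/-- Action of a complex matrix on a vector of `ℂ³`. -/
def act (M : MatC) (v : C3) : C3 := WithLp.toLp 2 (M *ᵥ v.ofLp)

/-- The partial derivative `∂ⱼ f`. -/
def pd (j : Fin 3) (f : R3 → ℂ) (x : R3) : ℂ := fderiv ℝ f x (EuclideanSpace.single j 1)

/-- The gradient of a complex-valued function. -/
def grad (f : R3 → ℂ) (x : R3) : C3 := WithLp.toLp 2 fun j => pd j f x

/-- The classical curl of a `ℂ³`-valued field. -/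
def curl (F : R3 → C3) (x : R3) : C3 :=
  WithLp.toLp 2 ![pd 1 (fun y => F y 2) x - pd 2 (fun y => F y 1) x,
    pd 2 (fun y => F y 0) x - pd 0 (fun y => F y 2) x,
    pd 0 (fun y => F y 1) x - pd 1 (fun y => F y 0) x]

/-- The exponential `e_κ(y) = exp(i κ · y)`. -/
def ex (κ y : R3) : ℂ := Complex.exp (Complex.I * ((inner ℝ κ y : ℝ) : ℂ))

/-- The quasiperiodic gradient `conj(e_κ) ∇(e_κ φ)`. -/
def qgrad (κ : R3) (φ : R3 → ℂ) (y : R3) : C3 :=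
  conj (ex κ y) • grad (fun z => ex κ z * φ z) y

/-! ### Periodicity and measures -/

/-- The unit cell `Q = [0,1)³`. -/
def cell : Set R3 := {y | ∀ i, 0 ≤ y i ∧ y i < 1}

/-- A vector of the lattice `ℤ³`. -/
def latticeVec (n : Fin 3 → ℤ) : R3 := WithLp.toLp 2 fun i => (n i : ℝ)

/-- `Q`-periodic functions. -/
def IsPeriodicFun {α : Type*} (f : R3 → α) : Prop :=
  ∀ (n : Fin 3 → ℤ) (y : R3), f (y + latticeVec n) = f y

/-- `Q`-periodic measures. -/
def IsPeriodicMeasure (μ : Measure R3) : Prop :=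
  ∀ n : Fin 3 → ℤ, μ.map (fun y => y + latticeVec n) = μ

/-- The measure `μ^ε`, with `μ^ε(B) = ε³ μ(ε⁻¹ B)`. -/
def scaledMeasure (μ : Measure R3) (ε : ℝ) : Measure R3 :=
  ENNReal.ofReal (ε ^ 3) • μ.map (fun y => ε • y)

/-- The space `C^∞_#(Q)` of smooth `Q`-periodic functions. -/
def IsSmoothPeriodic (φ : R3 → ℂ) : Prop := ContDiff ℝ ∞ φ ∧ IsPeriodicFun φ

/-- The space `C^∞_{#,0}(Q)` of smooth `Q`-periodic functions with zero mean over `(Q, μ)`. -/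
def IsSmoothPeriodicZeroMean (μ : Measure R3) (φ : R3 → ℂ) : Prop :=
  IsSmoothPeriodic φ ∧ ∫ y in cell, φ y ∂μ = 0

/-! ### Powers of the coefficient matrix -/

/-- `A^{1/2}(y)`: the positive semidefinite square root, acting on `ℂ³`. -/
def sqrtC (A : R3 → MatR) (y : R3) : MatC := (CFC.sqrt (A y)).map (fun t : ℝ => (t : ℂ))

/-- `A^{-1}(y)`, acting on `ℂ³`. -/
def invC (A : R3 → MatR) (y : R3) : MatC := ((A y)⁻¹).map (fun t : ℝ => (t : ℂ))

/-! ### The Maxwell problem in the whole space -/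

/-- `(u, v)` belongs to `H¹_{curl A^{1/2}}(ℝ³, ν)`, where `M` is the field of matrices `A^{1/2}`:
the closure in `L² ⊕ L²` of the pairs `(φ, curl (M φ))` with `M φ ∈ C₀^∞(ℝ³)`. -/
def IsHCurlPair (ν : Measure R3) (M : R3 → MatC) (u v : R3 → C3) : Prop :=
  MemLp u 2 ν ∧ MemLp v 2 ν ∧ ∃ φ : ℕ → R3 → C3,
    (∀ k, ContDiff ℝ ∞ (fun x => act (M x) (φ k x)) ∧
      HasCompactSupport (fun x => act (M x) (φ k x))) ∧
    Tendsto (fun k => eLpNorm (fun x => u x - φ k x) 2 ν) atTop (𝓝 0) ∧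
    Tendsto (fun k => eLpNorm (fun x => v x - curl (fun z => act (M z) (φ k z)) x) 2 ν)
      atTop (𝓝 0)

/-- `div g = 0` with respect to `ν`, in the sense of the integral identity. -/
def IsDivFree (ν : Measure R3) (g : R3 → C3) : Prop :=
  ∀ φ : R3 → ℂ, ContDiff ℝ ∞ φ → HasCompactSupport φ → ∫ x, inner ℂ (grad φ x) (g x) ∂ν = 0

/-- The pair `(D, v)`, `v` being the curl of `M D`, is the weak solution of
`M curl curl (M D) + D = - M g`, where `M` is the field of matrices `A^{1/2}`. -/
def IsMaxwellSolution (ν : Measure R3) (M : R3 → MatC) (g D v : R3 → C3) : Prop :=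
  IsHCurlPair ν M D v ∧ ∀ φ w : R3 → C3, IsHCurlPair ν M φ w →
    (∫ x, inner ℂ (w x) (v x) ∂ν) + (∫ x, inner ℂ (φ x) (D x) ∂ν)
      = - ∫ x, inner ℂ (φ x) (act (M x) (g x)) ∂ν

/-! ### The cell problem and the homogenised symbol -/

/-- `ψ` is an element of `H¹_{#,0}(Q, μ)` and `p` is its quasiperiodic gradient
`conj(e_κ) ∇(e_κ ψ)`; both are extended periodically to `ℝ³`. -/
def IsH1ZeroPair (μ : Measure R3) (κ : R3) (ψ : R3 → ℂ) (p : R3 → C3) : Prop :=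
  IsPeriodicFun ψ ∧ IsPeriodicFun p ∧
  MemLp ψ 2 (μ.restrict cell) ∧ MemLp p 2 (μ.restrict cell) ∧
  ∃ φ : ℕ → R3 → ℂ, (∀ k, IsSmoothPeriodicZeroMean μ (φ k)) ∧
    Tendsto (fun k => eLpNorm (fun y => ψ y - φ k y) 2 (μ.restrict cell)) atTop (𝓝 0) ∧
    Tendsto (fun k => eLpNorm (fun y => p y - qgrad κ (φ k) y) 2 (μ.restrict cell)) atTop (𝓝 0)

/-- `ψ ∈ H¹_{#,0}(Q, μ)`, with `p = conj(e_κ) ∇(e_κ ψ)`, is the weak solution of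
`conj(e_κ) div A⁻¹ (∇(e_κ ψ) + e_κ c) = 0`. -/
def IsCellSolution (μ : Measure R3) (A : R3 → MatR) (κ : R3) (c : C3)
    (ψ : R3 → ℂ) (p : R3 → C3) : Prop :=
  IsH1ZeroPair μ κ ψ p ∧ ∀ φ : R3 → ℂ, IsSmoothPeriodicZeroMean μ φ →
    ∫ y in cell, inner ℂ (grad (fun z => ex κ z * φ z) y)
      (ex κ y • act (invC A y) (p y + c)) ∂μ = 0

/-- The family of vector functions `Ψ_κ = (Ψ κ 0, Ψ κ 1, Ψ κ 2)`, `κ ∈ ℝ³`, solves the cell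
problems `conj(e_κ) div A⁻¹ (∇(e_κ Ψ_κ) + e_κ I) = 0`, and `P κ j` is the `j`-th column
`conj(e_κ) ∇(e_κ Ψ κ j)` of the matrix `conj(e_κ) ∇(e_κ Ψ_κ)`. -/
def IsCellFamily (μ : Measure R3) (A : R3 → MatR)
    (Ψ : R3 → Fin 3 → R3 → ℂ) (P : R3 → Fin 3 → R3 → C3) : Prop :=
  ∀ (κ : R3) (j : Fin 3), IsCellSolution μ A κ (EuclideanSpace.single j 1) (Ψ κ j) (P κ j)

/-- The matrix `conj(e_κ(y)) ∇(e_κ Ψ_κ)(y) + I`. -/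
def cellMatrix (P : R3 → Fin 3 → R3 → C3) (κ y : R3) : MatC :=
  Matrix.of (fun i j => P κ j y i) + 1

/-- `Â_κ^hom = ∫_Q A⁻¹ (conj(e_κ) ∇(e_κ Ψ_κ) + I) dμ`. -/
def homMatrix (μ : Measure R3) (A : R3 → MatR) (P : R3 → Fin 3 → R3 → C3) (κ : R3) : MatC :=
  Matrix.of fun i j => ∫ y in cell, (invC A y * cellMatrix P κ y) i j ∂μ

/-- The matrix of the map `v ↦ i θ × v`. -/
def crossMatrix (θ : R3) : MatC :=
  Complex.I • (!![0, -(θ 2 : ℂ), (θ 1 : ℂ);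
                  (θ 2 : ℂ), 0, -(θ 0 : ℂ);
                  -(θ 1 : ℂ), (θ 0 : ℂ), 0] : MatC)

/-- `𝔄_θ^hom = iθ × iθ × (Â_{εθ}^hom)⁻¹`. -/
def homSymbol (μ : Measure R3) (A : R3 → MatR) (P : R3 → Fin 3 → R3 → C3) (ε : ℝ) (θ : R3) :
    MatC :=
  crossMatrix θ * crossMatrix θ * (homMatrix μ A P (ε • θ))⁻¹

/-- The two-scale symbol
`A^{-1/2} (conj(e_{εθ}) ∇(e_{εθ} Ψ_{εθ}) + I) (Â_{εθ}^hom)⁻¹ (𝔄_θ^hom + I)⁻¹` at `y = x / ε`. -/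
def twoScaleSymbol (μ : Measure R3) (A : R3 → MatR) (P : R3 → Fin 3 → R3 → C3) (ε : ℝ)
    (θ x : R3) : MatC :=
  (sqrtC A (ε⁻¹ • x))⁻¹ * cellMatrix P (ε • θ) (ε⁻¹ • x) *
    (homMatrix μ A P (ε • θ))⁻¹ * (homSymbol μ A P ε θ + 1)⁻¹

/-! ### The pseudo-differential operator -/

/-- `ghat` is the Fourier transform `(2π)^{-3/2} ∫ g conj(e_θ) dν` of `g ∈ L²(ν)`: the limit in
`L²_loc(ℝ³, dθ)` of the transforms of the truncations of `g` to the balls of radius `n`. -/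
def IsFourierTransform (ν : Measure R3) (g ghat : R3 → C3) : Prop :=
  AEStronglyMeasurable ghat volume ∧
  ∀ r : ℝ, Tendsto (fun n : ℕ => eLpNorm (fun θ => ghat θ -
      ((2 * Real.pi) ^ (-(3 / 2) : ℝ) : ℝ) •
        ∫ x in Metric.ball (0 : R3) n, conj (ex θ x) • g x ∂ν)
    2 (volume.restrict (Metric.ball (0 : R3) r))) atTop (𝓝 0)

/-- `u = (2π)^{-3/2} ∫_{ℝ³} S(θ, ·) ghat(θ) e_θ dθ`, where `ghat` is the Fourier transform of `g`:
the integral over `θ` of vector fields is understood weakly, that is, it converges absolutely after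
pairing with any test field in `C₀^∞(ℝ³)`. -/
def IsPseudoDiffImage (ν : Measure R3) (S : R3 → R3 → MatC) (g u : R3 → C3) : Prop :=
  ∃ ghat : R3 → C3, IsFourierTransform ν g ghat ∧
    ∀ h : R3 → C3, ContDiff ℝ ∞ h → HasCompactSupport h →
      Integrable (fun θ => ∫ x, inner ℂ (h x) (ex θ x • act (S θ x) (ghat θ)) ∂ν) volume ∧
      ∫ x, inner ℂ (h x) (u x) ∂ν =
        ((2 * Real.pi) ^ (-(3 / 2) : ℝ) : ℝ) •
          ∫ θ, ∫ x, inner ℂ (h x) (ex θ x • act (S θ x) (ghat θ)) ∂ν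

end

end MaxwellHom

/-! The gradient condition annihilates every nonzero Fourier coefficient of `μ` on the torus, so `μ`
is Lebesgue measure (`eq_volume_of_integral_pd`) and so is every `μ^ε`. With `S = A^{-1/2}(·/ε)` and
`B = A^{1/2}(·/ε) D_ε` the problem reads `curl curl B + S² B = -g`. The estimates see `A` only
through a common bound `b` of `A^{1/2}` and `A^{-1/2}`.

The approximation of `-B` is a superposition `U` of corrected plane waves: `e_θ(x)`, times the
corrected field of the cell problem at `x/ε`, with density `w(θ)` solving `(iθ × iθ × + Â_{εθ}) w =
ĝ`. The corrector is a gradient, so it does not change the curl of a plane wave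
(`IsBlochFamily.blochT_of_transversal`). Hence `curl curl U + S² U = g + R`, where `R`
(`fluxDefect`) is the flux `S² U` minus the homogenised flux with transform `Â w`. For `Z = B + U`
this gives `curl curl Z + S² Z = R`, and therefore `‖curl Z‖² + ‖S Z‖² = ⟨Z, R⟩`.

The right-hand side is of order `ε` for two reasons. If `w` lives on the fundamental domain
`lowFreq` of the dual lattice of scale `1/ε`, then `R` contains only frequencies outside it, because
the flux of a cell solution differs from its mean by nonzero modes (`fourier_fluxDefect_eq_zero`).
As `R` is also divergence free, pairing it with `Z` gains a factor `1/|θ| ≤ ε` against `curl Z`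
(`norm_inner_le_of_highFreq`). The remaining part of `w` is itself of size `ε ‖g‖`, since on
transversal data the inverse symbol gains `1/|θ|` (`norm_mul_norm_symbol_inv_le`).
`norm_add_synth_le` combines both parts.

The superposition has to be bounded on `L²` uniformly in `ε`. This rests on
`IsBlochFamily.exists_summable_bound`: a field on the cell is split into a transversal part and the
flux of a longitudinal one, and each part pairs with a corrected field through a single Fourier
mode. Parseval's identity then bounds the pairings over a whole coset of quasimomenta, without any
lower bound on `|κ + 2πm|` and without regularity of the correctors. Measurability in `κ` is
obtained from the variational characterisation of the cell solutions (`IsWeight.measurable_energy`).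
-/

namespace MaxwellHom

/-! ### Reduction to Lebesgue measure. -/

noncomputable section

/-! ### Exponentials -/

/-- The frequency `2π m` dual to the unit lattice. -/
def freq (m : Fin 3 → ℤ) : R3 := (2 * Real.pi) • latticeVec m

lemma latticeVec_apply (m : Fin 3 → ℤ) (i : Fin 3) : latticeVec m i = (m i : ℝ) := rfl

lemma freq_apply (m : Fin 3 → ℤ) (i : Fin 3) : freq m i = 2 * Real.pi * m i := rfl

lemma latticeVec_add (m n : Fin 3 → ℤ) : latticeVec (m + n) = latticeVec m + latticeVec n := by
  ext i; simp [latticeVec_apply]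

lemma latticeVec_neg (m : Fin 3 → ℤ) : latticeVec (-m) = -latticeVec m := by
  ext i; simp [latticeVec_apply]

lemma latticeVec_zero : latticeVec 0 = 0 := by
  ext i; simp [latticeVec_apply]

lemma freq_add (m n : Fin 3 → ℤ) : freq (m + n) = freq m + freq n := by
  simp [freq, latticeVec_add]

lemma freq_neg (m : Fin 3 → ℤ) : freq (-m) = -freq m := by
  simp [freq, latticeVec_neg]

lemma freq_zero : freq 0 = 0 := by
  simp [freq, latticeVec_zero]

lemma ex_zero (y : R3) : ex 0 y = 1 := by simp [ex]

lemma ex_add_left (κ κ' y : R3) : ex (κ + κ') y = ex κ y * ex κ' y := by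
  simp [ex, inner_add_left, mul_add, Complex.exp_add]

lemma ex_add_right (κ y y' : R3) : ex κ (y + y') = ex κ y * ex κ y' := by
  simp [ex, inner_add_right, mul_add, Complex.exp_add]

lemma norm_ex (κ y : R3) : ‖ex κ y‖ = 1 := by
  rw [ex, mul_comm, Complex.norm_exp_ofReal_mul_I]

lemma conj_ex (κ y : R3) : conj (ex κ y) = ex (-κ) y := by
  simp [ex, ← Complex.exp_conj]

lemma conj_ex_mul_ex (κ y : R3) : conj (ex κ y) * ex κ y = 1 := by
  rw [conj_ex, ← ex_add_left]; simp [ex]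

lemma ex_mul_conj_ex (κ y : R3) : ex κ y * conj (ex κ y) = 1 := by
  rw [mul_comm, conj_ex_mul_ex]

lemma contDiff_ex (κ : R3) : ContDiff ℝ ∞ (ex κ) := by
  unfold ex
  have h : ContDiff ℝ ∞ (fun y : R3 => ((inner ℝ κ y : ℝ) : ℂ)) :=
    Complex.ofRealCLM.contDiff.comp (contDiff_const.inner ℝ contDiff_id)
  exact (contDiff_const.mul h).cexp

lemma continuous_ex : Continuous fun p : R3 × R3 => ex p.1 p.2 := by
  unfold ex; fun_prop

@[fun_prop]
lemma Continuous.ex {α : Type*} [TopologicalSpace α] {f g : α → R3} (hf : Continuous f)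
    (hg : Continuous g) : Continuous fun a => ex (f a) (g a) :=
  continuous_ex.comp (hf.prodMk hg)

lemma hasFDerivAt_ex (κ y : R3) :
    HasFDerivAt (ex κ) ((Complex.I * ex κ y) • Complex.ofRealCLM.comp (innerSL ℝ κ)) y := by
  have h : HasFDerivAt (fun y : R3 => Complex.I * ((inner ℝ κ y : ℝ) : ℂ))
      (Complex.I • Complex.ofRealCLM.comp (innerSL ℝ κ)) y :=
    ((Complex.ofRealCLM.comp (innerSL ℝ κ)).hasFDerivAt).const_mul Complex.I
  have h' := h.cexp
  rw [smul_smul, mul_comm] at h'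
  exact h'

lemma pd_ex (j : Fin 3) (κ y : R3) : pd j (ex κ) y = Complex.I * (κ j : ℂ) * ex κ y := by
  rw [pd, (hasFDerivAt_ex κ y).fderiv]
  simp only [smul_apply, ContinuousLinearMap.comp_apply, innerSL_apply_apply,
    EuclideanSpace.inner_single_right, Complex.ofRealCLM_apply, smul_eq_mul]
  simp
  ring

lemma ex_freq_latticeVec (m n : Fin 3 → ℤ) : ex (freq m) (latticeVec n) = 1 := by
  have h : ((inner ℝ (freq m) (latticeVec n) : ℝ) : ℂ)
      = ((∑ i, m i * n i : ℤ) : ℂ) * (2 * Real.pi) := by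
    simp only [PiLp.inner_apply, freq_apply, latticeVec_apply, RCLike.inner_apply, conj_trivial]
    push_cast
    rw [Finset.sum_mul]
    exact Finset.sum_congr rfl fun i _ => by ring
  rw [ex, h, ← Complex.exp_int_mul_two_pi_mul_I (∑ i, m i * n i : ℤ)]
  congr 1; ring

lemma isPeriodicFun_ex_freq (m : Fin 3 → ℤ) : IsPeriodicFun (ex (freq m)) := by
  intro n y
  rw [ex_add_right, ex_freq_latticeVec, mul_one]

lemma isSmoothPeriodic_ex_freq (m : Fin 3 → ℤ) : IsSmoothPeriodic (ex (freq m)) :=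
  ⟨contDiff_ex _, isPeriodicFun_ex_freq m⟩

/-! ### The torus -/

/-- The quotient map `ℝ³ → (ℝ/ℤ)³`. -/
def torusMap (y : R3) : UnitAddTorus (Fin 3) := fun i => (y i : UnitAddCircle)

/-- The section of `torusMap` with values in the unit cell. -/
def torusSection (t : UnitAddTorus (Fin 3)) : R3 :=
  WithLp.toLp 2 fun i => (AddCircle.measurableEquivIco (1 : ℝ) 0 (t i)).1

lemma measurable_torusMap : Measurable torusMap :=
  measurable_pi_lambda _ fun i => AddCircle.measurable_mk'.comp (by fun_prop)

lemma measurable_torusSection : Measurable torusSection := by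
  refine (PiLp.continuous_toLp 2 _).measurable.comp (measurable_pi_lambda _ fun i => ?_)
  exact measurable_subtype_coe.comp
    ((AddCircle.measurableEquivIco (1 : ℝ) 0).measurable.comp (measurable_pi_apply i))

lemma torusSection_torusMap {y : R3} (hy : y ∈ cell) : torusSection (torusMap y) = y := by
  ext i
  have h : y i ∈ Set.Ico (0 : ℝ) (0 + 1) := by simpa using hy i
  change ((AddCircle.equivIco (1 : ℝ) 0) ((y i : ℝ) : AddCircle (1 : ℝ))).1 = y i
  rw [AddCircle.equivIco_coe_eq h]

lemma ex_freq (m : Fin 3 → ℤ) (y : R3) :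
    ex (freq m) y = UnitAddTorus.mFourier m (torusMap y) := by
  change _ = ∏ i, fourier (m i) ((y i : ℝ) : AddCircle (1 : ℝ))
  simp only [fourier_coe_apply, ← Complex.exp_sum]
  rw [ex]
  congr 1
  simp only [PiLp.inner_apply, freq_apply, RCLike.inner_apply, conj_trivial]
  push_cast
  rw [Finset.mul_sum]
  exact Finset.sum_congr rfl fun i _ => by ring

lemma measurableSet_cell : MeasurableSet cell := by
  have : cell = ⋂ i : Fin 3, {y : R3 | 0 ≤ y i ∧ y i < 1} := by
    ext y; simp [cell]
  rw [this]
  refine MeasurableSet.iInter fun i => ?_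
  have h : Measurable fun y : R3 => y i := by fun_prop
  exact (measurableSet_le measurable_const h).inter (measurableSet_lt h measurable_const)

/-- The integer part of a point of `ℝ³`. -/
def floorVec (y : R3) : Fin 3 → ℤ := fun i => ⌊y i⌋

lemma sub_floorVec_mem_cell (y : R3) : y - latticeVec (floorVec y) ∈ cell := by
  intro i
  exact ⟨sub_nonneg.2 (Int.floor_le _), by
    have := Int.lt_floor_add_one (y i)
    change y i - (⌊y i⌋ : ℝ) < 1
    linarith⟩

lemma floorVec_eq_of_mem {y : R3} {n : Fin 3 → ℤ} (h : y - latticeVec n ∈ cell) :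
    floorVec y = n := by
  funext i
  have h1 : (0 : ℝ) ≤ y i - n i := (h i).1
  have h2 : y i - n i < (1 : ℝ) := (h i).2
  exact Int.floor_eq_iff.2 ⟨by linarith, by linarith⟩

/-- The translate of the unit cell by a lattice vector. -/
def cellAt (n : Fin 3 → ℤ) : Set R3 := (fun y => y - latticeVec n) ⁻¹' cell

lemma measurableSet_cellAt (n : Fin 3 → ℤ) : MeasurableSet (cellAt n) :=
  (measurable_id.sub_const _) measurableSet_cell

lemma iUnion_cellAt : ⋃ n, cellAt n = Set.univ :=
  Set.eq_univ_of_forall fun y => Set.mem_iUnion.2 ⟨floorVec y, sub_floorVec_mem_cell y⟩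

lemma disjoint_cellAt {m n : Fin 3 → ℤ} (h : m ≠ n) : Disjoint (cellAt m) (cellAt n) :=
  Set.disjoint_left.2 fun _ hm hn => h ((floorVec_eq_of_mem hm).symm.trans (floorVec_eq_of_mem hn))

lemma restrict_cellAt {μ : Measure R3} (hμ : IsPeriodicMeasure μ) (n : Fin 3 → ℤ) :
    μ.restrict (cellAt n) = (μ.restrict cell).map (fun y => y + latticeVec n) := by
  have hm : Measurable fun y : R3 => y + latticeVec n := measurable_id.add_const _
  have h : (fun y : R3 => y + latticeVec n) ⁻¹' cellAt n = cell := by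
    ext y; simp [cellAt]
  conv_lhs => rw [← hμ n]
  rw [Measure.restrict_map hm (measurableSet_cellAt n), h]

lemma isPeriodicMeasure_volume : IsPeriodicMeasure (volume : Measure R3) := fun n =>
  (measurePreserving_add_right volume (latticeVec n)).map_eq

/-- The lattice translates of the cell tile the space, and periodicity copies the measure from one
tile to the others. -/
lemma eq_of_restrict_cell_eq {μ ν : Measure R3} (hμ : IsPeriodicMeasure μ)
    (hν : IsPeriodicMeasure ν) (h : μ.restrict cell = ν.restrict cell) : μ = ν :=
  (Measure.ext_iff_of_iUnion_eq_univ iUnion_cellAt).2 fun n => by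
    rw [restrict_cellAt hμ, restrict_cellAt hν, h]

/-- Passing to the torus and back loses nothing, so measures on the cell may be compared on the
torus, where the characters span a dense space of continuous functions. -/
lemma map_torusSection_map (μ : Measure R3) :
    ((μ.restrict cell).map torusMap).map torusSection = μ.restrict cell := by
  rw [Measure.map_map measurable_torusSection measurable_torusMap]
  conv_rhs => rw [← Measure.map_id (μ := μ.restrict cell)]
  refine Measure.map_congr ?_
  filter_upwards [ae_restrict_mem measurableSet_cell] with y hy
  exact torusSection_torusMap hy

/-- Two finite measures on the torus with the same Fourier coefficients agree. -/
lemma torus_measure_ext {ν₁ ν₂ : Measure (UnitAddTorus (Fin 3))} [IsFiniteMeasure ν₁]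
    [IsFiniteMeasure ν₂]
    (h : ∀ m, ∫ t, UnitAddTorus.mFourier m t ∂ν₁ = ∫ t, UnitAddTorus.mFourier m t ∂ν₂) :
    ν₁ = ν₂ := by
  have hint : ∀ (ν : Measure (UnitAddTorus (Fin 3))) [IsFiniteMeasure ν]
      (f : C(UnitAddTorus (Fin 3), ℂ)), Integrable f ν := fun ν _ f =>
    (BoundedContinuousFunction.mkOfCompact f).integrable ν
  have key : ∀ f : C(UnitAddTorus (Fin 3), ℂ), ∫ t, f t ∂ν₁ = ∫ t, f t ∂ν₂ := by
    -- Integration factors through `L¹` and is a continuous functional on continuous functions.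
    -- Equality on the characters thus extends to their closed span, which is everything by
    -- Stone–Weierstrass.
    let L : ∀ (ν : Measure (UnitAddTorus (Fin 3))) [IsFiniteMeasure ν],
        C(UnitAddTorus (Fin 3), ℂ) →L[ℂ] ℂ := fun ν _ =>
      (L1.integralCLM' ℂ).comp (ContinuousMap.toLp 1 ν ℂ)
    have hL : ∀ (ν : Measure (UnitAddTorus (Fin 3))) [IsFiniteMeasure ν]
        (f : C(UnitAddTorus (Fin 3), ℂ)), L ν f = ∫ t, f t ∂ν := fun ν _ f => by
      have h1 : L ν f = L1.integral (ContinuousMap.toLp 1 ν ℂ f) :=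
        (L1.integral_eq' ℂ _).symm
      rw [h1, L1.integral_eq_integral]
      exact integral_congr_ae (ContinuousMap.coeFn_toLp ν f)
    have hset : ∀ f ∈ (Submodule.span ℂ (Set.range
        (UnitAddTorus.mFourier (d := Fin 3)))).topologicalClosure, L ν₁ f = L ν₂ f := by
      intro f hf
      have hcl : IsClosed {f | L ν₁ f = L ν₂ f} := isClosed_eq (L ν₁).continuous (L ν₂).continuous
      refine closure_minimal (fun g hg => ?_) hcl hf
      have := LinearMap.eqOn_span (f := (L ν₁).toLinearMap) (g := (L ν₂).toLinearMap)
        (s := Set.range (UnitAddTorus.mFourier (d := Fin 3)))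
        (by rintro _ ⟨m, rfl⟩; simpa [hL] using h m)
      exact this hg
    intro f
    rw [← hL, ← hL]
    exact hset f (by rw [UnitAddTorus.span_mFourier_closure_eq_top]; trivial)
  refine ext_of_forall_integral_eq_of_IsFiniteMeasure fun f => ?_
  have := key ⟨fun t => (f t : ℂ), Complex.continuous_ofReal.comp f.continuous⟩
  simp only [ContinuousMap.coe_mk, integral_complex_ofReal] at this
  exact_mod_cast this

/-- The product form lets cell integrals of characters factor into one-dimensional integrals. -/
lemma volume_restrict_cell :
    (volume : Measure R3).restrict cell
      = (Measure.pi fun _ : Fin 3 => (volume : Measure ℝ).restrict (Set.Ico 0 1)).map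
          (WithLp.toLp 2) := by
  rw [← Measure.restrict_pi_pi, ← volume_pi,
    ← (PiLp.volume_preserving_toLp (Fin 3)).map_eq,
    Measure.restrict_map (by fun_prop) measurableSet_cell]
  congr 2
  ext y
  simp [cell, Set.mem_pi]

lemma integral_cell_ex_freq (m : Fin 3 → ℤ) :
    ∫ y in cell, ex (freq m) y = if m = 0 then 1 else 0 := by
  have h1 : ∀ k : ℤ, ∫ x in Set.Ico (0 : ℝ) 1, fourier k ((x : ℝ) : UnitAddCircle)
      = if k = 0 then 1 else 0 := by
    intro k
    rw [MeasureTheory.integral_Ico_eq_integral_Ioc, ← intervalIntegral.integral_of_le zero_le_one]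
    rcases eq_or_ne k 0 with rfl | hk
    · simp
    · simp only [fourier_coe_apply, hk, if_false]
      have hc : (2 * Real.pi * Complex.I * k : ℂ) ≠ 0 := by
        simp [Real.pi_ne_zero, Complex.I_ne_zero, hk]
      have : ∀ x : ℝ, Complex.exp (2 * Real.pi * Complex.I * k * x / (1 : ℝ))
          = Complex.exp ((2 * Real.pi * Complex.I * k) * x) := fun x => by simp
      simp only [this]
      rw [integral_exp_mul_complex hc]
      have h2 : Complex.exp (2 * Real.pi * Complex.I * k * (1 : ℝ)) = 1 := by
        rw [Complex.exp_eq_one_iff]; exact ⟨k, by push_cast; ring⟩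
      rw [h2]; simp
  rw [volume_restrict_cell, integral_map (by fun_prop) (by
    exact (Continuous.ex continuous_const continuous_id).aestronglyMeasurable)]
  simp only [ex_freq]
  change ∫ x : Fin 3 → ℝ, ∏ i, fourier (m i) ((x i : ℝ) : UnitAddCircle) ∂_ = _
  rw [MeasureTheory.integral_fintype_prod_eq_prod
    (f := fun i (x : ℝ) => fourier (m i) ((x : ℝ) : UnitAddCircle))]
  simp only [h1]
  rw [Fintype.prod_ite_zero]
  simp [funext_iff]

lemma volume_cell : (volume : Measure R3) cell = 1 := by
  have : (volume : Measure R3).restrict cell Set.univ = 1 := by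
    rw [volume_restrict_cell, Measure.map_apply (by fun_prop) MeasurableSet.univ]
    simp [Measure.pi_univ]
  simpa using this

instance : IsProbabilityMeasure ((volume : Measure R3).restrict cell) :=
  ⟨by simp [volume_cell]⟩

/-- A periodic measure which annihilates all derivatives of smooth periodic functions and is
normalised on the cell is the Lebesgue measure. -/
lemma eq_volume_of_integral_pd {μ : Measure R3} (hμ_per : IsPeriodicMeasure μ)
    (hμ_cell : μ cell = 1)
    (hμ_grad : ∀ φ : R3 → ℂ, IsSmoothPeriodic φ → ∀ j : Fin 3, ∫ y in cell, pd j φ y ∂μ = 0) :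
    μ = volume := by
  refine eq_of_restrict_cell_eq hμ_per isPeriodicMeasure_volume ?_
  have : IsFiniteMeasure (μ.restrict cell) := ⟨by simp [hμ_cell]⟩
  have : IsFiniteMeasure ((μ.restrict cell).map torusMap) := inferInstance
  rw [← map_torusSection_map μ, ← map_torusSection_map volume]
  congr 1
  refine torus_measure_ext fun m => ?_
  rw [integral_map measurable_torusMap.aemeasurable
      (UnitAddTorus.mFourier m).continuous.aestronglyMeasurable,
    integral_map measurable_torusMap.aemeasurable
      (UnitAddTorus.mFourier m).continuous.aestronglyMeasurable]
  simp only [← ex_freq]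
  rw [integral_cell_ex_freq]
  split_ifs with hm
  · subst hm
    simp [freq_zero, ex_zero, Measure.real, hμ_cell]
  -- In a direction with `m j ≠ 0` the derivative of the character is a nonzero multiple of the
  -- character, so the gradient condition makes its integral vanish.
  · obtain ⟨j, hj⟩ := Function.ne_iff.1 hm
    have h := hμ_grad _ (isSmoothPeriodic_ex_freq m) j
    simp only [pd_ex] at h
    rw [integral_const_mul] at h
    refine (mul_eq_zero.1 h).resolve_left ?_
    have : (m j : ℂ) ≠ 0 := by simpa using hj
    simp [freq_apply, this, Real.pi_ne_zero]

/-- The factor `ε ^ 3` compensates the Jacobian of the dilation. -/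
lemma scaledMeasure_volume {ε : ℝ} (hε : 0 < ε) : scaledMeasure volume ε = volume := by
  rw [scaledMeasure, Measure.map_addHaar_smul volume hε.ne', smul_smul]
  have : Module.finrank ℝ R3 = 3 := by simp
  rw [this, abs_of_pos (by positivity), ← ENNReal.ofReal_mul (by positivity),
    mul_inv_cancel₀ (by positivity)]
  simp

end

end MaxwellHom

/-! ### Fourier coefficients and Parseval's identity on the cell. -/

namespace MaxwellHom

noncomputable section

/-! ### Fourier series on the cell -/

/-- Lebesgue measure on the unit cell. -/
abbrev cellVol : Measure R3 := (volume : Measure R3).restrict cell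

/-- The `m`-th Fourier coefficient over the unit cell. -/
def fc {E : Type*} [NormedAddCommGroup E] [NormedSpace ℂ E] (m : Fin 3 → ℤ) (f : R3 → E) : E :=
  ∫ y, conj (ex (freq m) y) • f y ∂cellVol

/-- The measure on the torus induced by Lebesgue measure on the cell. -/
def torusVol : Measure (UnitAddTorus (Fin 3)) := cellVol.map torusMap

instance : IsProbabilityMeasure torusVol :=
  Measure.isProbabilityMeasure_map measurable_torusMap.aemeasurable

lemma measurePreserving_torusMap : MeasurePreserving torusMap cellVol torusVol :=
  ⟨measurable_torusMap, rfl⟩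

lemma measurePreserving_torusSection : MeasurePreserving torusSection torusVol cellVol :=
  ⟨measurable_torusSection, map_torusSection_map volume⟩

lemma integral_torus_mFourier (m : Fin 3 → ℤ) :
    ∫ t, UnitAddTorus.mFourier m t ∂torusVol = if m = 0 then 1 else 0 := by
  rw [torusVol, integral_map measurable_torusMap.aemeasurable
      (UnitAddTorus.mFourier m).continuous.aestronglyMeasurable]
  simp only [← ex_freq]
  exact integral_cell_ex_freq m

lemma orthonormal_torus : Orthonormal ℂ (fun m : Fin 3 → ℤ =>
    ContinuousMap.toLp (E := ℂ) 2 torusVol ℂ (UnitAddTorus.mFourier m)) := by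
  rw [orthonormal_iff_ite]
  intro m n
  simp only [ContinuousMap.inner_toLp, ← UnitAddTorus.mFourier_neg, ← UnitAddTorus.mFourier_add,
    integral_torus_mFourier]
  simp only [← sub_eq_add_neg, sub_eq_zero, eq_comm (a := n)]

/-- The exponentials as a Hilbert basis of `L²` of the torus. -/
def torusBasis : HilbertBasis (Fin 3 → ℤ) ℂ (Lp ℂ 2 torusVol) :=
  HilbertBasis.mk orthonormal_torus (by
    have h := (ContinuousMap.toLp_denseRange ℂ torusVol ℂ (p := 2)
      (by simp)).topologicalClosure_map_submodule UnitAddTorus.span_mFourier_closure_eq_top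
    rw [Submodule.map_span, ← Set.range_comp] at h
    exact h.ge)

lemma torusBasis_apply (m : Fin 3 → ℤ) :
    torusBasis m = ContinuousMap.toLp (E := ℂ) 2 torusVol ℂ (UnitAddTorus.mFourier m) := by
  simp [torusBasis]

lemma inner_torusBasis (m : Fin 3 → ℤ) (F : Lp ℂ 2 torusVol) :
    inner ℂ (torusBasis m) F = fc m (fun y => F (torusMap y)) := by
  have h : inner ℂ (torusBasis m) F = ∫ t, conj (UnitAddTorus.mFourier m t) * F t ∂torusVol := by
    rw [L2.inner_def, torusBasis_apply]
    refine integral_congr_ae ?_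
    filter_upwards [ContinuousMap.coeFn_toLp (𝕜 := ℂ) (p := 2) torusVol
      (UnitAddTorus.mFourier m)] with t ht
    rw [ht, RCLike.inner_apply, mul_comm]
  rw [h]
  refine (integral_map (μ := cellVol) measurable_torusMap.aemeasurable ?_).trans ?_
  rotate_left
  · simp only [fc, ex_freq, smul_eq_mul]
  · exact ((Complex.continuous_conj.comp
      (UnitAddTorus.mFourier m).continuous).aestronglyMeasurable).mul
        (Lp.aestronglyMeasurable F)

lemma memLp_comp_torusSection {f : R3 → ℂ} (hf : MemLp f 2 cellVol) :
    MemLp (fun t => f (torusSection t)) 2 torusVol :=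
  hf.comp_measurePreserving measurePreserving_torusSection

lemma toLp_comp_torusSection {f : R3 → ℂ} (hf : MemLp f 2 cellVol) :
    (fun y => (memLp_comp_torusSection hf).toLp _ (torusMap y)) =ᵐ[cellVol] f := by
  have h := measurePreserving_torusMap.quasiMeasurePreserving.ae
    (memLp_comp_torusSection hf).coeFn_toLp
  filter_upwards [h, ae_restrict_mem measurableSet_cell] with y hy hc
  rw [hy, torusSection_torusMap hc]

lemma fc_congr {E : Type*} [NormedAddCommGroup E] [NormedSpace ℂ E] {f g : R3 → E}
    (h : f =ᵐ[cellVol] g) (m : Fin 3 → ℤ) : fc m f = fc m g :=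
  integral_congr_ae (by filter_upwards [h] with y hy; rw [hy])

/-- Parseval's identity for the Hilbert basis of characters on the torus, transported by the measure
preserving maps between torus and cell. -/
lemma hasSum_fc_scalar {f g : R3 → ℂ} (hf : MemLp f 2 cellVol) (hg : MemLp g 2 cellVol) :
    HasSum (fun m => conj (fc m f) * fc m g) (∫ y, conj (f y) * g y ∂cellVol) := by
  have h := torusBasis.hasSum_inner_mul_inner ((memLp_comp_torusSection hf).toLp _)
    ((memLp_comp_torusSection hg).toLp _)
  have h1 : ∀ m, inner ℂ (torusBasis m) ((memLp_comp_torusSection hf).toLp _) = fc m f :=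
    fun m => (inner_torusBasis m _).trans (fc_congr (toLp_comp_torusSection hf) m)
  have h2 : ∀ m, inner ℂ (torusBasis m) ((memLp_comp_torusSection hg).toLp _) = fc m g :=
    fun m => (inner_torusBasis m _).trans (fc_congr (toLp_comp_torusSection hg) m)
  have h3 : inner ℂ ((memLp_comp_torusSection hf).toLp _) ((memLp_comp_torusSection hg).toLp _)
      = ∫ y, conj (f y) * g y ∂cellVol := by
    rw [L2.inner_def]
    refine (integral_map (μ := cellVol) measurable_torusMap.aemeasurable ?_).trans ?_
    rotate_left
    · refine integral_congr_ae ?_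
      filter_upwards [toLp_comp_torusSection hf, toLp_comp_torusSection hg] with y hy hy'
      erw [hy, hy']
      rw [RCLike.inner_apply, mul_comm]
    · exact (L2.integrable_inner (𝕜 := ℂ) ((memLp_comp_torusSection hf).toLp _)
        ((memLp_comp_torusSection hg).toLp _)).aestronglyMeasurable
  rw [h3] at h
  refine h.congr_fun fun m => ?_
  rw [← inner_conj_symm _ (torusBasis m), h1, h2]

/-- A square summable family is the family of Fourier coefficients of a periodic function. -/
lemma exists_fc_eq {a : (Fin 3 → ℤ) → ℂ} (ha : Summable fun m => ‖a m‖ ^ 2) :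
    ∃ ψ : R3 → ℂ, IsPeriodicFun ψ ∧ MemLp ψ 2 cellVol ∧ ∀ m, fc m ψ = a m := by
  have hmem : Memℓp a 2 := memℓp_gen (by simpa using ha)
  let F : Lp ℂ 2 torusVol := torusBasis.repr.symm ⟨a, hmem⟩
  refine ⟨fun y => F (torusMap y), fun n y => ?_, ?_, fun m => ?_⟩
  · have : torusMap (y + latticeVec n) = torusMap y := by
      funext i
      have h1 : ((n i : ℝ) : UnitAddCircle) = 0 :=
        (AddCircle.coe_eq_zero_iff (1 : ℝ)).2 ⟨n i, by simp⟩
      change ((y i + n i : ℝ) : UnitAddCircle) = ((y i : ℝ) : UnitAddCircle)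
      rw [AddCircle.coe_add, h1, add_zero]
    simp only [this]
  · exact (Lp.memLp F).comp_measurePreserving measurePreserving_torusMap
  · rw [← inner_torusBasis, ← HilbertBasis.repr_apply_apply]
    simp [F]

lemma continuous_conj_ex (κ : R3) : Continuous fun y => conj (ex κ y) :=
  Complex.continuous_conj.comp (Continuous.ex continuous_const continuous_id)

lemma MemLp.conj_ex_smul {E : Type*} [NormedAddCommGroup E] [NormedSpace ℂ E] {f : R3 → E}
    {p : ℝ≥0∞} {μ : Measure R3} (hf : MemLp f p μ) (κ : R3) :
    MemLp (fun y => conj (ex κ y) • f y) p μ :=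
  hf.of_le ((continuous_conj_ex κ).aestronglyMeasurable.smul hf.1)
    (ae_of_all _ fun y => by rw [norm_smul, RCLike.norm_conj, norm_ex, one_mul])

lemma MemLp.ex_smul {E : Type*} [NormedAddCommGroup E] [NormedSpace ℂ E] {f : R3 → E}
    {p : ℝ≥0∞} {μ : Measure R3} (hf : MemLp f p μ) (κ : R3) :
    MemLp (fun y => ex κ y • f y) p μ :=
  hf.of_le ((Continuous.ex continuous_const continuous_id).aestronglyMeasurable.smul hf.1)
    (ae_of_all _ fun y => by rw [norm_smul, norm_ex, one_mul])

lemma integrable_of_memLp_cell {E : Type*} [NormedAddCommGroup E] {f : R3 → E}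
    (hf : MemLp f 2 cellVol) : Integrable f cellVol := hf.integrable one_le_two

lemma integrable_fc {E : Type*} [NormedAddCommGroup E] [NormedSpace ℂ E] {f : R3 → E}
    (hf : MemLp f 2 cellVol) (m : Fin 3 → ℤ) :
    Integrable (fun y => conj (ex (freq m) y) • f y) cellVol :=
  integrable_of_memLp_cell (MemLp.conj_ex_smul hf _)

lemma fc_add {E : Type*} [NormedAddCommGroup E] [NormedSpace ℂ E] {f g : R3 → E}
    (hf : MemLp f 2 cellVol) (hg : MemLp g 2 cellVol) (m : Fin 3 → ℤ) :
    fc m (fun y => f y + g y) = fc m f + fc m g := by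
  simp only [fc, smul_add]
  exact integral_add (integrable_fc hf m) (integrable_fc hg m)

lemma fc_sub {E : Type*} [NormedAddCommGroup E] [NormedSpace ℂ E] {f g : R3 → E}
    (hf : MemLp f 2 cellVol) (hg : MemLp g 2 cellVol) (m : Fin 3 → ℤ) :
    fc m (fun y => f y - g y) = fc m f - fc m g := by
  simp only [fc, smul_sub]
  exact integral_sub (integrable_fc hf m) (integrable_fc hg m)

lemma fc_smul {E : Type*} [NormedAddCommGroup E] [NormedSpace ℂ E] (f : R3 → E) (c : ℂ)
    (m : Fin 3 → ℤ) : fc m (fun y => c • f y) = c • fc m f := by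
  simp only [fc, smul_comm _ c]
  exact integral_smul c _

/-- Multiplication by an exponential shifts the Fourier coefficients. -/
lemma fc_conj_ex_smul {E : Type*} [NormedAddCommGroup E] [NormedSpace ℂ E] (f : R3 → E)
    (m n : Fin 3 → ℤ) : fc n (fun y => conj (ex (freq m) y) • f y) = fc (n + m) f := by
  simp only [fc, freq_add, ex_add_left, map_mul, mul_smul]

lemma fc_ex_smul_const {E : Type*} [NormedAddCommGroup E] [NormedSpace ℂ E] [CompleteSpace E]
    (c : E) (m n : Fin 3 → ℤ) :
    fc n (fun y => ex (freq m) y • c) = if n = m then c else 0 := by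
  have : ∀ y, conj (ex (freq n) y) • ex (freq m) y • c = ex (freq (m - n)) y • c := fun y => by
    rw [smul_smul, conj_ex, ← ex_add_left, ← freq_neg, ← freq_add, sub_eq_add_neg, add_comm]
  simp only [fc, this]
  rw [integral_smul_const, integral_cell_ex_freq]
  simp only [sub_eq_zero, eq_comm (a := m)]
  split_ifs <;> simp

lemma fc_const {E : Type*} [NormedAddCommGroup E] [NormedSpace ℂ E] [CompleteSpace E]
    (c : E) (n : Fin 3 → ℤ) : fc n (fun _ => c) = if n = 0 then c else 0 := by
  have := fc_ex_smul_const c 0 n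
  simpa [freq_zero, ex_zero] using this

lemma fc_apply {f : R3 → C3} (hf : MemLp f 2 cellVol) (m : Fin 3 → ℤ) (i : Fin 3) :
    fc m f i = fc m (fun y => f y i) :=
  ((EuclideanSpace.proj (𝕜 := ℂ) i).integral_comp_comm (integrable_fc hf m)).symm

lemma memLp_apply {μ : Measure R3} {p : ℝ≥0∞} {f : R3 → C3} (hf : MemLp f p μ) (i : Fin 3) :
    MemLp (fun y => f y i) p μ :=
  (EuclideanSpace.proj (𝕜 := ℂ) i).comp_memLp' hf

lemma inner_C3 (u v : C3) : inner ℂ u v = ∑ i, conj (u i) * v i := by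
  rw [PiLp.inner_apply]
  exact Finset.sum_congr rfl fun i _ => by rw [RCLike.inner_apply, mul_comm]

lemma integrable_inner {μ : Measure R3} {f g : R3 → C3} (hf : MemLp f 2 μ) (hg : MemLp g 2 μ) :
    Integrable (fun y => inner ℂ (f y) (g y)) μ := by
  have h := L2.integrable_inner (𝕜 := ℂ) (hf.toLp f) (hg.toLp g)
  refine h.congr ?_
  filter_upwards [hf.coeFn_toLp, hg.coeFn_toLp] with y h1 h2
  rw [h1, h2]

/-- Parseval's identity for vector fields on the cell. -/
lemma hasSum_fc {f g : R3 → C3} (hf : MemLp f 2 cellVol) (hg : MemLp g 2 cellVol) :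
    HasSum (fun m => inner ℂ (fc m f) (fc m g)) (∫ y, inner ℂ (f y) (g y) ∂cellVol) := by
  have h : HasSum (fun m => ∑ i, conj (fc m (fun y => f y i)) * fc m (fun y => g y i))
      (∑ i, ∫ y, conj (f y i) * g y i ∂cellVol) :=
    hasSum_sum fun i _ => hasSum_fc_scalar (memLp_apply hf i) (memLp_apply hg i)
  have hint : ∀ i, Integrable (fun y => conj (f y i) * g y i) cellVol := fun i => by
    have h1 := memLp_apply hf i
    have h2 := memLp_apply hg i
    have h1' : MemLp (fun y => conj (f y i)) 2 cellVol :=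
      h1.of_le (Complex.continuous_conj.comp_aestronglyMeasurable h1.1)
        (ae_of_all _ fun y => by rw [RCLike.norm_conj])
    exact h1'.integrable_mul h2
  rw [← integral_finsetSum _ fun i _ => hint i] at h
  simp only [inner_C3]
  convert h using 4 with m
  · rw [fc_apply hf]
  · rw [fc_apply hg]

lemma hasSum_sq_fc {f : R3 → C3} (hf : MemLp f 2 cellVol) :
    HasSum (fun m => ‖fc m f‖ ^ 2) (∫ y, ‖f y‖ ^ 2 ∂cellVol) := by
  have h := hasSum_fc hf hf
  simp only [inner_self_eq_norm_sq_to_K] at h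
  have h2 : (∫ y, ((‖f y‖ : ℂ)) ^ 2 ∂cellVol) = ((∫ y, ‖f y‖ ^ 2 ∂cellVol : ℝ) : ℂ) := by
    rw [← integral_complex_ofReal]; simp
  erw [h2] at h
  have h3 : HasSum (fun m => ((‖fc m f‖ ^ 2 : ℝ) : ℂ)) ((∫ y, ‖f y‖ ^ 2 ∂cellVol : ℝ) : ℂ) := by
    simpa using h
  exact (Complex.hasSum_ofReal).1 h3

lemma eq_zero_of_fc {f : R3 → C3} (hf : MemLp f 2 cellVol) (h : ∀ m, fc m f = 0) :
    f =ᵐ[cellVol] 0 := by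
  have h1 := hasSum_sq_fc hf
  simp only [h, norm_zero, ne_eq, OfNat.ofNat_ne_zero, not_false_eq_true, zero_pow] at h1
  have h2 := (integral_eq_zero_iff_of_nonneg (fun y => by positivity)
    (by simpa using (memLp_two_iff_integrable_sq_norm hf.1).1 hf)).1 (h1.unique hasSum_zero)
  filter_upwards [h2] with y hy
  simpa using hy

end

end MaxwellHom

/-! ### Matrix fields and the square roots of the coefficients. -/

namespace MaxwellHom

noncomputable section

/-! ### The action of matrices -/

lemma act_apply (M : MatC) (v : C3) (i : Fin 3) : act M v i = ∑ j, M i j * v j := rfl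

lemma act_add (M : MatC) (u v : C3) : act M (u + v) = act M u + act M v := by
  simp [act, Matrix.mulVec_add]

lemma act_sub (M : MatC) (u v : C3) : act M (u - v) = act M u - act M v := by
  simp [act, Matrix.mulVec_sub]

lemma act_neg (M : MatC) (v : C3) : act M (-v) = -act M v := by
  simp [act, Matrix.mulVec_neg]

lemma act_smul (M : MatC) (c : ℂ) (v : C3) : act M (c • v) = c • act M v := by
  simp [act, Matrix.mulVec_smul]

lemma act_zero (M : MatC) : act M 0 = 0 := by simp [act]

lemma act_mul (M N : MatC) (v : C3) : act (M * N) v = act M (act N v) := by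
  simp [act, Matrix.mulVec_mulVec]

lemma act_one (v : C3) : act 1 v = v := by simp [act]

lemma act_add_left (M N : MatC) (v : C3) : act (M + N) v = act M v + act N v := by
  simp [act, Matrix.add_mulVec]

lemma act_neg_left (M : MatC) (v : C3) : act (-M) v = -act M v := by
  simp [act, Matrix.neg_mulVec]

lemma inner_act_left (M : MatC) (u v : C3) : inner ℂ (act M u) v = inner ℂ u (act Mᴴ v) := by
  simp only [inner_C3, act_apply, Matrix.conjTranspose_apply, map_sum, map_mul, Finset.sum_mul,
    Finset.mul_sum, RCLike.star_def]
  rw [Finset.sum_comm]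
  exact Finset.sum_congr rfl fun i _ => Finset.sum_congr rfl fun j _ => by ring

lemma Continuous.act {α : Type*} [TopologicalSpace α] {M : α → MatC} {v : α → C3}
    (hM : Continuous M) (hv : Continuous v) : Continuous fun a => act (M a) (v a) := by
  refine (PiLp.continuous_toLp 2 _).comp ?_
  exact hM.matrix_mulVec ((PiLp.continuous_ofLp 2 _).comp hv)

lemma norm_apply_le (v : C3) (i : Fin 3) : ‖v i‖ ≤ ‖v‖ := PiLp.norm_apply_le v i

lemma norm_le_sum (v : C3) : ‖v‖ ≤ ∑ i, ‖v i‖ := by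
  have h : v = ∑ i, EuclideanSpace.single i (v i) := by
    ext k
    simp [Finset.sum_apply]
  conv_lhs => rw [h]
  refine (norm_sum_le _ _).trans (le_of_eq ?_)
  exact Finset.sum_congr rfl fun i _ => by simp

lemma norm_act_le (M : MatC) (v : C3) : ‖act M v‖ ≤ (∑ i, ∑ j, ‖M i j‖) * ‖v‖ := by
  refine (norm_le_sum _).trans ?_
  rw [Finset.sum_mul]
  refine Finset.sum_le_sum fun i _ => ?_
  rw [act_apply, Finset.sum_mul]
  refine (norm_sum_le _ _).trans (Finset.sum_le_sum fun j _ => ?_)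
  rw [norm_mul]
  gcongr
  exact norm_apply_le v j

/-- The radius `3` is a crude substitute for `√3`; only boundedness of the cell matters. -/
lemma norm_le_of_mem_cell {y : R3} (hy : y ∈ cell) : ‖y‖ ≤ 3 := by
  rw [EuclideanSpace.norm_eq, Real.sqrt_le_left (by norm_num)]
  have : ∀ i, ‖y i‖ ^ 2 ≤ 1 := fun i => by
    rw [Real.norm_eq_abs, sq_abs]
    have := hy i
    nlinarith
  calc ∑ i, ‖y i‖ ^ 2 ≤ ∑ _i : Fin 3, (1 : ℝ) := Finset.sum_le_sum fun i _ => this i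
    _ ≤ 3 ^ 2 := by norm_num

lemma exists_mem_cell_of_periodic {α : Type*} {f : R3 → α} (hf : IsPeriodicFun f) (y : R3) :
    ∃ z ∈ cell, f z = f y :=
  ⟨y - latticeVec (floorVec y), sub_floorVec_mem_cell y, by
    have := hf (-floorVec y) y
    rwa [latticeVec_neg, ← sub_eq_add_neg] at this⟩

lemma exists_bound_of_continuous_periodic {f : R3 → ℝ} (hf : Continuous f)
    (hp : IsPeriodicFun f) : ∃ b, 0 < b ∧ ∀ y, f y ≤ b := by
  obtain ⟨b, hb⟩ := (isCompact_closedBall (0 : R3) 3).exists_bound_of_continuousOn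
    hf.continuousOn
  refine ⟨max b 1, by positivity, fun y => ?_⟩
  obtain ⟨z, hz, hzy⟩ := exists_mem_cell_of_periodic hp y
  rw [← hzy]
  exact (le_abs_self _).trans ((hb z (by simpa using norm_le_of_mem_cell hz)).trans
    (le_max_left _ _))

lemma exists_act_bound {M : R3 → MatC} (hM : Continuous M) (hp : IsPeriodicFun M) :
    ∃ b, 0 < b ∧ ∀ y v, ‖act (M y) v‖ ≤ b * ‖v‖ := by
  obtain ⟨b, hb, h⟩ := exists_bound_of_continuous_periodic (f := fun y => ∑ i, ∑ j, ‖M y i j‖)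
    (by
      refine continuous_finsetSum _ fun i _ => continuous_finsetSum _ fun j _ => ?_
      exact (hM.matrix_elem i j).norm)
    (fun n y => by simp only [hp n y])
  exact ⟨b, hb, fun y v => (norm_act_le _ _).trans (by gcongr; exact h y)⟩

/-! ### Square roots of the coefficients -/

/-- `S` and `T` are continuous periodic fields of Hermitian matrices, inverse to each other and
bounded by `b`; they stand for `A^{-1/2}` and `A^{1/2}`. -/
structure IsWeight (S T : R3 → MatC) (b : ℝ) : Prop where
  contS : Continuous S
  contT : Continuous T
  perS : IsPeriodicFun S
  perT : IsPeriodicFun T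
  hermS : ∀ y, (S y)ᴴ = S y
  hermT : ∀ y, (T y)ᴴ = T y
  mulST : ∀ y, S y * T y = 1
  mulTS : ∀ y, T y * S y = 1
  b_pos : 0 < b
  boundS : ∀ y v, ‖act (S y) v‖ ≤ b * ‖v‖
  boundT : ∀ y v, ‖act (T y) v‖ ≤ b * ‖v‖

section L2

open scoped Matrix.Norms.L2Operator

/-- The operator norm, which makes matrices a C⋆-algebra, is opened locally to have continuity of
the square root on the nonnegative cone. -/
lemma continuous_sqrt_of_posDef {A : R3 → MatR} (hA : Continuous A) (hpos : ∀ y, (A y).PosDef) :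
    Continuous fun y => CFC.sqrt (A y) :=
  CFC.continuousOn_sqrt.comp_continuous hA fun y => (hpos y).posSemidef.nonneg

end L2

variable {A : R3 → MatR}

lemma map_ofReal_mul (M N : MatR) : (M * N).map (fun t : ℝ => (t : ℂ))
    = M.map (fun t : ℝ => (t : ℂ)) * N.map (fun t : ℝ => (t : ℂ)) :=
  Matrix.map_mul (f := Complex.ofRealHom)

lemma map_ofReal_one : (1 : MatR).map (fun t : ℝ => (t : ℂ)) = 1 :=
  Matrix.map_one (fun t : ℝ => (t : ℂ)) Complex.ofReal_zero Complex.ofReal_one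

lemma sqrtC_mul_sqrtC (hpos : ∀ y, (A y).PosDef) (y : R3) :
    sqrtC A y * sqrtC A y = (A y).map (fun t : ℝ => (t : ℂ)) := by
  rw [sqrtC, ← map_ofReal_mul, CFC.sqrt_mul_sqrt_self _ (hpos y).posSemidef.nonneg]

lemma invC_mul_map (hpos : ∀ y, (A y).PosDef) (y : R3) :
    invC A y * (A y).map (fun t : ℝ => (t : ℂ)) = 1 := by
  rw [invC, ← map_ofReal_mul, Matrix.nonsing_inv_mul _ ((hpos y).det_pos.ne'.isUnit),
    map_ofReal_one]

lemma isUnit_det_sqrtC (hpos : ∀ y, (A y).PosDef) (y : R3) : IsUnit (sqrtC A y).det := by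
  have h := congrArg Matrix.det (invC_mul_map hpos y)
  rw [← sqrtC_mul_sqrtC hpos, Matrix.det_mul, Matrix.det_mul, Matrix.det_one] at h
  exact isUnit_iff_ne_zero.2 fun h0 => by simp [h0] at h

lemma invC_eq (hpos : ∀ y, (A y).PosDef) (y : R3) :
    invC A y = (sqrtC A y)⁻¹ * (sqrtC A y)⁻¹ := by
  have h := invC_mul_map hpos y
  rw [← sqrtC_mul_sqrtC hpos] at h
  have hu := isUnit_det_sqrtC hpos y
  calc invC A y = (invC A y * (sqrtC A y * sqrtC A y)) * ((sqrtC A y)⁻¹ * (sqrtC A y)⁻¹) := by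
        rw [Matrix.mul_assoc, Matrix.mul_assoc (sqrtC A y), ← Matrix.mul_assoc (sqrtC A y)
          (sqrtC A y)⁻¹, Matrix.mul_nonsing_inv _ hu, Matrix.one_mul, Matrix.mul_nonsing_inv _ hu,
          Matrix.mul_one]
    _ = _ := by rw [h, Matrix.one_mul]

/-- Continuity and periodicity reduce the bounds to a compact set. The single number `b` obtained
here is what all later constants depend on. -/
lemma exists_isWeight (hA_diff : ∀ i j : Fin 3, Differentiable ℝ (fun y => A y i j))
    (hA_per : IsPeriodicFun A) (hpos : ∀ y, (A y).PosDef) :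
    ∃ b, IsWeight (fun y => (sqrtC A y)⁻¹) (sqrtC A) b := by
  have hA : Continuous A := continuous_matrix fun i j => (hA_diff i j).continuous
  have hT : Continuous (sqrtC A) :=
    (continuous_sqrt_of_posDef hA hpos).matrix_map Complex.continuous_ofReal
  have hTp : IsPeriodicFun (sqrtC A) := fun n y => by simp only [sqrtC, hA_per n y]
  have hS : Continuous fun y => (sqrtC A y)⁻¹ := by
    simp only [Matrix.inv_def, Ring.inverse_eq_inv']
    exact (hT.matrix_det.inv₀ fun y => (isUnit_det_sqrtC hpos y).ne_zero).smul hT.matrix_adjugate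
  have hSp : IsPeriodicFun fun y => (sqrtC A y)⁻¹ := fun n y => by simp only [hTp n y]
  have hTh : ∀ y, (sqrtC A y)ᴴ = sqrtC A y := fun y => by
    have h : (CFC.sqrt (A y))ᴴ = CFC.sqrt (A y) :=
      (CFC.sqrt_nonneg (A y)).isSelfAdjoint
    ext i j
    have := congrFun (congrFun h i) j
    simp only [Matrix.conjTranspose_apply, star_trivial] at this
    simp [sqrtC, this]
  obtain ⟨b₁, hb₁, h₁⟩ := exists_act_bound hS hSp
  obtain ⟨b₂, hb₂, h₂⟩ := exists_act_bound hT hTp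
  exact ⟨max b₁ b₂, hS, hT, hSp, hTp, fun y => by rw [Matrix.conjTranspose_nonsing_inv, hTh], hTh,
    fun y => Matrix.nonsing_inv_mul _ (isUnit_det_sqrtC hpos y),
    fun y => Matrix.mul_nonsing_inv _ (isUnit_det_sqrtC hpos y), by positivity,
    fun y v => (h₁ y v).trans (by gcongr; exact le_max_left _ _),
    fun y v => (h₂ y v).trans (by gcongr; exact le_max_right _ _)⟩

end

end MaxwellHom

/-! ### Longitudinal and transversal fields, and the cell problem as an orthogonal projection. -/

namespace MaxwellHom

noncomputable section

/-! ### Multiplication operators -/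

lemma aestronglyMeasurable_C3 {α : Type*} {mα : MeasurableSpace α} {μ : Measure α} {f : α → C3}
    (hf : ∀ i, AEStronglyMeasurable (fun y => f y i) μ) : AEStronglyMeasurable f μ :=
  ((PiLp.continuous_toLp 2 (fun _ : Fin 3 => ℂ)).measurable.comp_aemeasurable
    (aemeasurable_pi_iff.2 fun i => (hf i).aemeasurable)).aestronglyMeasurable

lemma aestronglyMeasurable_apply {α : Type*} {mα : MeasurableSpace α} {μ : Measure α} {f : α → C3}
    (hf : AEStronglyMeasurable f μ) (i : Fin 3) : AEStronglyMeasurable (fun y => f y i) μ :=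
  (EuclideanSpace.proj (𝕜 := ℂ) i).continuous.comp_aestronglyMeasurable hf

lemma aestronglyMeasurable_act {α : Type*} {mα : MeasurableSpace α} {μ : Measure α} {M : α → MatC}
    (hM : ∀ i j, AEStronglyMeasurable (fun y => M y i j) μ) {f : α → C3}
    (hf : AEStronglyMeasurable f μ) : AEStronglyMeasurable (fun y => act (M y) (f y)) μ := by
  refine aestronglyMeasurable_C3 fun i => ?_
  simp only [act_apply]
  exact Finset.aestronglyMeasurable_fun_sum _ fun j _ =>
    (hM i j).mul (aestronglyMeasurable_apply hf j)

lemma measurable_entry {M : R3 → MatC} (hM : Continuous M) (i j : Fin 3) :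
    Measurable fun y => M y i j :=
  (hM.matrix_elem i j).measurable

lemma MemLp.act_of_measurable {μ : Measure R3} {p : ℝ≥0∞} {M : R3 → MatC}
    (hM : ∀ i j, Measurable fun y => M y i j) {b : ℝ}
    (hb : ∀ y v, ‖act (M y) v‖ ≤ b * ‖v‖) {f : R3 → C3} (hf : MemLp f p μ) :
    MemLp (fun y => act (M y) (f y)) p μ := by
  refine hf.of_le_mul (c := b) ?_ (ae_of_all _ fun y => hb y _)
  exact aestronglyMeasurable_act (fun i j => (hM i j).aestronglyMeasurable) hf.1

lemma MemLp.act {μ : Measure R3} {p : ℝ≥0∞} {M : R3 → MatC} (hM : Continuous M) {b : ℝ}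
    (hb : ∀ y v, ‖act (M y) v‖ ≤ b * ‖v‖) {f : R3 → C3} (hf : MemLp f p μ) :
    MemLp (fun y => act (M y) (f y)) p μ :=
  MemLp.act_of_measurable (measurable_entry hM) hb hf

/-- Multiplication by a bounded measurable matrix field as an operator on `L²`. -/
def mulLp (μ : Measure R3) {M : R3 → MatC} (hM : ∀ i j, Measurable fun y => M y i j) {b : ℝ}
    (hb : ∀ y v, ‖act (M y) v‖ ≤ b * ‖v‖) : Lp C3 2 μ →L[ℂ] Lp C3 2 μ :=
  LinearMap.mkContinuous
    { toFun := fun f => (MemLp.act_of_measurable hM hb (Lp.memLp f)).toLp _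
      map_add' := fun f g => by
        rw [← MemLp.toLp_add]
        refine MemLp.toLp_congr _ _ ?_
        filter_upwards [Lp.coeFn_add f g] with y hy
        rw [hy, Pi.add_apply, Pi.add_apply, act_add]
      map_smul' := fun c f => by
        rw [RingHom.id_apply, ← MemLp.toLp_const_smul]
        refine MemLp.toLp_congr _ _ ?_
        filter_upwards [Lp.coeFn_smul c f] with y hy
        rw [hy, Pi.smul_apply, Pi.smul_apply, act_smul] }
    b (fun f => by
      refine Lp.norm_le_mul_norm_of_ae_le_mul ?_
      filter_upwards [(MemLp.act_of_measurable hM hb (Lp.memLp f)).coeFn_toLp] with y hy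
      exact (congrArg norm hy).le.trans (hb y _))

lemma coeFn_mulLp {μ : Measure R3} {M : R3 → MatC} (hM : ∀ i j, Measurable fun y => M y i j) {b : ℝ}
    (hb : ∀ y v, ‖act (M y) v‖ ≤ b * ‖v‖) (f : Lp C3 2 μ) :
    mulLp μ hM hb f =ᵐ[μ] fun y => act (M y) (f y) :=
  (MemLp.act_of_measurable hM hb (Lp.memLp f)).coeFn_toLp

lemma mulLp_toLp {μ : Measure R3} {M : R3 → MatC} (hM : ∀ i j, Measurable fun y => M y i j) {b : ℝ}
    (hb : ∀ y v, ‖act (M y) v‖ ≤ b * ‖v‖) {f : R3 → C3} (hf : MemLp f 2 μ) :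
    mulLp μ hM hb (hf.toLp f) = (MemLp.act_of_measurable hM hb hf).toLp _ := by
  refine MemLp.toLp_congr (MemLp.act_of_measurable hM hb (Lp.memLp _)) _ ?_
  filter_upwards [hf.coeFn_toLp] with y hy
  rw [hy]

lemma inner_toLp {μ : Measure R3} {f g : R3 → C3} (hf : MemLp f 2 μ) (hg : MemLp g 2 μ) :
    inner ℂ (hf.toLp f) (hg.toLp g) = ∫ y, inner ℂ (f y) (g y) ∂μ := by
  rw [L2.inner_def]
  refine integral_congr_ae ?_
  filter_upwards [hf.coeFn_toLp, hg.coeFn_toLp] with y h1 h2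
  rw [h1, h2]

lemma norm_toLp_sq {μ : Measure R3} {f : R3 → C3} (hf : MemLp f 2 μ) :
    ‖hf.toLp f‖ ^ 2 = ∫ y, ‖f y‖ ^ 2 ∂μ := by
  have h := inner_toLp hf hf
  simp only [inner_self_eq_norm_sq_to_K] at h
  have h2 : (∫ y, ((‖f y‖ : ℂ)) ^ 2 ∂μ) = ((∫ y, ‖f y‖ ^ 2 ∂μ : ℝ) : ℂ) := by
    rw [← integral_complex_ofReal]; simp
  erw [h2] at h
  exact Complex.ofReal_injective (by simpa using h)

/-! ### Fields with prescribed directions of the Fourier coefficients -/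

/-- The inclusion of `ℝ³` into `ℂ³`. -/
def cplx (x : R3) : C3 := WithLp.toLp 2 fun i => (x i : ℂ)

/-- The `m`-th Fourier coefficient of `p` is a multiple of `w m`, for all `m`. -/
def IsModal (w : (Fin 3 → ℤ) → C3) (p : R3 → C3) : Prop :=
  MemLp p 2 cellVol ∧ ∀ m, fc m p ∈ Submodule.span ℂ {w m}

/-- The `m`-th Fourier coefficient of `f` is orthogonal to `w m`, for all `m`. -/
def IsOrthModal (w : (Fin 3 → ℤ) → C3) (f : R3 → C3) : Prop :=
  MemLp f 2 cellVol ∧ ∀ m, inner ℂ (w m) (fc m f) = 0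

lemma inner_eq_zero_of_mem_span {w u v : C3} (hu : u ∈ Submodule.span ℂ {w})
    (hv : inner ℂ w v = 0) : inner ℂ u v = 0 := by
  obtain ⟨a, rfl⟩ := Submodule.mem_span_singleton.1 hu
  rw [inner_smul_left, hv, mul_zero]

/-- Parseval's identity, each term of which vanishes. This plays the role of integration by parts
between gradients and divergence free fields on the cell. -/
lemma IsModal.integral_inner_eq_zero {w : (Fin 3 → ℤ) → C3} {p f : R3 → C3} (hp : IsModal w p)
    (hf : IsOrthModal w f) : ∫ y, inner ℂ (p y) (f y) ∂cellVol = 0 := by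
  have h := hasSum_fc hp.1 hf.1
  simp only [fun m => inner_eq_zero_of_mem_span (hp.2 m) (hf.2 m)] at h
  exact h.unique hasSum_zero

/-- The Fourier coefficient as a functional on `L²`. -/
def fcL (m : Fin 3 → ℤ) : Lp C3 2 cellVol →L[ℂ] C3 :=
  LinearMap.mkContinuous
    { toFun := fun f => fc m f
      map_add' := fun f g => by
        rw [← fc_add (Lp.memLp f) (Lp.memLp g)]
        exact fc_congr (Lp.coeFn_add f g) m
      map_smul' := fun c f => by
        rw [RingHom.id_apply, ← fc_smul]
        exact fc_congr (Lp.coeFn_smul c f) m }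
    1 (fun f => by
      have h := le_hasSum (hasSum_sq_fc (Lp.memLp f)) m fun _ _ => by positivity
      rw [← norm_toLp_sq (Lp.memLp f), Lp.toLp_coeFn] at h
      rw [one_mul]
      exact (sq_le_sq₀ (norm_nonneg _) (norm_nonneg _)).1 h)

lemma fcL_apply (m : Fin 3 → ℤ) (f : Lp C3 2 cellVol) : fcL m f = fc m f := rfl

/-- The closed subspace of `L²` of the fields satisfying `IsModal w`. -/
def modalSubmodule (w : (Fin 3 → ℤ) → C3) : Submodule ℂ (Lp C3 2 cellVol) :=
  ⨅ m, (Submodule.span ℂ {w m}).comap (fcL m).toLinearMap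

lemma mem_modalSubmodule {w : (Fin 3 → ℤ) → C3} {f : Lp C3 2 cellVol} :
    f ∈ modalSubmodule w ↔ ∀ m, fc m f ∈ Submodule.span ℂ {w m} := by
  simp only [modalSubmodule, Submodule.mem_iInf, Submodule.mem_comap]
  rfl

lemma isClosed_modalSubmodule (w : (Fin 3 → ℤ) → C3) :
    IsClosed (modalSubmodule w : Set (Lp C3 2 cellVol)) := by
  have : (modalSubmodule w : Set (Lp C3 2 cellVol))
      = ⋂ m, (fcL m) ⁻¹' (Submodule.span ℂ {w m} : Set C3) := by
    ext f; simp [mem_modalSubmodule, fcL_apply]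
  rw [this]
  exact isClosed_iInter fun m => (Submodule.closed_of_finiteDimensional _).preimage (fcL m).cont

lemma memLp_ex_smul_const (κ : R3) (c : C3) : MemLp (fun y => ex κ y • c) 2 cellVol :=
  MemLp.ex_smul (memLp_const c) κ

lemma integral_inner_ex_smul {f : R3 → C3} (hf : MemLp f 2 cellVol) (m : Fin 3 → ℤ) (c : C3) :
    ∫ y, inner ℂ (ex (freq m) y • c) (f y) ∂cellVol = inner ℂ c (fc m f) := by
  have : ∀ y, inner ℂ (ex (freq m) y • c) (f y) = inner ℂ c (conj (ex (freq m) y) • f y) :=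
    fun y => by rw [inner_smul_left, inner_smul_right]
  simp only [this]
  exact integral_inner (integrable_fc hf m) c

/-- The projection theorem for the preimage of a closed subspace. It is applied with `L` the
multiplication by `A^{1/2}`, so that a weighted problem becomes an unweighted projection. -/
lemma exists_projection_of_isClosed {E : Type*} [NormedAddCommGroup E] [InnerProductSpace ℂ E]
    [CompleteSpace E] {Y : Submodule ℂ E} (hY : IsClosed (Y : Set E)) (L : E →L[ℂ] E) (F : E) :
    ∃ u, L u ∈ Y ∧ ‖u‖ ≤ ‖F‖ ∧ ∀ q, L q ∈ Y → inner ℂ q (F - u) = 0 := by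
  let K := Y.comap L.toLinearMap
  have hK : IsClosed (K : Set E) := hY.preimage L.cont
  have : CompleteSpace K := hK.completeSpace_coe
  refine ⟨K.starProjection F, K.starProjection_apply_mem F, K.norm_starProjection_apply_le F,
    fun q hq => ?_⟩
  have hq' : q ∈ K := hq
  rw [← inner_conj_symm, K.starProjection_inner_eq_zero _ _ hq', map_zero]

/-- Solvability of the weighted orthogonality problem: there is `y` with modes along `w` such that
`S (S y + F)` has modes orthogonal to `w`. -/
lemma IsWeight.exists_modal {S T : R3 → MatC} {b : ℝ} (hW : IsWeight S T b)
    (w : (Fin 3 → ℤ) → C3) {F : R3 → C3} (hF : MemLp F 2 cellVol) :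
    ∃ y, IsModal w y ∧ IsOrthModal w (fun x => act (S x) (act (S x) (y x) + F x)) ∧
      ∫ x, ‖act (S x) (y x)‖ ^ 2 ∂cellVol ≤ ∫ x, ‖F x‖ ^ 2 ∂cellVol := by
  -- With `u = -S y` the condition on `y` says that `T u` has the prescribed modes. Projecting `F`
  -- onto such `u` makes the residue `F - u = S y + F` orthogonal to `S` times every field with
  -- these modes.
  obtain ⟨u, hu, hun, huo⟩ := exists_projection_of_isClosed (isClosed_modalSubmodule w)
    (mulLp cellVol (measurable_entry hW.contT) hW.boundT) (hF.toLp F)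
  have hTu := coeFn_mulLp (measurable_entry hW.contT) hW.boundT u
  have hTm := Lp.memLp (mulLp cellVol (measurable_entry hW.contT) hW.boundT u)
  rw [mem_modalSubmodule] at hu
  generalize mulLp cellVol (measurable_entry hW.contT) hW.boundT u = Tu at hu hTu hTm
  let y : R3 → C3 := fun x => - Tu x
  have hy : MemLp y 2 cellVol := hTm.neg
  have hSy : (fun x => act (S x) (y x)) =ᵐ[cellVol] fun x => -u x := by
    filter_upwards [hTu] with x hx
    change act (S x) (-(Tu x)) = _
    rw [act_neg, hx, ← act_mul, hW.mulST, act_one]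
  refine ⟨y, ⟨hy, fun m => ?_⟩, ⟨?_, fun m => ?_⟩, ?_⟩
  · have h1 := hu m
    have h2 : fc m y = -fc m Tu := by
      have := fc_smul (Tu : R3 → C3) (-1) m
      simpa [y] using this
    rw [h2]
    exact Submodule.neg_mem _ h1
  · exact MemLp.act hW.contS hW.boundS ((MemLp.act hW.contS hW.boundS hy).add hF)
  · have hM : MemLp (fun x => act (S x) (act (S x) (y x) + F x)) 2 cellVol :=
      MemLp.act hW.contS hW.boundS ((MemLp.act hW.contS hW.boundS hy).add hF)
    rw [← integral_inner_ex_smul hM]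
    -- The competitor is `S` applied to a single mode; its image under `T` is the mode itself, so it
    -- is admissible.
    have hq := memLp_ex_smul_const (freq m) (w m)
    have hSq := MemLp.act hW.contS hW.boundS hq
    have hqK : mulLp cellVol (measurable_entry hW.contT) hW.boundT (hSq.toLp _) ∈ modalSubmodule w := by
      rw [mulLp_toLp, mem_modalSubmodule]
      intro n
      have h1 : fc n ((MemLp.act hW.contT hW.boundT hSq).toLp _) = fc n
          (fun y => ex (freq m) y • w m) := by
        refine fc_congr ?_ n
        filter_upwards [(MemLp.act hW.contT hW.boundT hSq).coeFn_toLp] with x hx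
        rw [hx, ← act_mul, hW.mulTS, act_one]
      rw [h1, fc_ex_smul_const]
      split_ifs with h
      · rw [h]; exact Submodule.mem_span_singleton_self _
      · exact Submodule.zero_mem _
    have h0 : inner ℂ (hSq.toLp _) (hF.toLp F - u) = 0 := huo _ hqK
    have h1 : hF.toLp F - u = (hF.sub (Lp.memLp u)).toLp _ := by
      rw [MemLp.toLp_sub hF (Lp.memLp u), Lp.toLp_coeFn]
    rw [h1, inner_toLp] at h0
    rw [← h0]
    refine integral_congr_ae ?_
    filter_upwards [hSy] with x hx
    rw [hx, inner_act_left, hW.hermS]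
    simp only [Pi.sub_apply]
    rw [neg_add_eq_sub]
  · have h1 : ∫ x, ‖act (S x) (y x)‖ ^ 2 ∂cellVol = ‖u‖ ^ 2 := by
      conv_rhs => rw [← Lp.toLp_coeFn u (Lp.memLp u), norm_toLp_sq]
      refine integral_congr_ae ?_
      filter_upwards [hSy] with x hx
      rw [hx, norm_neg]
    rw [h1, ← norm_toLp_sq hF]
    gcongr

end

end MaxwellHom

/-! ### Variational characterisation and measurable dependence on the quasimomentum. -/

namespace MaxwellHom

noncomputable section

/-! ### Approximation by trigonometric polynomials -/

/-- The trigonometric polynomial with coefficients `a m • w m`, `m ∈ s`. -/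
def trigPoly (w : (Fin 3 → ℤ) → C3) (s : Finset (Fin 3 → ℤ)) (a : (Fin 3 → ℤ) → ℂ) (x : R3) : C3 :=
  ∑ m ∈ s, a m • ex (freq m) x • w m

lemma memLp_trigPoly (w : (Fin 3 → ℤ) → C3) (s : Finset (Fin 3 → ℤ)) (a : (Fin 3 → ℤ) → ℂ) :
    MemLp (trigPoly w s a) 2 cellVol :=
  memLp_finsetSum _ fun m _ => (memLp_ex_smul_const (freq m) (w m)).const_smul (a m)

lemma fc_trigPoly (w : (Fin 3 → ℤ) → C3) (s : Finset (Fin 3 → ℤ)) (a : (Fin 3 → ℤ) → ℂ)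
    (n : Fin 3 → ℤ) : fc n (trigPoly w s a) = if n ∈ s then a n • w n else 0 := by
  have h : fc n (trigPoly w s a) = ∑ m ∈ s, fc n (fun x => a m • ex (freq m) x • w m) := by
    simp only [fc, trigPoly, Finset.smul_sum]
    exact integral_finsetSum _ fun m _ =>
      integrable_fc ((memLp_ex_smul_const (freq m) (w m)).const_smul (a m)) n
  simp only [h, fc_smul, fc_ex_smul_const]
  simp

lemma isModal_trigPoly (w : (Fin 3 → ℤ) → C3) (s : Finset (Fin 3 → ℤ)) (a : (Fin 3 → ℤ) → ℂ) :
    IsModal w (trigPoly w s a) := by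
  refine ⟨memLp_trigPoly w s a, fun m => ?_⟩
  rw [fc_trigPoly]
  split_ifs
  · exact Submodule.smul_mem _ _ (Submodule.mem_span_singleton_self _)
  · exact Submodule.zero_mem _

lemma IsModal.add {w : (Fin 3 → ℤ) → C3} {p q : R3 → C3} (hp : IsModal w p) (hq : IsModal w q) :
    IsModal w (fun x => p x + q x) :=
  ⟨hp.1.add hq.1, fun m => by
    rw [fc_add hp.1 hq.1]; exact Submodule.add_mem _ (hp.2 m) (hq.2 m)⟩

lemma IsModal.smul {w : (Fin 3 → ℤ) → C3} {p : R3 → C3} (hp : IsModal w p) (c : ℂ) :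
    IsModal w (fun x => c • p x) :=
  ⟨hp.1.const_smul c, fun m => by rw [fc_smul]; exact Submodule.smul_mem _ _ (hp.2 m)⟩

lemma IsOrthModal.add {w : (Fin 3 → ℤ) → C3} {p q : R3 → C3} (hp : IsOrthModal w p)
    (hq : IsOrthModal w q) : IsOrthModal w (fun x => p x + q x) :=
  ⟨hp.1.add hq.1, fun m => by rw [fc_add hp.1 hq.1, inner_add_right, hp.2, hq.2, add_zero]⟩

lemma IsOrthModal.smul {w : (Fin 3 → ℤ) → C3} {p : R3 → C3} (hp : IsOrthModal w p) (c : ℂ) :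
    IsOrthModal w (fun x => c • p x) :=
  ⟨hp.1.const_smul c, fun m => by rw [fc_smul, inner_smul_right, hp.2, mul_zero]⟩

lemma integral_sq_eq_tsum {f : R3 → C3} (hf : MemLp f 2 cellVol) :
    ∫ x, ‖f x‖ ^ 2 ∂cellVol = ∑' m, ‖fc m f‖ ^ 2 := (hasSum_sq_fc hf).tsum_eq.symm

/-- The error is the Parseval sum over the complement of a finite set, that is, the tail of a
convergent series. -/
lemma tendsto_integral_sub_trigPoly {w : (Fin 3 → ℤ) → C3} {p : R3 → C3} (hp : MemLp p 2 cellVol)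
    {a : (Fin 3 → ℤ) → ℂ} (ha : ∀ m, fc m p = a m • w m) :
    Tendsto (fun s => ∫ x, ‖p x - trigPoly w s a x‖ ^ 2 ∂cellVol) atTop (𝓝 0) := by
  have h := tendsto_tsum_compl_atTop_zero fun m => ‖fc m p‖ ^ 2
  refine h.congr fun s => ?_
  have hm : MemLp (fun x => p x - trigPoly w s a x) 2 cellVol := hp.sub (memLp_trigPoly w s a)
  rw [integral_sq_eq_tsum hm]
  simp only [fc_sub hp (memLp_trigPoly w s a), fc_trigPoly]
  refine (tsum_subtype (({m | m ∉ s} : Set (Fin 3 → ℤ))) fun m => ‖fc m p‖ ^ 2).trans ?_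
  refine tsum_congr fun m => ?_
  by_cases hms : m ∈ s
  · simp [hms, ha]
  · simp [hms]

lemma integrable_norm_sq {μ : Measure R3} {f : R3 → C3} (hf : MemLp f 2 μ) :
    Integrable (fun x => ‖f x‖ ^ 2) μ := (memLp_two_iff_integrable_sq_norm hf.1).1 hf

/-- Minimality of the solution of the weighted orthogonality problem. -/
lemma IsWeight.integral_eq_iInf {S T : R3 → MatC} {b : ℝ} (hW : IsWeight S T b)
    {w : (Fin 3 → ℤ) → C3} {G y : R3 → C3} (hG : MemLp G 2 cellVol) (hy : IsModal w y)
    (ho : IsOrthModal w (fun x => act (S x) (act (S x) (G x + y x)))) :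
    ∫ x, ‖act (S x) (G x + y x)‖ ^ 2 ∂cellVol
      = ⨅ q : Finset (Fin 3 → ℤ) × ((Fin 3 → ℤ) → ℂ),
        ∫ x, ‖act (S x) (G x - trigPoly w q.1 q.2 x)‖ ^ 2 ∂cellVol := by
  -- Pythagoras: `y + trigPoly` has modes along `w`, so it is orthogonal in the weighted sense to
  -- the optimal field `G + y`, and the cross term disappears.
  have key : ∀ q : Finset (Fin 3 → ℤ) × ((Fin 3 → ℤ) → ℂ),
      ∫ x, ‖act (S x) (G x - trigPoly w q.1 q.2 x)‖ ^ 2 ∂cellVol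
        = ∫ x, ‖act (S x) (G x + y x)‖ ^ 2 ∂cellVol
          + ∫ x, ‖act (S x) (y x + trigPoly w q.1 q.2 x)‖ ^ 2 ∂cellVol := by
    rintro ⟨s, a⟩
    have hq := hy.add (isModal_trigPoly w s a)
    have h1 : MemLp (fun x => act (S x) (G x + y x)) 2 cellVol :=
      MemLp.act hW.contS hW.boundS (hG.add hy.1)
    have h2 := MemLp.act hW.contS hW.boundS hq.1
    have hz := hq.integral_inner_eq_zero ho
    have hz' : ∫ x, inner ℂ (act (S x) (y x + trigPoly w s a x)) (act (S x) (G x + y x)) ∂cellVol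
        = 0 := by
      rw [← hz]
      refine integral_congr_ae (ae_of_all _ fun x => ?_)
      dsimp only
      rw [inner_act_left, hW.hermS]
    have hpt : ∀ x, ‖act (S x) (G x - trigPoly w s a x)‖ ^ 2
        = ‖act (S x) (G x + y x)‖ ^ 2 + ‖act (S x) (y x + trigPoly w s a x)‖ ^ 2
          - 2 * RCLike.re (inner ℂ (act (S x) (y x + trigPoly w s a x))
              (act (S x) (G x + y x))) := fun x => by
      have : G x - trigPoly w s a x = (G x + y x) - (y x + trigPoly w s a x) := by abel
      rw [this, act_sub, @norm_sub_sq ℂ, inner_re_symm]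
      ring
    have hi := integrable_inner h2 h1
    simp only [hpt]
    have h12 : Integrable (fun x => ‖act (S x) (G x + y x)‖ ^ 2
        + ‖act (S x) (y x + trigPoly w s a x)‖ ^ 2) cellVol :=
      (integrable_norm_sq h1).add (integrable_norm_sq h2)
    rw [integral_sub h12 (hi.re.const_mul 2),
      integral_add (integrable_norm_sq h1) (integrable_norm_sq h2), integral_const_mul,
      integral_re hi, hz']
    simp
  simp only [key]
  refine le_antisymm (le_ciInf fun q => ?_) ?_
  · exact le_add_of_nonneg_right (integral_nonneg fun x => by positivity)
  -- The infimum is approached along the Fourier partial sums of `-y`.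
  · have ha : ∃ a : (Fin 3 → ℤ) → ℂ, ∀ m, fc m (fun x => (-1 : ℂ) • y x) = a m • w m := by
      choose a ha using fun m => Submodule.mem_span_singleton.1 ((hy.smul (-1)).2 m)
      exact ⟨a, fun m => (ha m).symm⟩
    obtain ⟨a, ha⟩ := ha
    have hlim := tendsto_integral_sub_trigPoly (hy.smul (-1)).1 ha
    refine le_of_forall_pos_le_add fun δ hδ => ?_
    have hb := hW.b_pos
    obtain ⟨s, hs⟩ := ((hlim.const_mul (b ^ 2)).eventually
      (gt_mem_nhds (by simpa using hδ))).exists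
    refine (ciInf_le ⟨0, ?_⟩ (s, a)).trans ?_
    · rintro _ ⟨q, rfl⟩
      exact add_nonneg (integral_nonneg fun x => by positivity)
        (integral_nonneg fun x => by positivity)
    · gcongr
      refine le_trans ?_ hs.le
      rw [← integral_const_mul]
      have hm := (hy.smul (-1)).1.sub (memLp_trigPoly w s a)
      refine integral_mono_of_nonneg (ae_of_all _ fun x => by positivity)
        ((integrable_norm_sq hm).const_mul _) (ae_of_all _ fun x => ?_)
      have : (-1 : ℂ) • y x - trigPoly w s a x = -(y x + trigPoly w s a x) := by
        rw [neg_one_smul]; abel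
      dsimp only
      rw [this, norm_neg, ← mul_pow]
      gcongr
      exact hW.boundS x _

lemma continuous_integral_cell {G : R3 → R3 → ℝ} (hG : Continuous (Function.uncurry G)) :
    Continuous fun κ => ∫ x, G κ x ∂cellVol := by
  refine continuous_iff_continuousAt.2 fun κ₀ => ?_
  obtain ⟨C, hC⟩ := ((isCompact_closedBall κ₀ 1).prod
    (isCompact_closedBall (0 : R3) 3)).exists_bound_of_continuousOn hG.continuousOn
  refine continuousAt_of_dominated (bound := fun _ => C) (Eventually.of_forall fun κ => ?_) ?_
    (integrable_const C) (ae_of_all _ fun x => ?_)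
  · exact (hG.comp (Continuous.prodMk continuous_const continuous_id)).aestronglyMeasurable
  · filter_upwards [Metric.closedBall_mem_nhds κ₀ one_pos] with κ hκ
    filter_upwards [ae_restrict_mem measurableSet_cell] with x hx
    exact hC (κ, x) ⟨hκ, by simpa using norm_le_of_mem_cell hx⟩
  · exact (hG.comp (Continuous.prodMk continuous_id continuous_const)).continuousAt

lemma memLp_cell_of_continuous {f : R3 → C3} (hf : Continuous f) : MemLp f 2 cellVol := by
  obtain ⟨C, hC⟩ := (isCompact_closedBall (0 : R3) 3).exists_bound_of_continuousOn hf.continuousOn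
  refine MemLp.of_bound hf.aestronglyMeasurable C ?_
  filter_upwards [ae_restrict_mem measurableSet_cell] with x hx
  exact hC x (by simpa using norm_le_of_mem_cell hx)

/-- The solution `y κ` is chosen separately for each `κ`, with no measurability assumed. Its energy
is an infimum of functions continuous in `κ`, hence upper semicontinuous. The competitors must be
trigonometric polynomials with free coefficients, since their directions `w κ m` vary continuously
with `κ`. The index set is uncountable, which semicontinuity allows. -/
lemma IsWeight.measurable_energy {S T : R3 → MatC} {b : ℝ} (hW : IsWeight S T b)
    {w : R3 → (Fin 3 → ℤ) → C3} (hw : ∀ m, Continuous fun κ => w κ m) {G y : R3 → R3 → C3}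
    (hG : Continuous (Function.uncurry G)) (hy : ∀ κ, IsModal (w κ) (y κ))
    (ho : ∀ κ, IsOrthModal (w κ) (fun x => act (S x) (act (S x) (G κ x + y κ x)))) :
    Measurable fun κ => ∫ x, ‖act (S x) (G κ x + y κ x)‖ ^ 2 ∂cellVol := by
  have hGκ : ∀ κ, MemLp (G κ) 2 cellVol := fun κ =>
    memLp_cell_of_continuous (hG.comp (Continuous.prodMk continuous_const continuous_id))
  simp only [fun κ => hW.integral_eq_iInf (hGκ κ) (hy κ) (ho κ)]
  refine UpperSemicontinuous.measurable (upperSemicontinuous_ciInf (fun κ => ⟨0, ?_⟩)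
    fun q => Continuous.upperSemicontinuous ?_)
  · rintro _ ⟨q, rfl⟩
    exact integral_nonneg fun x => by positivity
  · refine continuous_integral_cell ?_
    have h1 : Continuous fun p : R3 × R3 => trigPoly (w p.1) q.1 q.2 p.2 := by
      unfold trigPoly
      refine continuous_finsetSum _ fun m _ => ?_
      have := (hw m).comp (continuous_fst (X := R3) (Y := R3))
      have h2 : Continuous fun p : R3 × R3 => ex (freq m) p.2 :=
        Continuous.ex continuous_const continuous_snd
      exact (h2.smul this).const_smul (q.2 m)
    exact ((Continuous.act (hW.contS.comp continuous_snd) (hG.sub h1)).norm).pow 2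

/-- Measurable dependence on the parameter of the solutions of the weighted orthogonality
problems. -/
lemma IsWeight.measurable_integral_inner {S T : R3 → MatC} {b : ℝ} (hW : IsWeight S T b)
    {w : R3 → (Fin 3 → ℤ) → C3} (hw : ∀ m, Continuous fun κ => w κ m) {F p : R3 → R3 → C3}
    (hF : Continuous (Function.uncurry F)) (c : C3) (hp : ∀ κ, IsModal (w κ) (p κ))
    (ho : ∀ κ, IsOrthModal (w κ) (fun x => act (S x) (act (S x) (p κ x + c)))) :
    Measurable fun κ => ∫ x, inner ℂ (act (S x) (F κ x)) (act (S x) (p κ x + c)) ∂cellVol := by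
  have hFκ : ∀ κ, MemLp (F κ) 2 cellVol := fun κ =>
    memLp_cell_of_continuous (hF.comp (Continuous.prodMk continuous_const continuous_id))
  -- `F` is completed to an optimal field `F + y`, so that all combinations with `p + c` are optimal
  -- and polarisation of the energies is possible.
  choose y hy hyo _ using fun κ => hW.exists_modal (w κ) (MemLp.act hW.contS hW.boundS (hFκ κ))
  have hyo' : ∀ κ, IsOrthModal (w κ) (fun x => act (S x) (act (S x) (F κ x + y κ x))) := fun κ => by
    simpa only [act_add, add_comm] using hyo κ
  -- The orthogonality problem is linear, so the combination solves it for the datum `F + ζ c`; the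
  -- values `ζ = ±1, ±i` are used below.
  have energy : ∀ ζ : ℂ, Measurable fun κ =>
      ∫ x, ‖act (S x) (F κ x + y κ x) + ζ • act (S x) (p κ x + c)‖ ^ 2 ∂cellVol := fun ζ => by
    have h := hW.measurable_energy hw (G := fun κ x => F κ x + ζ • c)
      (y := fun κ x => y κ x + ζ • p κ x) (hF.add continuous_const)
      (fun κ => (hy κ).add ((hp κ).smul ζ)) (fun κ => by
        have h1 := (hyo' κ).add ((ho κ).smul ζ)
        simp only [← act_smul, ← act_add] at h1
        have h2 : ∀ x, F κ x + ζ • c + (y κ x + ζ • p κ x)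
            = F κ x + y κ x + ζ • (p κ x + c) := fun x => by rw [smul_add]; abel
        simpa only [h2] using h1)
    have h2 : ∀ κ x, F κ x + ζ • c + (y κ x + ζ • p κ x)
        = F κ x + y κ x + ζ • (p κ x + c) := fun κ x => by rw [smul_add]; abel
    simpa only [h2, act_add _ (F _ _ + y _ _), act_smul] using h
  have hU : ∀ κ, MemLp (fun x => act (S x) (F κ x + y κ x)) 2 cellVol := fun κ =>
    MemLp.act hW.contS hW.boundS ((hFκ κ).add (hy κ).1)
  have hV : ∀ κ, MemLp (fun x => act (S x) (p κ x + c)) 2 cellVol := fun κ =>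
    MemLp.act hW.contS hW.boundS ((hp κ).1.add (memLp_const c))
  have hnorm : ∀ κ (ζ : ℂ), ∫ x, ‖act (S x) (F κ x + y κ x) + ζ • act (S x) (p κ x + c)‖ ^ 2
      ∂cellVol = ‖(hU κ).toLp _ + ζ • (hV κ).toLp _‖ ^ 2 := fun κ ζ => by
    rw [← MemLp.toLp_const_smul, ← MemLp.toLp_add, norm_toLp_sq]
    rfl
  have hinner : ∀ κ, ∫ x, inner ℂ (act (S x) (F κ x)) (act (S x) (p κ x + c)) ∂cellVol
      = inner ℂ ((hU κ).toLp _) ((hV κ).toLp _) := fun κ => by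
    have hSF := MemLp.act hW.contS hW.boundS (hFκ κ)
    have hSy := MemLp.act hW.contS hW.boundS (hy κ).1
    -- The added correction has modes along `w` and is invisible in the pairing with the transversal
    -- flux of `p + c`.
    have h0 : ∫ x, inner ℂ (act (S x) (y κ x)) (act (S x) (p κ x + c)) ∂cellVol = 0 := by
      rw [← (hy κ).integral_inner_eq_zero (ho κ)]
      refine integral_congr_ae (ae_of_all _ fun x => ?_)
      dsimp only
      rw [inner_act_left, hW.hermS]
    rw [inner_toLp]
    simp only [act_add _ (F _ _), inner_add_left]
    rw [integral_add (integrable_inner hSF (hV κ)) (integrable_inner hSy (hV κ)), h0, add_zero]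
  rw [funext hinner]
  simp only [inner_eq_sum_norm_sq_div_four]
  simp only [hnorm] at energy
  have e1 := energy 1
  have e2 := energy (-1)
  have e3 := energy Complex.I
  have e4 := energy (-Complex.I)
  simp only [one_smul, neg_smul, ← sub_eq_add_neg] at e1 e2 e3 e4
  have cast : ∀ f : R3 → ℝ, Measurable (fun κ => f κ ^ 2) →
      Measurable fun κ => ((f κ : ℂ)) ^ 2 := fun f hf => by
    simpa [Function.comp_def] using Complex.measurable_ofReal.comp hf
  exact (((cast _ e1).sub (cast _ e2)).add
    (((cast _ e4).sub (cast _ e3)).mul_const _)).div_const _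

end

end MaxwellHom

/-! ### The cell problem in Fourier coefficients and its solvability. -/

namespace MaxwellHom

noncomputable section

/-! ### Quasiperiodic gradients of smooth periodic functions -/

lemma cplx_apply (x : R3) (i : Fin 3) : cplx x i = (x i : ℂ) := rfl

lemma cplx_smul (r : ℝ) (x : R3) : cplx (r • x) = (r : ℂ) • cplx x := by
  ext i; simp [cplx_apply]

lemma norm_cplx (x : R3) : ‖cplx x‖ = ‖x‖ := by
  simp [EuclideanSpace.norm_eq, cplx_apply]

lemma continuous_cplx : Continuous cplx :=
  (PiLp.continuous_toLp 2 _).comp (continuous_pi fun i => by fun_prop)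

lemma pd_mul {f g : R3 → ℂ} {y : R3} (hf : DifferentiableAt ℝ f y) (hg : DifferentiableAt ℝ g y)
    (j : Fin 3) : pd j (fun z => f z * g z) y = f y * pd j g y + g y * pd j f y := by
  rw [pd, fderiv_fun_mul hf hg]
  simp [pd]

lemma pd_ex_mul {φ : R3 → ℂ} {y : R3} (hφ : DifferentiableAt ℝ φ y) (κ : R3) (j : Fin 3) :
    pd j (fun z => ex κ z * φ z) y = ex κ y * (pd j φ y + Complex.I * (κ j : ℂ) * φ y) := by
  rw [pd_mul (hasFDerivAt_ex κ y).differentiableAt hφ, pd_ex]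
  ring

lemma grad_ex_mul {φ : R3 → ℂ} {y : R3} (hφ : DifferentiableAt ℝ φ y) (κ : R3) :
    grad (fun z => ex κ z * φ z) y = ex κ y • (grad φ y + (Complex.I * φ y) • cplx κ) := by
  ext j
  simp only [grad, pd_ex_mul hφ, PiLp.smul_apply, PiLp.add_apply, smul_eq_mul, cplx_apply]
  ring

lemma qgrad_eq {φ : R3 → ℂ} {y : R3} (hφ : DifferentiableAt ℝ φ y) (κ : R3) :
    qgrad κ φ y = grad φ y + (Complex.I * φ y) • cplx κ := by
  rw [qgrad, grad_ex_mul hφ, smul_smul, conj_ex_mul_ex, one_smul]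

lemma continuous_pd {φ : R3 → ℂ} (hφ : ContDiff ℝ ∞ φ) (j : Fin 3) : Continuous (pd j φ) :=
  (hφ.continuous_fderiv (by simp)).clm_apply continuous_const

lemma continuous_grad {φ : R3 → ℂ} (hφ : ContDiff ℝ ∞ φ) : Continuous (grad φ) :=
  (PiLp.continuous_toLp 2 _).comp (continuous_pi fun j => continuous_pd hφ j)

lemma differentiable_of_contDiff {φ : R3 → ℂ} (hφ : ContDiff ℝ ∞ φ) : Differentiable ℝ φ :=
  hφ.differentiable (by simp)

lemma continuous_qgrad {φ : R3 → ℂ} (hφ : ContDiff ℝ ∞ φ) (κ : R3) : Continuous (qgrad κ φ) := by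
  have : qgrad κ φ = fun y => grad φ y + (Complex.I * φ y) • cplx κ :=
    funext fun y => qgrad_eq (differentiable_of_contDiff hφ y) κ
  rw [this]
  exact (continuous_grad hφ).add ((continuous_const.mul hφ.continuous).smul continuous_const)

lemma memLp_cell_of_continuous_scalar {f : R3 → ℂ} (hf : Continuous f) : MemLp f 2 cellVol := by
  have h := memLp_apply (memLp_cell_of_continuous
    (f := fun y => f y • EuclideanSpace.single (0 : Fin 3) (1 : ℂ)) (hf.smul continuous_const)) 0
  simpa using h

/-- The integrals over the cell of derivatives of smooth periodic functions vanish. -/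
def CellGradFree : Prop :=
  ∀ φ : R3 → ℂ, IsSmoothPeriodic φ → ∀ j : Fin 3, ∫ y, pd j φ y ∂cellVol = 0

/-- Integration by parts on the cell: the hypothesis is applied to the product of `φ` with the
conjugate character, and the product rule gives both terms. -/
lemma fc_pd (hgrad : CellGradFree) {φ : R3 → ℂ} (hφ : IsSmoothPeriodic φ) (m : Fin 3 → ℤ)
    (j : Fin 3) : fc m (pd j φ) = Complex.I * (freq m j : ℂ) * fc m φ := by
  have hs : IsSmoothPeriodic (fun z => ex (freq (-m)) z * φ z) :=
    ⟨(contDiff_ex _).mul hφ.1, fun n y => by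
      simp only [isPeriodicFun_ex_freq (-m) n y, hφ.2 n y]⟩
  have h := hgrad _ hs j
  have hd := differentiable_of_contDiff hφ.1
  have hi1 := integrable_fc (memLp_cell_of_continuous_scalar (continuous_pd hφ.1 j)) m
  have hi2 := integrable_fc (memLp_cell_of_continuous_scalar hφ.1.continuous) m
  have hpt : ∀ y, pd j (fun z => ex (freq (-m)) z * φ z) y
      = conj (ex (freq m) y) • pd j φ y
        - (Complex.I * (freq m j : ℂ)) * (conj (ex (freq m) y) • φ y) := fun y => by
    rw [pd_ex_mul (hd y), conj_ex, freq_neg]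
    simp only [PiLp.neg_apply, Complex.ofReal_neg, smul_eq_mul]
    ring
  simp only [hpt] at h
  rw [integral_sub hi1 (hi2.const_mul _), integral_const_mul, sub_eq_zero] at h
  exact h

lemma fc_qgrad (hgrad : CellGradFree) {φ : R3 → ℂ} (hφ : IsSmoothPeriodic φ) (m : Fin 3 → ℤ)
    (κ : R3) : fc m (qgrad κ φ) = (Complex.I * fc m φ) • cplx (κ + freq m) := by
  ext j
  have hd := differentiable_of_contDiff hφ.1
  rw [fc_apply (memLp_cell_of_continuous (continuous_qgrad hφ.1 κ))]
  have hpt : (fun y => qgrad κ φ y j)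
      = fun y => pd j φ y + (Complex.I * (κ j : ℂ)) • φ y := by
    funext y
    rw [qgrad_eq (hd y)]
    simp only [grad, PiLp.add_apply, PiLp.smul_apply, cplx_apply, smul_eq_mul]
    ring
  rw [hpt, fc_add (g := fun y => (Complex.I * (κ j : ℂ)) • φ y)
    (memLp_cell_of_continuous_scalar (continuous_pd hφ.1 j))
    ((memLp_cell_of_continuous_scalar hφ.1.continuous).const_smul (Complex.I * (κ j : ℂ))), fc_smul,
    fc_pd hgrad hφ]
  simp only [PiLp.smul_apply, cplx_apply, PiLp.add_apply, smul_eq_mul]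
  push_cast
  ring

/-- The directions of the Fourier coefficients of the quasiperiodic gradients of functions of zero
mean. -/
def cellModes (κ : R3) (m : Fin 3 → ℤ) : C3 := if m = 0 then 0 else cplx (κ + freq m)

lemma continuous_cellModes (m : Fin 3 → ℤ) : Continuous fun κ => cellModes κ m := by
  unfold cellModes
  split_ifs
  · exact continuous_const
  · exact continuous_cplx.comp (continuous_id.add continuous_const)

lemma fc_zero_eq {E : Type*} [NormedAddCommGroup E] [NormedSpace ℂ E] (f : R3 → E) :
    fc 0 f = ∫ y, f y ∂cellVol := by
  simp [fc, freq_zero, ex_zero]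

lemma isModal_qgrad (hgrad : CellGradFree) {φ : R3 → ℂ}
    (hφ : IsSmoothPeriodicZeroMean volume φ) (κ : R3) : IsModal (cellModes κ) (qgrad κ φ) := by
  refine ⟨memLp_cell_of_continuous (continuous_qgrad hφ.1.1 κ), fun m => ?_⟩
  rw [fc_qgrad hgrad hφ.1]
  rcases eq_or_ne m 0 with rfl | hm
  · rw [fc_zero_eq, hφ.2]
    simp
  · rw [cellModes, if_neg hm]
    exact Submodule.smul_mem _ _ (Submodule.mem_span_singleton_self _)

lemma eLpNorm_two_eq {α E : Type*} {mα : MeasurableSpace α} [NormedAddCommGroup E] {μ : Measure α}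
    {f : α → E} (hf : MemLp f 2 μ) :
    eLpNorm f 2 μ = ENNReal.ofReal (√(∫ y, ‖f y‖ ^ 2 ∂μ)) := by
  rw [hf.eLpNorm_eq_integral_rpow_norm (by simp) (by simp), Real.sqrt_eq_rpow]
  simp

lemma tendsto_fc {f : R3 → C3} {g : ℕ → R3 → C3} (hf : MemLp f 2 cellVol)
    (hg : ∀ k, MemLp (g k) 2 cellVol)
    (h : Tendsto (fun k => eLpNorm (fun y => f y - g k y) 2 cellVol) atTop (𝓝 0))
    (m : Fin 3 → ℤ) : Tendsto (fun k => fc m (g k)) atTop (𝓝 (fc m f)) := by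
  rw [tendsto_iff_norm_sub_tendsto_zero]
  have h' := (ENNReal.tendsto_toReal (by simp)).comp h
  refine squeeze_zero (fun _ => norm_nonneg _) (fun k => ?_) h'
  have hd := hf.sub (hg k)
  have hd' : MemLp (fun y => f y - g k y) 2 cellVol := hd
  rw [Function.comp_apply, eLpNorm_two_eq hd', ENNReal.toReal_ofReal (Real.sqrt_nonneg _),
    ← norm_neg, neg_sub, ← fc_sub hf (hg k)]
  refine Real.le_sqrt_of_sq_le ?_
  exact le_hasSum (hasSum_sq_fc hd') m fun _ _ => by positivity

section Family

variable {A : R3 → MatR}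

/-- Smooth approximants have coefficients on the right lines, a line in `ℂ³` is closed, and each
Fourier coefficient is continuous on `L²`. -/
lemma IsCellSolution.isModal (hgrad : CellGradFree) {κ : R3} {c : C3} {ψ : R3 → ℂ} {p : R3 → C3}
    (h : IsCellSolution volume A κ c ψ p) : IsModal (cellModes κ) p := by
  obtain ⟨⟨-, -, -, hp, φ, hφ, -, hlim⟩, -⟩ := h
  refine ⟨hp, fun m => ?_⟩
  have hq := fun k => isModal_qgrad hgrad (hφ k) κ
  exact (Submodule.closed_of_finiteDimensional (Submodule.span ℂ {cellModes κ m})).mem_of_tendsto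
    (tendsto_fc hp (fun k => (hq k).1) hlim m) (Eventually.of_forall fun k => (hq k).2 m)

lemma act_invC (hpos : ∀ y, (A y).PosDef) (y : R3) (v : C3) :
    act (invC A y) v = act ((sqrtC A y)⁻¹) (act ((sqrtC A y)⁻¹) v) := by
  rw [invC_eq hpos, act_mul]

lemma isSmoothPeriodicZeroMean_ex_freq {m : Fin 3 → ℤ} (hm : m ≠ 0) :
    IsSmoothPeriodicZeroMean volume (ex (freq m)) :=
  ⟨isSmoothPeriodic_ex_freq m, by rw [integral_cell_ex_freq, if_neg hm]⟩

lemma inner_grad_ex_mul {φ : R3 → ℂ} {y : R3} (hφ : DifferentiableAt ℝ φ y) (κ : R3) (v : C3) :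
    inner ℂ (grad (fun z => ex κ z * φ z) y) (ex κ y • v) = inner ℂ (qgrad κ φ y) v := by
  rw [grad_ex_mul hφ, qgrad_eq hφ, inner_smul_left, inner_smul_right, ← mul_assoc,
    conj_ex_mul_ex, one_mul]

/-- The characters with `m ≠ 0` are admissible test functions, and testing with them isolates the
individual coefficients of the flux. For `m = 0` the prescribed direction is zero. -/
lemma IsCellSolution.isOrthModal (hpos : ∀ y, (A y).PosDef) {b : ℝ}
    (hW : IsWeight (fun y => (sqrtC A y)⁻¹) (sqrtC A) b) {κ : R3} {c : C3} {ψ : R3 → ℂ}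
    {p : R3 → C3} (h : IsCellSolution volume A κ c ψ p) :
    IsOrthModal (cellModes κ)
      (fun x => act ((sqrtC A x)⁻¹) (act ((sqrtC A x)⁻¹) (p x + c))) := by
  obtain ⟨⟨-, -, -, hp, -⟩, ho⟩ := h
  have hm : MemLp (fun x => act ((sqrtC A x)⁻¹) (act ((sqrtC A x)⁻¹) (p x + c))) 2 cellVol :=
    MemLp.act hW.contS hW.boundS (MemLp.act hW.contS hW.boundS (hp.add (memLp_const c)))
  refine ⟨hm, fun m => ?_⟩
  rcases eq_or_ne m 0 with rfl | hm0
  · simp [cellModes]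
  · have h := ho _ (isSmoothPeriodicZeroMean_ex_freq hm0)
    have hd := differentiable_of_contDiff (contDiff_ex (freq m))
    simp only [fun y => inner_grad_ex_mul (hd y) κ, act_invC hpos] at h
    have hq : ∀ y, qgrad κ (ex (freq m)) y
        = ex (freq m) y • (Complex.I • cplx (κ + freq m)) := fun y => by
      rw [qgrad_eq (hd y)]
      ext j
      simp only [grad, pd_ex, PiLp.add_apply, PiLp.smul_apply, cplx_apply, smul_eq_mul]
      push_cast
      ring
    simp only [hq] at h
    rw [integral_inner_ex_smul hm, inner_smul_left] at h
    rw [cellModes, if_neg hm0]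
    exact (mul_eq_zero.1 h).resolve_left (by simp)

/-- The points `t + 2πn` form a discrete set. The gap depends on `t` and degenerates near the dual
lattice; it only serves to show that the potential `ψ` is square integrable and enters no estimate.
-/
lemma exists_gap (t : ℝ) : ∃ δ > 0, ∀ n : ℤ, t + 2 * Real.pi * n ≠ 0 →
    δ ≤ |t + 2 * Real.pi * n| := by
  have hpi := Real.two_pi_pos
  set s := t / (2 * Real.pi) with hs
  have ht : t = 2 * Real.pi * s := by rw [hs]; field_simp
  have key : ∃ δ > 0, ∀ n : ℤ, s + n ≠ 0 → δ ≤ |s + n| := by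
    -- For integral `s` the nonzero values of `s + n` have modulus at least `1`; otherwise the
    -- distance of `s` to the nearest integer is the gap.
    by_cases h : s = round s
    · refine ⟨1, one_pos, fun n hn => ?_⟩
      rw [h] at hn ⊢
      have : (round s + n : ℤ) ≠ 0 := fun h0 => hn (by exact_mod_cast h0)
      have := Int.one_le_abs this
      exact_mod_cast this
    · refine ⟨|s - round s|, abs_pos.2 (sub_ne_zero.2 h), fun n _ => ?_⟩
      have := round_le s (-n)
      simpa using this
  obtain ⟨δ, hδ, h⟩ := key
  refine ⟨2 * Real.pi * δ, by positivity, fun n hn => ?_⟩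
  rw [ht, ← mul_add] at hn ⊢
  rw [abs_mul, abs_of_pos hpi]
  exact mul_le_mul_of_nonneg_left (h n (right_ne_zero_of_mul hn)) hpi.le

lemma exists_gap_vec (κ : R3) : ∃ δ > 0, ∀ m, cplx (κ + freq m) ≠ 0 →
    δ ≤ ‖cplx (κ + freq m)‖ := by
  choose δ hδ h using fun i => exists_gap (κ i)
  refine ⟨min (δ 0) (min (δ 1) (δ 2)), by simp [hδ], fun m hm => ?_⟩
  have : ∃ i, κ i + 2 * Real.pi * m i ≠ 0 := by
    by_contra! hcon
    refine hm ?_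
    ext i
    rw [cplx_apply, PiLp.add_apply, freq_apply, hcon i]
    simp
  obtain ⟨i, hi⟩ := this
  have h1 : δ i ≤ ‖cplx (κ + freq m)‖ := by
    refine (h i _ hi).trans ?_
    rw [norm_cplx]
    exact PiLp.norm_apply_le (κ + freq m) i
  refine le_trans ?_ h1
  fin_cases i <;> simp

/-- The quasigradient `p` is found first, by projection. The potential is then recovered from the
coefficients of `p` along the vectors `κ + 2πm`, and its Fourier partial sums are the smooth
approximants required by the definition. -/
lemma exists_isCellSolution (hgrad : CellGradFree) (hpos : ∀ y, (A y).PosDef) {b : ℝ}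
    (hW : IsWeight (fun y => (sqrtC A y)⁻¹) (sqrtC A) b) (κ : R3) (c : C3) :
    ∃ ψ p, IsCellSolution volume A κ c ψ p := by
  obtain ⟨y, hy, ho, -⟩ := hW.exists_modal (cellModes κ)
    (MemLp.act hW.contS hW.boundS (memLp_const c))
  -- The projection determines the field on the cell only; this is its periodic extension.
  let p : R3 → C3 := fun x => y (torusSection (torusMap x))
  have hpy : p =ᵐ[cellVol] y := by
    filter_upwards [ae_restrict_mem measurableSet_cell] with x hx
    simp only [p, torusSection_torusMap hx]
  have hp : MemLp p 2 cellVol := (memLp_congr_ae hpy).2 hy.1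
  have htp : ∀ n x, torusMap (x + latticeVec n) = torusMap x := fun n x => by
    funext i
    have h1 : ((n i : ℝ) : UnitAddCircle) = 0 :=
      (AddCircle.coe_eq_zero_iff (1 : ℝ)).2 ⟨n i, by simp⟩
    change ((x i + n i : ℝ) : UnitAddCircle) = ((x i : ℝ) : UnitAddCircle)
    rw [AddCircle.coe_add, h1, add_zero]
  have hpm : IsModal (cellModes κ) p := ⟨hp, fun m => by rw [fc_congr hpy]; exact hy.2 m⟩
  have hor : IsOrthModal (cellModes κ)
      (fun x => act ((sqrtC A x)⁻¹) (act ((sqrtC A x)⁻¹) (p x + c))) := by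
    have hae : (fun x => act ((sqrtC A x)⁻¹) (act ((sqrtC A x)⁻¹) (p x + c))) =ᵐ[cellVol]
        (fun x => act ((sqrtC A x)⁻¹) (act ((sqrtC A x)⁻¹) (y x) + act ((sqrtC A x)⁻¹) c)) := by
      filter_upwards [hpy] with x hx
      rw [hx, act_add]
    exact ⟨(memLp_congr_ae hae).2 ho.1, fun m => by rw [fc_congr hae]; exact ho.2 m⟩
  have hcoef : ∃ a : (Fin 3 → ℤ) → ℂ, (∀ m, fc m p = a m • cellModes κ m) ∧
      ∀ m, cellModes κ m = 0 → a m = 0 := by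
    choose a ha using fun m => Submodule.mem_span_singleton.1 (hpm.2 m)
    -- Where the direction vanishes the coefficient is set to zero. This concerns `m = 0`, which
    -- gives the zero mean, and a possible resonance `κ = -2πm`.
    refine ⟨fun m => if cellModes κ m = 0 then 0 else a m, fun m => ?_, fun m hm => if_pos hm⟩
    dsimp only
    split_ifs with h
    · rw [← ha m, h, smul_zero, smul_zero]
    · exact (ha m).symm
  obtain ⟨a, ha, ha0⟩ := hcoef
  let α : (Fin 3 → ℤ) → ℂ := fun m => -Complex.I * a m
  have hIα : ∀ m, Complex.I * α m = a m := fun m => by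
    simp only [α]
    rw [← mul_assoc, mul_neg, Complex.I_mul_I]; simp
  obtain ⟨δ, hδ, hgap⟩ := exists_gap_vec κ
  have hαs : Summable fun m => ‖α m‖ ^ 2 := by
    refine Summable.of_nonneg_of_le (fun _ => by positivity) (fun m => ?_)
      ((hasSum_sq_fc hp).summable.mul_left ((δ ^ 2)⁻¹))
    have h1 : ‖α m‖ = ‖a m‖ := by simp [α]
    rw [h1, ha m, norm_smul, mul_pow]
    by_cases hm : cellModes κ m = 0
    · simp [ha0 m hm]
    · have hm' : cellModes κ m = cplx (κ + freq m) := by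
        rw [cellModes, if_neg]; rintro rfl; exact hm (by simp [cellModes])
      rw [hm'] at hm ⊢
      rw [← div_eq_inv_mul, le_div_iff₀ (by positivity)]
      gcongr
      exact hgap m hm
  obtain ⟨ψ, hψp, hψ, hψα⟩ := exists_fc_eq hαs
  let φ : Finset (Fin 3 → ℤ) → R3 → ℂ := fun s y => ∑ m ∈ s, α m * ex (freq m) y
  have hφp : ∀ s, IsSmoothPeriodic (φ s) := fun s => by
    refine ⟨ContDiff.sum fun m _ => contDiff_const.mul (contDiff_ex _), fun n y => ?_⟩
    exact Finset.sum_congr rfl fun m _ => by rw [isPeriodicFun_ex_freq m n]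
  have hφfc : ∀ s n, fc n (φ s) = if n ∈ s then α n else 0 := fun s n => by
    have h : fc n (φ s) = ∑ m ∈ s, fc n (fun x => α m • ex (freq m) x • (1 : ℂ)) := by
      simp only [fc, φ, smul_eq_mul, mul_one, Finset.mul_sum]
      refine integral_finsetSum _ fun m _ => ?_
      have := integrable_fc (memLp_cell_of_continuous_scalar
        (f := fun x => α m * ex (freq m) x) (by fun_prop)) n
      simpa using this
    rw [h]
    simp only [fc_smul, fc_ex_smul_const]
    simp
  have hα0 : α 0 = 0 := by simp [α, ha0 0 (by simp [cellModes])]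
  have hφz : ∀ s, IsSmoothPeriodicZeroMean volume (φ s) := fun s => by
    refine ⟨hφp s, ?_⟩
    rw [← fc_zero_eq, hφfc, hα0, ite_self]
  have hq : ∀ s, qgrad κ (φ s) =ᵐ[cellVol] trigPoly (cellModes κ) s a := fun s => by
    have hm1 : MemLp (qgrad κ (φ s)) 2 cellVol := (isModal_qgrad hgrad (hφz s) κ).1
    have hm2 := memLp_trigPoly (cellModes κ) s a
    have h0 := eq_zero_of_fc (f := fun x => qgrad κ (φ s) x - trigPoly (cellModes κ) s a x)
      (hm1.sub hm2) (fun n => by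
        rw [fc_sub hm1 hm2, fc_qgrad hgrad (hφp s), fc_trigPoly, hφfc]
        split_ifs with hn
        · rw [hIα]
          rcases eq_or_ne n 0 with rfl | hn0
          · simp [cellModes, ha0 0 (by simp [cellModes])]
          · rw [cellModes, if_neg hn0, sub_self]
        · simp)
    filter_upwards [h0] with x hx
    exact sub_eq_zero.1 hx
  -- A sequence of finite sets exhausting the lattice turns convergence of nets of partial sums into
  -- convergence of sequences.
  obtain ⟨s, hs⟩ := exists_seq_tendsto (atTop : Filter (Finset (Fin 3 → ℤ)))
  refine ⟨ψ, p, ⟨hψp, fun n x => by simp only [p, htp], hψ, hp, fun k => φ (s k),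
    fun k => hφz _, ?_, ?_⟩, fun φ hφ => ?_⟩
  -- The scalar potential is placed in the first component of a vector field in order to reuse the
  -- vector-valued tail estimate.
  · have he : MemLp (fun x => ψ x • EuclideanSpace.single (0 : Fin 3) (1 : ℂ)) 2 cellVol :=
      (ContinuousLinearMap.toSpanSingleton ℂ
        (EuclideanSpace.single (0 : Fin 3) (1 : ℂ))).comp_memLp' hψ
    have hlim := tendsto_integral_sub_trigPoly (w := fun _ => EuclideanSpace.single 0 1) (a := α)
      he (fun m => by
        rw [← hψα m]
        simp only [fc, smul_smul, smul_eq_mul]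
        exact integral_smul_const _ _)
    have h2 : ∀ k, eLpNorm (fun y => ψ y - φ (s k) y) 2 cellVol = ENNReal.ofReal (√(∫ x,
        ‖ψ x • EuclideanSpace.single (0 : Fin 3) (1 : ℂ)
          - trigPoly (fun _ => EuclideanSpace.single 0 1) (s k) α x‖ ^ 2 ∂cellVol)) := fun k => by
      have hm : MemLp (fun y => ψ y - φ (s k) y) 2 cellVol :=
        hψ.sub (memLp_cell_of_continuous_scalar (hφp (s k)).1.continuous)
      rw [eLpNorm_two_eq hm]
      congr 3
      funext x
      have : trigPoly (fun _ => EuclideanSpace.single (0 : Fin 3) (1 : ℂ)) (s k) α x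
          = φ (s k) x • EuclideanSpace.single 0 1 := by
        simp only [trigPoly, φ, Finset.sum_smul, smul_smul]
      rw [this, ← sub_smul, norm_smul]
      simp
    simp only [h2]
    have h3 := (hlim.comp hs).sqrt
    have h4 := ENNReal.tendsto_ofReal h3
    simpa using h4
  · have hlim := tendsto_integral_sub_trigPoly hp ha
    have h2 : ∀ k, eLpNorm (fun y => p y - qgrad κ (φ (s k)) y) 2 cellVol = ENNReal.ofReal (√(∫ x,
        ‖p x - trigPoly (cellModes κ) (s k) a x‖ ^ 2 ∂cellVol)) := fun k => by
      have hm : MemLp (fun x => p x - trigPoly (cellModes κ) (s k) a x) 2 cellVol :=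
        hp.sub (memLp_trigPoly _ _ _)
      rw [← eLpNorm_two_eq hm]
      refine eLpNorm_congr_ae ?_
      filter_upwards [hq (s k)] with x hx
      rw [hx]
    simp only [h2]
    simpa using ENNReal.tendsto_ofReal (hlim.comp hs).sqrt
  · have hd := differentiable_of_contDiff hφ.1.1
    simp only [fun y => inner_grad_ex_mul (hd y) κ, act_invC hpos]
    exact (isModal_qgrad hgrad hφ κ).integral_inner_eq_zero hor

lemma exists_isCellFamily (hgrad : CellGradFree) (hpos : ∀ y, (A y).PosDef) {b : ℝ}
    (hW : IsWeight (fun y => (sqrtC A y)⁻¹) (sqrtC A) b) : ∃ Ψ P, IsCellFamily volume A Ψ P := by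
  choose Ψ P h using fun (κ : R3) (j : Fin 3) =>
    exists_isCellSolution hgrad hpos hW κ (EuclideanSpace.single j 1)
  exact ⟨Ψ, P, h⟩

end Family

end

end MaxwellHom

/-! ### Corrected fields, the effective matrix and bounds uniform in the quasimomentum. -/

namespace MaxwellHom

noncomputable section

/-! ### Families of corrected fields -/

/-- The fields `P κ j` are the periodic quasigradients solving the cell problems with the weight
`S * S`. -/
structure IsBlochFamily (S : R3 → MatC) (P : R3 → Fin 3 → R3 → C3) : Prop where
  per : ∀ κ j, IsPeriodicFun (P κ j)
  modal : ∀ κ j, IsModal (cellModes κ) (P κ j)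
  orth : ∀ κ j, IsOrthModal (cellModes κ)
    (fun x => act (S x) (act (S x) (P κ j x + EuclideanSpace.single j 1)))

lemma IsCellFamily.isBlochFamily {A : R3 → MatR} (hgrad : CellGradFree)
    (hpos : ∀ y, (A y).PosDef) {b : ℝ} (hW : IsWeight (fun y => (sqrtC A y)⁻¹) (sqrtC A) b)
    {Ψ : R3 → Fin 3 → R3 → ℂ} {P : R3 → Fin 3 → R3 → C3} (h : IsCellFamily volume A Ψ P) :
    IsBlochFamily (fun y => (sqrtC A y)⁻¹) P :=
  ⟨fun κ j => (h κ j).1.2.1, fun κ j => (h κ j).isModal hgrad,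
    fun κ j => (h κ j).isOrthModal hpos hW⟩

/-- The effective matrix with columns `∫ S S (P κ j + e_j)` over the cell. -/
def effMatrix (S : R3 → MatC) (P : R3 → Fin 3 → R3 → C3) (κ : R3) : MatC :=
  Matrix.of fun i j =>
    fc 0 (fun x => act (S x) (act (S x) (P κ j x + EuclideanSpace.single j 1))) i

lemma act_cellMatrix (P : R3 → Fin 3 → R3 → C3) (κ x : R3) (c : C3) :
    act (cellMatrix P κ x) c = ∑ j, c j • (P κ j x + EuclideanSpace.single j 1) := by
  ext i
  rw [act_apply, WithLp.ofLp_sum, Finset.sum_apply]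
  refine Finset.sum_congr rfl fun j _ => ?_
  simp only [cellMatrix, Matrix.add_apply, Matrix.of_apply, PiLp.smul_apply, PiLp.add_apply,
    smul_eq_mul, Matrix.one_apply, PiLp.single_apply]
  ring

lemma sum_smul_single (c : C3) : ∑ j, c j • EuclideanSpace.single j (1 : ℂ) = c := by
  ext i
  rw [WithLp.ofLp_sum, Finset.sum_apply]
  simp

section Bloch

variable {S T : R3 → MatC} {b : ℝ} {P : R3 → Fin 3 → R3 → C3}

lemma IsModal.sum {w : (Fin 3 → ℤ) → C3} {p : Fin 3 → R3 → C3} (hp : ∀ j, IsModal w (p j)) :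
    IsModal w (fun x => ∑ j, p j x) := by
  simp only [Fin.sum_univ_three]
  exact ((hp 0).add (hp 1)).add (hp 2)

lemma IsOrthModal.sum {w : (Fin 3 → ℤ) → C3} {p : Fin 3 → R3 → C3}
    (hp : ∀ j, IsOrthModal w (p j)) : IsOrthModal w (fun x => ∑ j, p j x) := by
  simp only [Fin.sum_univ_three]
  exact ((hp 0).add (hp 1)).add (hp 2)

lemma IsBlochFamily.modal_sub (hP : IsBlochFamily S P) (κ : R3) (c : C3) :
    IsModal (cellModes κ) (fun x => act (cellMatrix P κ x) c - c) := by
  have h := IsModal.sum fun j => (hP.modal κ j).smul (c j)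
  convert h using 2 with x
  rw [act_cellMatrix]
  simp only [smul_add, Finset.sum_add_distrib, sum_smul_single, add_sub_cancel_right]

lemma act_sum (M : MatC) (v : Fin 3 → C3) : act M (∑ j, v j) = ∑ j, act M (v j) := by
  simp only [Fin.sum_univ_three, act_add]

lemma act_act_cellMatrix (S : R3 → MatC) (P : R3 → Fin 3 → R3 → C3) (κ : R3) (c : C3) :
    (fun x => act (S x) (act (S x) (act (cellMatrix P κ x) c)))
      = fun x => ∑ j, c j •
          act (S x) (act (S x) (P κ j x + EuclideanSpace.single j 1)) := by
  funext x
  rw [act_cellMatrix, act_sum, act_sum]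
  simp only [act_smul]

lemma IsBlochFamily.orth_act (hP : IsBlochFamily S P) (κ : R3) (c : C3) :
    IsOrthModal (cellModes κ)
      (fun x => act (S x) (act (S x) (act (cellMatrix P κ x) c))) := by
  rw [act_act_cellMatrix]
  exact IsOrthModal.sum fun j => (hP.orth κ j).smul (c j)

lemma IsBlochFamily.memLp (hP : IsBlochFamily S P) (κ : R3) (c : C3) :
    MemLp (fun x => act (cellMatrix P κ x) c) 2 cellVol := by
  have h := (hP.modal_sub κ c).1.add (memLp_const c)
  refine h.ae_eq (ae_of_all _ fun x => ?_)
  simp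

lemma fc_sum_smul {q : Fin 3 → R3 → C3} (hq : ∀ j, MemLp (q j) 2 cellVol) (c : C3)
    (m : Fin 3 → ℤ) : fc m (fun x => ∑ j, c j • q j x) = ∑ j, c j • fc m (q j) := by
  have h : ∀ j, MemLp (fun x => c j • q j x) 2 cellVol := fun j => (hq j).const_smul (c j)
  have h01 : MemLp (fun x => c 0 • q 0 x + c 1 • q 1 x) 2 cellVol := (h 0).add (h 1)
  simp only [Fin.sum_univ_three]
  rw [fc_add h01 (h 2), fc_add (h 0) (h 1), fc_smul, fc_smul, fc_smul]

lemma IsBlochFamily.act_effMatrix (hP : IsBlochFamily S P) (κ : R3) (c : C3) :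
    act (effMatrix S P κ) c
      = fc 0 (fun x => act (S x) (act (S x) (act (cellMatrix P κ x) c))) := by
  rw [act_act_cellMatrix, fc_sum_smul fun j => (hP.orth κ j).1]
  ext i
  rw [act_apply, WithLp.ofLp_sum, Finset.sum_apply]
  refine Finset.sum_congr rfl fun j _ => ?_
  rw [PiLp.smul_apply, smul_eq_mul, mul_comm]
  rfl

lemma fc_zero_sub_self {f : R3 → C3} (hf : MemLp f 2 cellVol) (n : Fin 3 → ℤ) :
    fc n (fun x => f x - fc 0 f) = if n = 0 then 0 else fc n f := by
  rw [fc_sub hf (memLp_const _), fc_const]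
  split_ifs with h
  · rw [h, sub_self]
  · rw [sub_zero]

lemma cellModes_of_ne {κ : R3} {m : Fin 3 → ℤ} (hm : m ≠ 0) :
    cellModes κ m = cplx (κ + freq m) := if_neg hm

lemma cellModes_zero (κ : R3) : cellModes κ 0 = 0 := if_pos rfl

lemma inner_cell_const {f : R3 → C3} (hf : MemLp f 2 cellVol) (c : C3) :
    ∫ x, inner ℂ (f x) c ∂cellVol = inner ℂ (fc 0 f) c := by
  have h := integral_inner_ex_smul hf 0 c
  simp only [freq_zero, ex_zero, one_smul] at h
  rw [← inner_conj_symm, ← h, ← integral_conj]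
  simp only [inner_conj_symm]

lemma IsBlochFamily.fc_zero (hP : IsBlochFamily S P) (κ : R3) (c : C3) :
    fc 0 (fun x => act (cellMatrix P κ x) c) = c := by
  have h := (hP.modal_sub κ c).2 0
  rw [cellModes_zero, fc_sub (hP.memLp κ c) (memLp_const c), fc_const] at h
  simpa [sub_eq_zero] using h

/-- Pairing a corrected field with a field whose nonzero modes are transversal. -/
lemma IsBlochFamily.integral_inner_of_orth (hP : IsBlochFamily S P) {κ : R3} (c : C3)
    {f : R3 → C3} (hf : IsOrthModal (cellModes κ) f) :
    ∫ x, inner ℂ (f x) (act (cellMatrix P κ x) c) ∂cellVol = inner ℂ (fc 0 f) c := by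
  have h0 := (hP.modal_sub κ c).integral_inner_eq_zero hf
  have h1 : ∫ x, inner ℂ (f x) (act (cellMatrix P κ x) c - c) ∂cellVol = 0 := by
    have : ∀ x, inner ℂ (f x) (act (cellMatrix P κ x) c - c)
        = conj (inner ℂ (act (cellMatrix P κ x) c - c) (f x)) := fun x => by
      rw [inner_conj_symm]
    simp only [this]
    rw [integral_conj, h0, map_zero]
  simp only [inner_sub_right] at h1
  rw [integral_sub (integrable_inner hf.1 (hP.memLp κ c)) (integrable_inner hf.1 (memLp_const c)),
    sub_eq_zero] at h1
  rw [h1, inner_cell_const hf.1]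

/-- Pairing the flux of a corrected field with a field whose nonzero modes are longitudinal. -/
lemma IsBlochFamily.integral_inner_of_modal (hP : IsBlochFamily S P) {κ : R3} (c : C3)
    {z : R3 → C3} (hz : MemLp z 2 cellVol)
    (hzm : ∀ n ≠ 0, fc n z ∈ Submodule.span ℂ {cellModes κ n}) :
    ∫ x, inner ℂ (z x) (act (S x) (act (S x) (act (cellMatrix P κ x) c))) ∂cellVol
      = inner ℂ (fc 0 z) (act (effMatrix S P κ) c) := by
  have ho := hP.orth_act κ c
  have hm : IsModal (cellModes κ) (fun x => z x - fc 0 z) := by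
    refine ⟨hz.sub (memLp_const _), fun n => ?_⟩
    rw [fc_zero_sub_self hz]
    split_ifs with hn
    · exact Submodule.zero_mem _
    · exact hzm n hn
  have h0 := hm.integral_inner_eq_zero ho
  simp only [inner_sub_left] at h0
  rw [integral_sub (integrable_inner hz ho.1) (integrable_inner (memLp_const _) ho.1),
    sub_eq_zero] at h0
  rw [h0, hP.act_effMatrix]
  have := integral_inner_ex_smul ho.1 0 (fc 0 z)
  simpa only [freq_zero, ex_zero, one_smul] using this

lemma norm_integral_inner_sq_le {μ : Measure R3} {f g : R3 → C3} (hf : MemLp f 2 μ)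
    (hg : MemLp g 2 μ) : ‖∫ x, inner ℂ (f x) (g x) ∂μ‖ ^ 2
      ≤ (∫ x, ‖f x‖ ^ 2 ∂μ) * ∫ x, ‖g x‖ ^ 2 ∂μ := by
  rw [← inner_toLp hf hg, ← norm_toLp_sq hf, ← norm_toLp_sq hg, ← mul_pow]
  gcongr
  exact norm_inner_le_norm _ _

lemma integral_norm_sq_le {μ : Measure R3} {f g : R3 → C3} {C : ℝ} (hg : MemLp g 2 μ)
    (h : ∀ x, ‖f x‖ ≤ C * ‖g x‖) : ∫ x, ‖f x‖ ^ 2 ∂μ ≤ C ^ 2 * ∫ x, ‖g x‖ ^ 2 ∂μ := by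
  rw [← integral_const_mul]
  refine integral_mono_of_nonneg (ae_of_all _ fun x => by positivity)
    ((integrable_norm_sq hg).const_mul _) (ae_of_all _ fun x => ?_)
  dsimp only
  rw [← mul_pow]
  have := h x
  gcongr

lemma IsWeight.norm_le (hW : IsWeight S T b) (y : R3) (v : C3) : ‖v‖ ≤ b * ‖act (S y) v‖ := by
  have h := hW.boundT y (act (S y) v)
  rwa [← act_mul, hW.mulTS, act_one] at h

/-- The energy of the corrected field gives the quadratic form of the effective matrix. -/
lemma IsBlochFamily.inner_effMatrix (hW : IsWeight S T b) (hP : IsBlochFamily S P) (κ : R3)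
    (c : C3) : inner ℂ c (act (effMatrix S P κ) c)
      = ((∫ x, ‖act (S x) (act (cellMatrix P κ x) c)‖ ^ 2 ∂cellVol : ℝ) : ℂ) := by
  have h := hP.integral_inner_of_modal (κ := κ) c (hP.memLp κ c) (fun n hn => by
    have := (hP.modal_sub κ c).2 n
    rwa [fc_sub (hP.memLp κ c) (memLp_const c), fc_const, if_neg hn, sub_zero] at this)
  rw [hP.fc_zero] at h
  rw [← h, ← integral_complex_ofReal]
  refine integral_congr_ae (ae_of_all _ fun x => ?_)
  dsimp only
  have h2 : inner ℂ (act (cellMatrix P κ x) c) (act (S x) (act (S x) (act (cellMatrix P κ x) c)))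
      = inner ℂ (act (S x) (act (cellMatrix P κ x) c)) (act (S x) (act (cellMatrix P κ x) c)) := by
    rw [inner_act_left (S x), hW.hermS]
  rw [h2, inner_self_eq_norm_sq_to_K]
  simp

/-- The energy `E` equals the pairing of `S c` with the weighted corrected field, since the
corrector is orthogonal to the flux. Cauchy–Schwarz gives `E² ≤ b² |c|² E`. -/
lemma IsBlochFamily.energy_le (hW : IsWeight S T b) (hP : IsBlochFamily S P) (κ : R3) (c : C3) :
    ∫ x, ‖act (S x) (act (cellMatrix P κ x) c)‖ ^ 2 ∂cellVol ≤ b ^ 2 * ‖c‖ ^ 2 := by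
  have hV := hP.memLp κ c
  have hSV := MemLp.act hW.contS hW.boundS hV
  have hSc : MemLp (fun x => act (S x) c) 2 cellVol :=
    MemLp.act hW.contS hW.boundS (memLp_const c)
  set E := ∫ x, ‖act (S x) (act (cellMatrix P κ x) c)‖ ^ 2 ∂cellVol with hE
  have hE0 : 0 ≤ E := integral_nonneg fun x => by positivity
  have h1 : (E : ℂ) = ∫ x, inner ℂ (act (S x) c) (act (S x) (act (cellMatrix P κ x) c)) ∂cellVol := by
    rw [hE, ← hP.inner_effMatrix hW, hP.act_effMatrix, ← integral_inner_ex_smul (hP.orth_act κ c).1]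
    refine integral_congr_ae (ae_of_all _ fun x => ?_)
    dsimp only
    rw [freq_zero, ex_zero, one_smul, inner_act_left, hW.hermS]
  have h2 := norm_integral_inner_sq_le hSc hSV
  rw [← h1, ← hE, Complex.norm_real, Real.norm_eq_abs, sq_abs] at h2
  have h3 : ∫ x, ‖act (S x) c‖ ^ 2 ∂cellVol ≤ b ^ 2 * ‖c‖ ^ 2 := by
    have := integral_norm_sq_le (f := fun x => act (S x) c) (memLp_const (μ := cellVol) c)
      (fun x => hW.boundS x c)
    simpa using this
  have h4 : E * E ≤ (b ^ 2 * ‖c‖ ^ 2) * E := by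
    calc E * E = E ^ 2 := by ring
      _ ≤ _ := h2
      _ ≤ _ := by gcongr
  rcases hE0.eq_or_lt with h0 | h0
  · rw [← h0]; positivity
  · exact le_of_mul_le_mul_right h4 h0

lemma norm_fc_sq_le {f : R3 → C3} (hf : MemLp f 2 cellVol) (m : Fin 3 → ℤ) :
    ‖fc m f‖ ^ 2 ≤ ∫ x, ‖f x‖ ^ 2 ∂cellVol :=
  le_hasSum (hasSum_sq_fc hf) m fun _ _ => by positivity

/-- The corrected field has mean `c`, so `|c|²` is at most its squared norm, which the energy
controls through the bound on `T`. This is coercivity of the effective matrix, uniform in `κ`. -/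
lemma IsBlochFamily.norm_sq_le_inner (hW : IsWeight S T b) (hP : IsBlochFamily S P) (κ : R3)
    (c : C3) : ‖c‖ ^ 2 ≤ b ^ 2 * (inner ℂ c (act (effMatrix S P κ) c)).re := by
  rw [hP.inner_effMatrix hW, Complex.ofReal_re]
  calc ‖c‖ ^ 2 = ‖fc 0 (fun x => act (cellMatrix P κ x) c)‖ ^ 2 := by rw [hP.fc_zero]
    _ ≤ _ := norm_fc_sq_le (hP.memLp κ c) 0
    _ ≤ _ := integral_norm_sq_le (MemLp.act hW.contS hW.boundS (hP.memLp κ c))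
      fun x => hW.norm_le x _

lemma IsBlochFamily.flux_le (hW : IsWeight S T b) (hP : IsBlochFamily S P) (κ : R3) (c : C3) :
    ∫ x, ‖act (S x) (act (S x) (act (cellMatrix P κ x) c))‖ ^ 2 ∂cellVol
      ≤ b ^ 4 * ‖c‖ ^ 2 := by
  refine (integral_norm_sq_le (MemLp.act hW.contS hW.boundS (hP.memLp κ c))
    fun x => hW.boundS x _).trans ?_
  calc b ^ 2 * _ ≤ b ^ 2 * (b ^ 2 * ‖c‖ ^ 2) := by gcongr; exact hP.energy_le hW κ c
    _ = _ := by ring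

lemma IsBlochFamily.norm_act_effMatrix_le (hW : IsWeight S T b) (hP : IsBlochFamily S P) (κ : R3)
    (c : C3) : ‖act (effMatrix S P κ) c‖ ≤ b ^ 2 * ‖c‖ := by
  have hb := hW.b_pos
  refine (sq_le_sq₀ (norm_nonneg _) (by positivity)).1 ?_
  rw [hP.act_effMatrix]
  refine (norm_fc_sq_le (hP.orth_act κ c).1 0).trans ((hP.flux_le hW κ c).trans ?_)
  exact le_of_eq (by ring)

/-- The flux of a corrected field differs from its mean by higher modes only. -/
lemma IsBlochFamily.flux_sub_mean (hW : IsWeight S T b) (hP : IsBlochFamily S P) (κ : R3)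
    (c : C3) {f : R3 → C3} (hf : MemLp f 2 cellVol) :
    ‖∫ x, inner ℂ (f x) (act (S x) (act (S x) (act (cellMatrix P κ x) c))) ∂cellVol
      - inner ℂ (fc 0 f) (act (effMatrix S P κ) c)‖ ^ 2
      ≤ b ^ 4 * ‖c‖ ^ 2 * ∑' n, if n = 0 then 0 else ‖fc n f‖ ^ 2 := by
  have ho := (hP.orth_act κ c).1
  -- The mean of `f` pairs exactly with the mean of the flux, so only the nonzero modes of `f`
  -- remain for Cauchy–Schwarz.
  have h0 : inner ℂ (fc 0 f) (act (effMatrix S P κ) c) = ∫ x, inner ℂ (fc 0 f)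
      (act (S x) (act (S x) (act (cellMatrix P κ x) c))) ∂cellVol := by
    rw [hP.act_effMatrix]
    have := integral_inner_ex_smul ho 0 (fc 0 f)
    simpa only [freq_zero, ex_zero, one_smul] using this.symm
  have hd : MemLp (fun x => f x - fc 0 f) 2 cellVol := hf.sub (memLp_const _)
  rw [h0, ← integral_sub (integrable_inner hf ho) (integrable_inner (memLp_const _) ho)]
  simp only [← inner_sub_left]
  refine (norm_integral_inner_sq_le hd ho).trans ?_
  rw [integral_sq_eq_tsum hd, mul_comm]
  simp only [fc_zero_sub_self hf]
  have : ∀ n, ‖(if n = 0 then 0 else fc n f)‖ ^ 2 = if n = 0 then 0 else ‖fc n f‖ ^ 2 := fun n => by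
    split_ifs <;> simp
  simp only [this]
  gcongr
  exact hP.flux_le hW κ c

/-- The pairings of a fixed field with the corrected fields of all quasimomenta in a coset of the
dual lattice are square summable. -/
lemma IsBlochFamily.exists_summable_bound (hW : IsWeight S T b) (hP : IsBlochFamily S P) (κ : R3)
    {f : R3 → C3} (hf : MemLp f 2 cellVol) :
    ∃ G : (Fin 3 → ℤ) → ℝ, Summable G ∧ (∀ m, 0 ≤ G m) ∧
      ∑' m, G m ≤ (4 + 4 * b ^ 4 + 2 * b ^ 8) * ∫ x, ‖f x‖ ^ 2 ∂cellVol ∧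
      ∀ m c, ‖∫ x, inner ℂ (conj (ex (freq m) x) • f x)
        (act (cellMatrix P (κ + freq m) x) c) ∂cellVol‖ ^ 2 ≤ G m * ‖c‖ ^ 2 := by
  have hb := hW.b_pos
  have hTf := MemLp.act hW.contT hW.boundT hf
  -- `f = S S z - (S S z - f)`, where `z` is longitudinal and `S S z - f` is transversal. Here all
  -- modes are constrained, including `n = 0`, so that one splitting serves the whole coset `κ +
  -- 2πℤ³`.
  obtain ⟨z, hz, ho', hE⟩ := hW.exists_modal (fun n => cplx (κ + freq n))
    (F := fun x => -act (T x) (f x)) hTf.neg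
  have hSS : MemLp (fun x => act (S x) (act (S x) (z x))) 2 cellVol :=
    MemLp.act hW.contS hW.boundS (MemLp.act hW.contS hW.boundS hz.1)
  have ho : IsOrthModal (fun n => cplx (κ + freq n))
      (fun x => act (S x) (act (S x) (z x)) - f x) := by
    have : ∀ x, act (S x) (act (S x) (z x) + -act (T x) (f x))
        = act (S x) (act (S x) (z x)) - f x := fun x => by
      rw [← sub_eq_add_neg, act_sub, ← act_mul _ _ (f x), hW.mulST, act_one]
    simpa only [this] using ho'
  have hEz : ∫ x, ‖act (S x) (z x)‖ ^ 2 ∂cellVol ≤ b ^ 2 * ∫ x, ‖f x‖ ^ 2 ∂cellVol := by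
    refine hE.trans ?_
    simp only [norm_neg]
    exact integral_norm_sq_le hf fun x => hW.boundT x _
  have hSz := MemLp.act hW.contS hW.boundS hz.1
  have hz2 : ∫ x, ‖z x‖ ^ 2 ∂cellVol ≤ b ^ 4 * ∫ x, ‖f x‖ ^ 2 ∂cellVol := by
    refine (integral_norm_sq_le hSz fun x => hW.norm_le x _).trans ?_
    calc b ^ 2 * _ ≤ b ^ 2 * (b ^ 2 * ∫ x, ‖f x‖ ^ 2 ∂cellVol) := by gcongr
      _ = _ := by ring
  have hd2 : ∫ x, ‖act (S x) (act (S x) (z x)) - f x‖ ^ 2 ∂cellVol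
      ≤ (2 + 2 * b ^ 4) * ∫ x, ‖f x‖ ^ 2 ∂cellVol := by
    have h1 : ∫ x, ‖act (S x) (act (S x) (z x))‖ ^ 2 ∂cellVol
        ≤ b ^ 4 * ∫ x, ‖f x‖ ^ 2 ∂cellVol := by
      refine (integral_norm_sq_le hSz fun x => hW.boundS x _).trans ?_
      calc b ^ 2 * _ ≤ b ^ 2 * (b ^ 2 * ∫ x, ‖f x‖ ^ 2 ∂cellVol) := by gcongr
        _ = _ := by ring
    calc ∫ x, ‖act (S x) (act (S x) (z x)) - f x‖ ^ 2 ∂cellVol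
        ≤ ∫ x, (2 * ‖act (S x) (act (S x) (z x))‖ ^ 2 + 2 * ‖f x‖ ^ 2) ∂cellVol := by
          refine integral_mono (integrable_norm_sq ho.1)
            (((integrable_norm_sq hSS).const_mul 2).add ((integrable_norm_sq hf).const_mul 2))
            fun x => ?_
          have h := norm_sub_le (act (S x) (act (S x) (z x))) (f x)
          calc ‖act (S x) (act (S x) (z x)) - f x‖ ^ 2
              ≤ (‖act (S x) (act (S x) (z x))‖ + ‖f x‖) ^ 2 := by gcongr
            _ ≤ _ := by nlinarith [sq_nonneg (‖act (S x) (act (S x) (z x))‖ - ‖f x‖)]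
      _ = 2 * (∫ x, ‖act (S x) (act (S x) (z x))‖ ^ 2 ∂cellVol)
          + 2 * ∫ x, ‖f x‖ ^ 2 ∂cellVol := by
          rw [integral_add ((integrable_norm_sq hSS).const_mul 2)
            ((integrable_norm_sq hf).const_mul 2), integral_const_mul, integral_const_mul]
      _ ≤ _ := by nlinarith
  have hs1 := hasSum_sq_fc ho.1
  have hs2 := hasSum_sq_fc hz.1
  have hs := (hs1.mul_left 2).add (hs2.mul_left (2 * b ^ 4))
  refine ⟨_, hs.summable, fun m => by positivity, ?_, fun m c => ?_⟩
  · rw [hs.tsum_eq]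
    -- The constant is `2 (2 + 2 b⁴)` from the transversal part plus `2 b⁴ · b⁴` from the
    -- longitudinal one.
    nlinarith [pow_pos hb 4]
  -- Multiplication by the conjugate character shifts the coefficients by `m`, which matches
  -- replacing `κ` by `κ + 2πm`; transversality and longitudinality survive.
  · have hm1 : IsOrthModal (cellModes (κ + freq m))
        (fun x => conj (ex (freq m) x) • (act (S x) (act (S x) (z x)) - f x)) := by
      refine ⟨MemLp.conj_ex_smul ho.1 _, fun n => ?_⟩
      rcases eq_or_ne n 0 with rfl | hn
      · rw [cellModes_zero, inner_zero_left]
      · rw [cellModes_of_ne hn, fc_conj_ex_smul, add_assoc, ← freq_add, add_comm m n]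
        exact ho.2 (n + m)
    have hm2 : ∀ n ≠ 0, fc n (fun x => conj (ex (freq m) x) • z x)
        ∈ Submodule.span ℂ {cellModes (κ + freq m) n} := fun n hn => by
      rw [cellModes_of_ne hn, fc_conj_ex_smul, add_assoc, ← freq_add, add_comm m n]
      exact hz.2 (n + m)
    -- Each part now pairs with the corrected field through its zeroth mode only, that is, through
    -- the `m`-th coefficient of the unshifted field. Parseval's identity makes these square
    -- summable in `m`.
    have e1 := hP.integral_inner_of_orth c hm1
    have e2 := hP.integral_inner_of_modal c (MemLp.conj_ex_smul hz.1 (freq m)) hm2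
    rw [fc_conj_ex_smul, zero_add] at e1 e2
    have hV := hP.memLp (κ + freq m) c
    have hsplit : ∫ x, inner ℂ (conj (ex (freq m) x) • f x)
        (act (cellMatrix P (κ + freq m) x) c) ∂cellVol
        = inner ℂ (fc m z) (act (effMatrix S P (κ + freq m)) c)
          - inner ℂ (fc m fun x => act (S x) (act (S x) (z x)) - f x) c := by
      rw [← e1, ← e2, ← integral_sub
        (integrable_inner (MemLp.conj_ex_smul hz.1 _) (hP.orth_act _ c).1)
        (integrable_inner hm1.1 hV)]
      refine integral_congr_ae (ae_of_all _ fun x => ?_)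
      dsimp only
      rw [smul_sub, inner_sub_left]
      have : inner ℂ (conj (ex (freq m) x) • z x)
          (act (S x) (act (S x) (act (cellMatrix P (κ + freq m) x) c)))
          = inner ℂ (conj (ex (freq m) x) • act (S x) (act (S x) (z x)))
            (act (cellMatrix P (κ + freq m) x) c) := by
        rw [inner_smul_left, inner_smul_left, inner_act_left, hW.hermS, inner_act_left, hW.hermS]
      rw [this, sub_sub_cancel]
    rw [hsplit]
    have n1 : ‖inner ℂ (fc m z) (act (effMatrix S P (κ + freq m)) c)‖
        ≤ ‖fc m z‖ * (b ^ 2 * ‖c‖) :=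
      (norm_inner_le_norm _ _).trans (by gcongr; exact hP.norm_act_effMatrix_le hW _ c)
    have n2 := norm_inner_le_norm (𝕜 := ℂ)
      (fc m fun x => act (S x) (act (S x) (z x)) - f x) c
    set X := ‖fc m z‖
    set Y := ‖fc m fun x => act (S x) (act (S x) (z x)) - f x‖
    calc _ ≤ (X * (b ^ 2 * ‖c‖) + Y * ‖c‖) ^ 2 := by
          gcongr
          exact (norm_sub_le _ _).trans (add_le_add n1 n2)
      _ ≤ 2 * (X * (b ^ 2 * ‖c‖)) ^ 2 + 2 * (Y * ‖c‖) ^ 2 := by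
          nlinarith [sq_nonneg (X * (b ^ 2 * ‖c‖) - Y * ‖c‖)]
      _ = (2 * Y ^ 2 + 2 * b ^ 4 * X ^ 2) * ‖c‖ ^ 2 := by ring

end Bloch

end

end MaxwellHom

/-! ### Periodization of test fields and tiling of frequency space. -/

namespace MaxwellHom

noncomputable section

open FourierTransform

/-! ### Periodization -/

lemma measurePreserving_add_latticeVec (n : Fin 3 → ℤ) :
    MeasurePreserving (fun y : R3 => y + latticeVec n) cellVol (volume.restrict (cellAt n)) :=
  ⟨measurable_id.add_const _, (restrict_cellAt isPeriodicMeasure_volume n).symm⟩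

lemma integral_eq_sum_cell {E : Type*} [NormedAddCommGroup E] [NormedSpace ℝ E] {G : R3 → E}
    {N : Finset (Fin 3 → ℤ)} (h0 : ∀ n ∉ N, ∀ y ∈ cell, G (y + latticeVec n) = 0)
    (hi : ∀ n ∈ N, Integrable (fun y => G (y + latticeVec n)) cellVol) :
    ∫ y, G y = ∑ n ∈ N, ∫ y, G (y + latticeVec n) ∂cellVol := by
  have hemb : ∀ n : Fin 3 → ℤ, MeasurableEmbedding fun y : R3 => y + latticeVec n := fun n =>
    measurableEmbedding_addRight _
  have hzero : ∀ y ∉ ⋃ n ∈ N, cellAt n, G y = 0 := fun y hy => by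
    have hn : floorVec y ∉ N := fun hn => hy (Set.mem_biUnion hn (sub_floorVec_mem_cell y))
    have := h0 _ hn _ (sub_floorVec_mem_cell y)
    rwa [sub_add_cancel] at this
  rw [← setIntegral_eq_integral_of_forall_compl_eq_zero hzero,
    integral_biUnion_finset N (fun n _ => measurableSet_cellAt n)
      (fun m _ n _ hmn => disjoint_cellAt hmn)]
  · exact Finset.sum_congr rfl fun n _ =>
      ((measurePreserving_add_latticeVec n).integral_comp (hemb n) G).symm
  · intro n hn
    exact ((measurePreserving_add_latticeVec n).integrable_comp_emb (hemb n)).1 (hi n hn)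

lemma exists_finset_of_hasCompactSupport {f : R3 → C3} (hf : HasCompactSupport f) :
    ∃ N : Finset (Fin 3 → ℤ), ∀ n ∉ N, ∀ y ∈ cell, f (y + latticeVec n) = 0 := by
  obtain ⟨r, hr⟩ := hf.isCompact.isBounded.subset_closedBall 0
  -- The summand `3` is the bound for points of the cell: only translates within `r + 3` can meet
  -- the support.
  obtain ⟨M, hM⟩ := exists_nat_gt (r + 3)
  refine ⟨Finset.Icc (fun _ => -(M : ℤ)) (fun _ => (M : ℤ)), fun n hn y hy => ?_⟩
  by_contra hne
  refine hn (Finset.mem_Icc.2 ?_)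
  have h1 : ‖y + latticeVec n‖ ≤ r := by
    simpa using hr (subset_tsupport _ (Function.mem_support.2 hne))
  have h2 : ‖latticeVec n‖ ≤ r + 3 := by
    have : latticeVec n = (y + latticeVec n) - y := by abel
    rw [this]
    exact (norm_sub_le _ _).trans (add_le_add h1 (norm_le_of_mem_cell hy))
  have h3 : ∀ i, |n i| ≤ (M : ℤ) := fun i => by
    have h4 : |(n i : ℝ)| ≤ ‖latticeVec n‖ := PiLp.norm_apply_le (latticeVec n) i
    have : |(n i : ℝ)| ≤ M := by linarith
    exact_mod_cast this
  exact ⟨fun i => (abs_le.1 (h3 i)).1, fun i => (abs_le.1 (h3 i)).2⟩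

/-- Fixes the normalisation: the transform at `ξ` corresponds to the frequency `θ = 2πξ`. -/
lemma fourier_eq {E : Type*} [NormedAddCommGroup E] [NormedSpace ℂ E] (f : R3 → E) (ξ : R3) :
    𝓕 f ξ = ∫ x, conj (ex ((2 * Real.pi) • ξ) x) • f x := by
  rw [Real.fourier_eq']
  refine integral_congr_ae (ae_of_all _ fun x => ?_)
  dsimp only
  rw [conj_ex, ex, real_inner_comm, inner_neg_left, inner_smul_left]
  congr 2
  simp only [conj_trivial]
  push_cast
  ring

/-- Finite periodization of a continuous compactly supported field, at scale `ε`. -/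
lemma exists_periodization {h : R3 → C3} (hc : Continuous h) (hs : HasCompactSupport h) {ε : ℝ}
    (hε : 0 < ε) : ∃ F : R3 → R3 → C3, Continuous (Function.uncurry F) ∧
      (∀ ξ m, fc m (F ξ) = 𝓕 h (ξ + ε⁻¹ • latticeVec m)) ∧
      ∀ (ξ : R3) (V : R3 → C3), IsPeriodicFun V → MemLp V 2 cellVol →
        ∫ x, inner ℂ (h x) (ex ((2 * Real.pi) • ξ) x • V (ε⁻¹ • x))
          = ∫ y, inner ℂ (F ξ y) (V y) ∂cellVol := by
  let f : R3 → C3 := fun y => h (ε • y)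
  have hfc : Continuous f := hc.comp (continuous_const_smul ε)
  have hfs : HasCompactSupport f := hs.comp_smul hε.ne'
  obtain ⟨N, hN⟩ := exists_finset_of_hasCompactSupport hfs
  have hscale : ∀ {E : Type} [NormedAddCommGroup E] [NormedSpace ℝ E] (G : R3 → E),
      ∫ x, G x = (ε ^ 3) • ∫ y, G (ε • y) := fun G => by
    rw [Measure.integral_comp_smul volume G ε]
    have : Module.finrank ℝ R3 = 3 := by simp
    rw [this, abs_of_pos (by positivity), smul_smul, mul_inv_cancel₀ (by positivity), one_smul]
  -- The Poisson sum of `h`, rescaled to the unit lattice and twisted by the plane wave; compact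
  -- support makes it finite. `ε ^ 3` is the Jacobian.
  let F : R3 → R3 → C3 := fun ξ y => ∑ n ∈ N,
    (((ε ^ 3 : ℝ) : ℂ) * conj (ex ((2 * Real.pi * ε) • ξ) (y + latticeVec n)))
      • f (y + latticeVec n)
  have hFc : Continuous (Function.uncurry F) := by
    refine continuous_finsetSum _ fun n _ => ?_
    have h1 : Continuous fun p : R3 × R3 =>
        ex ((2 * Real.pi * ε) • p.1) (p.2 + latticeVec n) :=
      Continuous.ex (continuous_fst.const_smul (2 * Real.pi * ε))
        (continuous_snd.add continuous_const)
    exact (continuous_const.mul (Complex.continuous_conj.comp h1)).smul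
      (hfc.comp (continuous_snd.add continuous_const))
  have hexs : ∀ ξ y : R3, ex ((2 * Real.pi) • ξ) (ε • y) = ex ((2 * Real.pi * ε) • ξ) y :=
    fun ξ y => by
      rw [ex, ex, inner_smul_right, inner_smul_left, inner_smul_left]
      congr 2
      simp only [conj_trivial]
      push_cast
      ring
  refine ⟨F, hFc, fun ξ m => ?_, fun ξ V hVp hV => ?_⟩
  · have hcont : ∀ n, Continuous fun y : R3 =>
        conj (ex (freq m) y) • (((ε ^ 3 : ℝ) : ℂ) *
          conj (ex ((2 * Real.pi * ε) • ξ) (y + latticeVec n))) • f (y + latticeVec n) := fun n => by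
      have h1 : Continuous fun y : R3 => ex ((2 * Real.pi * ε) • ξ) (y + latticeVec n) :=
        Continuous.ex continuous_const (continuous_id.add continuous_const)
      exact (continuous_conj_ex _).smul ((continuous_const.mul
        (Complex.continuous_conj.comp h1)).smul (hfc.comp (continuous_id.add continuous_const)))
    have hint := fun n => integrable_of_memLp_cell (memLp_cell_of_continuous (hcont n))
    rw [fourier_eq, hscale]
    let G : R3 → C3 := fun y => (ε ^ 3 : ℝ) •
      (conj (ex ((2 * Real.pi) • (ξ + ε⁻¹ • latticeVec m)) (ε • y)) • h (ε • y))
    have hG : ∀ n y, G (y + latticeVec n) = conj (ex (freq m) y) • (((ε ^ 3 : ℝ) : ℂ) *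
          conj (ex ((2 * Real.pi * ε) • ξ) (y + latticeVec n))) • f (y + latticeVec n) := by
      intro n y
      -- A shift of `ξ` by `ε⁻¹ m` produces the character `2πm`, which is trivial on the lattice.
      -- Hence it leaves the sum and becomes a Fourier coefficient.
      have e1 : (2 * Real.pi * ε) • (ξ + ε⁻¹ • latticeVec m) = freq m + (2 * Real.pi * ε) • ξ := by
        rw [smul_add, smul_smul, mul_assoc _ ε, mul_inv_cancel₀ hε.ne', mul_one, add_comm]
        rfl
      simp only [G]
      rw [hexs, e1, ex_add_left, ex_add_right (freq m), ex_freq_latticeVec, mul_one, map_mul]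
      rw [smul_smul, ← Complex.coe_smul, smul_smul]
      simp only [f]
      congr 1
      push_cast
      ring
    have h1 := integral_eq_sum_cell (G := G) (N := N) (fun n hn y hy => by
      have h0 := hN n hn y hy
      rw [hG, h0, smul_zero, smul_zero]) (fun n _ => by simpa only [hG] using hint n)
    simp only [hG] at h1
    rw [← integral_finsetSum _ fun n _ => hint n] at h1
    rw [← integral_smul]
    refine Eq.trans ?_ h1.symm
    simp only [fc, F, Finset.smul_sum]
  · rw [hscale]
    have hcont : ∀ n, Continuous fun y : R3 => (((ε ^ 3 : ℝ) : ℂ) *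
          conj (ex ((2 * Real.pi * ε) • ξ) (y + latticeVec n))) • f (y + latticeVec n) := fun n => by
      have h1 : Continuous fun y : R3 => ex ((2 * Real.pi * ε) • ξ) (y + latticeVec n) :=
        Continuous.ex continuous_const (continuous_id.add continuous_const)
      exact ((continuous_const.mul
        (Complex.continuous_conj.comp h1)).smul (hfc.comp (continuous_id.add continuous_const)))
    have hint := fun n => integrable_inner (memLp_cell_of_continuous (hcont n)) hV
    let G : R3 → ℂ := fun y => (ε ^ 3 : ℝ) •
      inner ℂ (h (ε • y)) (ex ((2 * Real.pi) • ξ) (ε • y) • V (ε⁻¹ • ε • y))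
    have hG : ∀ n y, G (y + latticeVec n) = inner ℂ ((((ε ^ 3 : ℝ) : ℂ) *
          conj (ex ((2 * Real.pi * ε) • ξ) (y + latticeVec n))) • f (y + latticeVec n)) (V y) := by
      intro n y
      simp only [G]
      rw [hexs, smul_smul, inv_mul_cancel₀ hε.ne', one_smul, hVp, inner_smul_left,
        inner_smul_right, map_mul, Complex.conj_conj, Complex.conj_ofReal, Complex.real_smul]
      simp only [f]
      ring
    have h1 := integral_eq_sum_cell (G := G) (N := N) (fun n hn y hy => by
      have h0 := hN n hn y hy
      rw [hG, h0, smul_zero, inner_zero_left]) (fun n _ => by simpa only [hG] using hint n)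
    simp only [hG] at h1
    rw [← integral_finsetSum _ fun n _ => hint n] at h1
    rw [← integral_smul]
    refine Eq.trans h1 ?_
    simp only [F, sum_inner]

/-- The scaled and centred cell, a fundamental domain of the lattice `ε⁻¹ ℤ³`. -/
def lowFreq (ε : ℝ) : Set R3 := {ξ | ε • ξ + WithLp.toLp 2 (fun _ => 1 / 2) ∈ cell}

lemma measurableSet_lowFreq (ε : ℝ) : MeasurableSet (lowFreq ε) := by
  have h : Measurable fun ξ : R3 => ε • ξ + WithLp.toLp 2 (fun _ => 1 / 2) := by fun_prop
  exact h measurableSet_cell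

lemma add_mem_cellAt_iff {ε : ℝ} (hε : ε ≠ 0) (ξ : R3) (n : Fin 3 → ℤ) :
    ε • (ξ + ε⁻¹ • latticeVec n) + WithLp.toLp 2 (fun _ => 1 / 2) ∈ cellAt n ↔ ξ ∈ lowFreq ε := by
  rw [cellAt, Set.mem_preimage, smul_add, smul_smul, mul_inv_cancel₀ hε, one_smul,
    add_right_comm, add_sub_cancel_right]
  rfl

lemma add_notMem_lowFreq {ε : ℝ} (hε : ε ≠ 0) {ξ : R3} (hξ : ξ ∈ lowFreq ε) {n : Fin 3 → ℤ}
    (hn : n ≠ 0) : ξ + ε⁻¹ • latticeVec n ∉ lowFreq ε := fun h => by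
  refine Set.disjoint_left.1 (disjoint_cellAt hn) ((add_mem_cellAt_iff hε ξ n).2 hξ) ?_
  rwa [← add_mem_cellAt_iff hε _ 0, latticeVec_zero, smul_zero, add_zero] at h

/-- The translates of `lowFreq ε` by `ε⁻¹ ℤ³` tile frequency space. This splits `L²` norms into
fibres indexed by quasimomenta. -/
lemma lintegral_eq_tsum_lowFreq {G : R3 → ℝ≥0∞} (hG : Measurable G) {ε : ℝ} (hε : ε ≠ 0) :
    ∫⁻ ξ, G ξ = ∫⁻ ξ in lowFreq ε, ∑' n, G (ξ + ε⁻¹ • latticeVec n) := by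
  let t : R3 → R3 := fun ξ => ε • ξ + WithLp.toLp 2 (fun _ => 1 / 2)
  have ht : Measurable t := by fun_prop
  have hU : (⋃ n, t ⁻¹' cellAt n) = Set.univ := by
    rw [← Set.preimage_iUnion, iUnion_cellAt, Set.preimage_univ]
  rw [← setLIntegral_univ, ← hU, lintegral_iUnion (fun n => ht (measurableSet_cellAt n))
    (fun m n hmn => (disjoint_cellAt hmn).preimage t),
    lintegral_tsum (f := fun n ξ => G (ξ + ε⁻¹ • latticeVec n)) fun n => (hG.comp (measurable_add_const (ε⁻¹ • latticeVec n))).aemeasurable]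
  refine tsum_congr fun n => ?_
  rw [← lintegral_indicator (ht (measurableSet_cellAt n)),
    ← lintegral_indicator (measurableSet_lowFreq ε),
    ← lintegral_add_right_eq_self _ (ε⁻¹ • latticeVec n)]
  refine lintegral_congr fun ξ => ?_
  have hmem : ξ + ε⁻¹ • latticeVec n ∈ t ⁻¹' cellAt n ↔ ξ ∈ lowFreq ε := add_mem_cellAt_iff hε ξ n
  by_cases hξ : ξ ∈ lowFreq ε
  · rw [Set.indicator_of_mem hξ, Set.indicator_of_mem (hmem.2 hξ)]
  · rw [Set.indicator_of_notMem hξ, Set.indicator_of_notMem (mt hmem.1 hξ)]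

end

end MaxwellHom

/-! ### The Bloch transform and its `L²` bound. -/

namespace MaxwellHom

noncomputable section

open FourierTransform

/-! ### The Bloch transform -/

/-- The pairing of `h` with the corrected plane waves `e_{2πξ} (act (cellMatrix P κ)) (x / ε)`,
`κ = 2π ε ξ`. -/
def blochT (P : R3 → Fin 3 → R3 → C3) (ε : ℝ) (h : R3 → C3) (ξ : R3) : C3 :=
  WithLp.toLp 2 fun j => conj (∫ x, inner ℂ (h x) (ex ((2 * Real.pi) • ξ) x •
    act (cellMatrix P (ε • (2 * Real.pi) • ξ) (ε⁻¹ • x)) (EuclideanSpace.single j 1)))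

/-- Multiplication by the weight `S S` at scale `ε`. -/
def weight (S : R3 → MatC) (ε : ℝ) (h : R3 → C3) (x : R3) : C3 :=
  act (S (ε⁻¹ • x)) (act (S (ε⁻¹ • x)) (h x))

section

variable {S T : R3 → MatC} {b : ℝ} {P : R3 → Fin 3 → R3 → C3} {ε : ℝ} {h : R3 → C3}

lemma IsWeight.continuous_weight (hW : IsWeight S T b) (hc : Continuous h) :
    Continuous (weight S ε h) := by
  have hS : Continuous fun x : R3 => S (ε⁻¹ • x) := hW.contS.comp (continuous_const_smul _)
  exact Continuous.act hS (Continuous.act hS hc)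

lemma hasCompactSupport_act {M : R3 → MatC} (hs : HasCompactSupport h) :
    HasCompactSupport fun x => act (M x) (h x) :=
  hs.mono fun x hx hx' => hx (by simp only [hx', act_zero])

lemma hasCompactSupport_weight (hs : HasCompactSupport h) :
    HasCompactSupport (weight S ε h) :=
  hasCompactSupport_act (hasCompactSupport_act hs)

lemma IsBlochFamily.isPeriodicFun (hP : IsBlochFamily S P) (κ : R3) (c : C3) :
    IsPeriodicFun fun x => act (cellMatrix P κ x) c := fun n y => by
  simp only [act_cellMatrix, hP.per κ _ n y]

lemma single_act_cellMatrix (κ x : R3) (j : Fin 3) :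
    act (cellMatrix P κ x) (EuclideanSpace.single j 1) = P κ j x + EuclideanSpace.single j 1 := by
  rw [act_cellMatrix, Finset.sum_eq_single j]
  · simp
  · intro i _ hi
    simp [hi]
  · simp

lemma smul_smul_add_latticeVec (hε : ε ≠ 0) (ξ : R3) (n : Fin 3 → ℤ) :
    ε • (2 * Real.pi) • (ξ + ε⁻¹ • latticeVec n) = ε • (2 * Real.pi) • ξ + freq n := by
  rw [smul_add, smul_add, smul_smul, smul_smul, smul_smul]
  congr 1
  change _ = (2 * Real.pi) • latticeVec n
  congr 1
  field_simp

/-- The pairing with corrected plane waves, in terms of a periodization `F` of `h`. -/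
lemma IsBlochFamily.inner_blochT (hP : IsBlochFamily S P) {F : R3 → R3 → C3}
    (hF : ∀ ξ, MemLp (F ξ) 2 cellVol)
    (hFi : ∀ (ξ : R3) (V : R3 → C3), IsPeriodicFun V → MemLp V 2 cellVol →
        ∫ x, inner ℂ (h x) (ex ((2 * Real.pi) • ξ) x • V (ε⁻¹ • x))
          = ∫ y, inner ℂ (F ξ y) (V y) ∂cellVol) (ξ : R3) (c : C3) :
    inner ℂ (blochT P ε h ξ) c
      = ∫ y, inner ℂ (F ξ y) (act (cellMatrix P (ε • (2 * Real.pi) • ξ) y) c) ∂cellVol := by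
  have h1 : ∀ j, conj (blochT P ε h ξ j) = ∫ y, inner ℂ (F ξ y)
      (act (cellMatrix P (ε • (2 * Real.pi) • ξ) y) (EuclideanSpace.single j 1)) ∂cellVol := fun j => by
    rw [← hFi ξ _ (hP.isPeriodicFun _ _) (hP.memLp _ _)]
    exact Complex.conj_conj _
  have h2 : ∀ y, inner ℂ (F ξ y) (act (cellMatrix P (ε • (2 * Real.pi) • ξ) y) c)
      = ∑ j, c j * inner ℂ (F ξ y)
        (act (cellMatrix P (ε • (2 * Real.pi) • ξ) y) (EuclideanSpace.single j 1)) := fun y => by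
    rw [act_cellMatrix, inner_sum]
    simp only [inner_smul_right, single_act_cellMatrix]
  simp only [h2]
  rw [integral_finsetSum _ fun j _ => (integrable_inner (hF ξ) (hP.memLp _ _)).const_mul _]
  simp only [integral_const_mul, ← h1]
  rw [inner_C3]
  exact Finset.sum_congr rfl fun j _ => mul_comm _ _

lemma continuous_section {F : R3 → R3 → C3} (hF : Continuous (Function.uncurry F)) (ξ : R3) :
    MemLp (F ξ) 2 cellVol :=
  memLp_cell_of_continuous (hF.comp (Continuous.prodMk continuous_const continuous_id))

lemma IsBlochFamily.inner_blochT_eq (hP : IsBlochFamily S P) (hc : Continuous h)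
    (hs : HasCompactSupport h) (hε : 0 < ε) (ξ : R3) (c : C3) :
    inner ℂ (blochT P ε h ξ) c = ∫ x, inner ℂ (h x) (ex ((2 * Real.pi) • ξ) x •
      act (cellMatrix P (ε • (2 * Real.pi) • ξ) (ε⁻¹ • x)) c) := by
  obtain ⟨F, hFc, -, hFi⟩ := exists_periodization hc hs hε
  rw [hP.inner_blochT (continuous_section hFc) hFi, hFi ξ _ (hP.isPeriodicFun _ c) (hP.memLp _ c)]

lemma IsBlochFamily.measurable_blochT (hW : IsWeight S T b) (hP : IsBlochFamily S P)
    (hc : Continuous h) (hs : HasCompactSupport h) (hε : 0 < ε) :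
    Measurable (blochT P ε h) := by
  obtain ⟨F, hFc, -, hFi⟩ := exists_periodization hc hs hε
  have hcont : Continuous fun ξ : R3 => ε • (2 * Real.pi) • ξ := by fun_prop
  refine (WithLp.measurable_toLp 2 _).comp (measurable_pi_lambda _ fun j => ?_)
  refine Complex.continuous_conj.measurable.comp ?_
  have h1 := hW.measurable_integral_inner (w := fun ξ => cellModes (ε • (2 * Real.pi) • ξ))
    (fun m => (continuous_cellModes m).comp hcont)
    -- The factor `T T` cancels the weights `S` in the measurability result for weighted pairings.
    (F := fun ξ y => act (T y) (act (T y) (F ξ y))) (p := fun ξ => P (ε • (2 * Real.pi) • ξ) j)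
    (Continuous.act (hW.contT.comp continuous_snd)
      (Continuous.act (hW.contT.comp continuous_snd) hFc))
    (EuclideanSpace.single j 1) (fun ξ => hP.modal _ j) (fun ξ => hP.orth _ j)
  convert h1 using 1
  funext ξ
  rw [hFi ξ _ (hP.isPeriodicFun _ _) (hP.memLp _ _)]
  refine integral_congr_ae (ae_of_all _ fun y => ?_)
  dsimp only
  rw [← act_mul (S y), hW.mulST, act_one, inner_act_left, hW.hermT, ← act_mul, hW.mulTS, act_one,
    single_act_cellMatrix]

/-- The flux pairing in terms of a periodization of `h`. -/
lemma IsBlochFamily.inner_blochT_weight (hW : IsWeight S T b) (hP : IsBlochFamily S P)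
    (hc : Continuous h) (hs : HasCompactSupport h) (hε : 0 < ε) {F : R3 → R3 → C3}
    (hFi : ∀ (ξ : R3) (V : R3 → C3), IsPeriodicFun V → MemLp V 2 cellVol →
        ∫ x, inner ℂ (h x) (ex ((2 * Real.pi) • ξ) x • V (ε⁻¹ • x))
          = ∫ y, inner ℂ (F ξ y) (V y) ∂cellVol) (ξ : R3) (c : C3) :
    inner ℂ (blochT P ε (weight S ε h) ξ) c = ∫ y, inner ℂ (F ξ y)
      (act (S y) (act (S y) (act (cellMatrix P (ε • (2 * Real.pi) • ξ) y) c))) ∂cellVol := by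
  rw [hP.inner_blochT_eq (hW.continuous_weight hc) (hasCompactSupport_weight hs) hε,
    ← hFi ξ (fun y => act (S y) (act (S y) (act (cellMatrix P (ε • (2 * Real.pi) • ξ) y) c)))
      (fun n y => by
        have := hP.isPeriodicFun (ε • (2 * Real.pi) • ξ) c n y
        dsimp only at this ⊢
        rw [hW.perS, this]) (hP.orth_act _ c).1]
  refine integral_congr_ae (ae_of_all _ fun x => ?_)
  dsimp only [weight]
  rw [inner_act_left, inner_act_left, hW.hermS, act_smul, act_smul]

/-- The Bloch transform of a divergence free field is its Fourier transform. -/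
lemma IsBlochFamily.blochT_of_transversal (hP : IsBlochFamily S P) (hc : Continuous h)
    (hs : HasCompactSupport h) (hε : 0 < ε) (ht : ∀ ξ, inner ℂ (cplx ξ) (𝓕 h ξ) = 0) (ξ : R3) :
    blochT P ε h ξ = 𝓕 h ξ := by
  obtain ⟨F, hFc, hFf, hFi⟩ := exists_periodization hc hs hε
  refine ext_inner_right ℂ fun c => ?_
  rw [hP.inner_blochT (continuous_section hFc) hFi, hP.integral_inner_of_orth c (f := F ξ), hFf]
  · rw [latticeVec_zero, smul_zero, add_zero]
  · refine ⟨continuous_section hFc ξ, fun n => ?_⟩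
    -- Transversality of `𝓕 h` at `ξ + ε⁻¹ n` is transversality of the `n`-th mode of the
    -- periodization with respect to `κ + 2πn`; the gradient corrector therefore drops out.
    rcases eq_or_ne n 0 with rfl | hn
    · rw [cellModes_zero, inner_zero_left]
    · rw [cellModes_of_ne hn, hFf, ← smul_smul_add_latticeVec hε.ne', cplx_smul, cplx_smul,
        inner_smul_left, inner_smul_left, ht, mul_zero, mul_zero]

/-- The flux pairing with a gradient field. -/
lemma IsBlochFamily.inner_blochT_weight_of_longitudinal (hW : IsWeight S T b)
    (hP : IsBlochFamily S P) (hc : Continuous h) (hs : HasCompactSupport h) (hε : 0 < ε)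
    (hl : ∀ ξ, 𝓕 h ξ ∈ Submodule.span ℂ {cplx ξ}) (ξ : R3) (c : C3) :
    inner ℂ (blochT P ε (weight S ε h) ξ) c
      = inner ℂ (𝓕 h ξ) (act (effMatrix S P (ε • (2 * Real.pi) • ξ)) c) := by
  obtain ⟨F, hFc, hFf, hFi⟩ := exists_periodization hc hs hε
  rw [hP.inner_blochT_weight hW hc hs hε hFi,
    hP.integral_inner_of_modal c (continuous_section hFc ξ), hFf]
  · rw [latticeVec_zero, smul_zero, add_zero]
  · intro n hn
    rw [cellModes_of_ne hn, hFf, ← smul_smul_add_latticeVec hε.ne', cplx_smul, cplx_smul,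
      smul_smul, Submodule.span_singleton_smul_eq]
    · exact hl _
    · have : ε * (2 * Real.pi) ≠ 0 := mul_ne_zero hε.ne' (by positivity)
      rw [← Complex.ofReal_mul]
      exact (Complex.ofReal_ne_zero.2 this).isUnit

lemma continuous_fourier_of_integrable {E : Type*} [NormedAddCommGroup E] [NormedSpace ℂ E]
    {f : R3 → E} (hf : Integrable f) : Continuous (𝓕 f) :=
  VectorFourier.fourierIntegral_continuous Real.continuous_fourierChar
    (innerSL ℝ).continuous₂ hf

lemma enorm_sq_eq (v : C3) : ‖v‖ₑ ^ 2 = ENNReal.ofReal (‖v‖ ^ 2) := by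
  rw [← ofReal_norm, ENNReal.ofReal_pow (norm_nonneg _)]

/-- The flux pairing differs from the homogenised one by higher frequencies of `h`. -/
lemma IsBlochFamily.flux_pairing_sub_le (hW : IsWeight S T b) (hP : IsBlochFamily S P)
    (hc : Continuous h) (hs : HasCompactSupport h) (hε : 0 < ε) (ξ : R3) (c : C3) :
    ‖inner ℂ (blochT P ε (weight S ε h) ξ) c
      - inner ℂ (𝓕 h ξ) (act (effMatrix S P (ε • (2 * Real.pi) • ξ)) c)‖ₑ ^ 2
      ≤ ENNReal.ofReal (b ^ 4) * ‖c‖ₑ ^ 2 *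
        ∑' n : Fin 3 → ℤ, if n = 0 then 0 else ‖𝓕 h (ξ + ε⁻¹ • latticeVec n)‖ₑ ^ 2 := by
  obtain ⟨F, hFc, hFf, hFi⟩ := exists_periodization hc hs hε
  have hb := hW.b_pos
  have hF := continuous_section hFc ξ
  have h1 := hP.flux_sub_mean hW (ε • (2 * Real.pi) • ξ) c hF
  rw [← hP.inner_blochT_weight hW hc hs hε hFi] at h1
  simp only [hFf] at h1
  rw [latticeVec_zero, smul_zero, add_zero] at h1
  have hsum : Summable fun n : Fin 3 → ℤ =>
      if n = 0 then 0 else ‖𝓕 h (ξ + ε⁻¹ • latticeVec n)‖ ^ 2 := by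
    refine Summable.of_nonneg_of_le (fun n => by split_ifs <;> positivity) (fun n => ?_)
      (hasSum_sq_fc hF).summable
    rw [hFf]
    split_ifs <;> [positivity; rfl]
  have h2 : ∑' n : Fin 3 → ℤ, (if n = 0 then 0 else ‖𝓕 h (ξ + ε⁻¹ • latticeVec n)‖ₑ ^ 2)
      = ENNReal.ofReal (∑' n : Fin 3 → ℤ,
        if n = 0 then 0 else ‖𝓕 h (ξ + ε⁻¹ • latticeVec n)‖ ^ 2) := by
    rw [ENNReal.ofReal_tsum_of_nonneg (fun n => by split_ifs <;> positivity) hsum]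
    refine tsum_congr fun n => ?_
    split_ifs
    · rw [ENNReal.ofReal_zero]
    · rw [enorm_sq_eq]
  rw [h2, enorm_sq_eq, ← ENNReal.ofReal_mul (by positivity),
    ← ENNReal.ofReal_mul (by positivity), ← ofReal_norm, ← ENNReal.ofReal_pow (norm_nonneg _)]
  exact ENNReal.ofReal_le_ofReal h1

/-- `L²` bound of the Bloch transform. -/
lemma IsBlochFamily.lintegral_blochT_le (hW : IsWeight S T b) (hP : IsBlochFamily S P)
    (hc : Continuous h) (hs : HasCompactSupport h) (hε : 0 < ε) :
    ∫⁻ ξ, ‖blochT P ε h ξ‖ₑ ^ 2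
      ≤ ENNReal.ofReal (4 + 4 * b ^ 4 + 2 * b ^ 8) * ∫⁻ ξ, ‖𝓕 h ξ‖ₑ ^ 2 := by
  obtain ⟨F, hFc, hFf, hFi⟩ := exists_periodization hc hs hε
  have hb := hW.b_pos
  have hF := continuous_section hFc
  have hcont : Continuous (𝓕 h) :=
    continuous_fourier_of_integrable (hc.integrable_of_hasCompactSupport hs)
  rw [lintegral_eq_tsum_lowFreq ((hP.measurable_blochT hW hc hs hε).enorm.pow_const 2) hε.ne',
    lintegral_eq_tsum_lowFreq (hcont.measurable.enorm.pow_const 2) hε.ne',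
    ← lintegral_const_mul' _ _ ENNReal.ofReal_ne_top]
  refine lintegral_mono fun ξ => ?_
  obtain ⟨G, hGs, hG0, hGt, hGb⟩ := hP.exists_summable_bound hW (ε • (2 * Real.pi) • ξ) (hF ξ)
  -- Periodizations at points of one coset differ by a character, so the bound on the cell for the
  -- single field `F ξ` covers the entire fibre.
  have hae : ∀ m, F (ξ + ε⁻¹ • latticeVec m) =ᵐ[cellVol] fun x => conj (ex (freq m) x) • F ξ x :=
    fun m => by
      have hm := MemLp.conj_ex_smul (hF ξ) (freq m)
      have h0 : (fun x => F (ξ + ε⁻¹ • latticeVec m) x - conj (ex (freq m) x) • F ξ x)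
          =ᵐ[cellVol] 0 := eq_zero_of_fc ((hF _).sub hm) fun n => by
        rw [fc_sub (hF _) hm, fc_conj_ex_smul, hFf, hFf, add_assoc, ← smul_add, ← latticeVec_add,
          add_comm m n, sub_self]
      filter_upwards [h0] with x hx
      exact sub_eq_zero.1 hx
  have hle : ∀ m, ‖blochT P ε h (ξ + ε⁻¹ • latticeVec m)‖ ^ 2 ≤ G m := fun m => by
    -- The vector-valued bound follows by taking the amplitude `c` equal to the value of the
    -- transform itself.
    set K := blochT P ε h (ξ + ε⁻¹ • latticeVec m) with hK
    have h1 := hGb m K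
    have h2 : ∫ x, inner ℂ (conj (ex (freq m) x) • F ξ x)
        (act (cellMatrix P (ε • (2 * Real.pi) • ξ + freq m) x) K) ∂cellVol = inner ℂ K K := by
      conv_rhs => rw [hK, hP.inner_blochT hF hFi, smul_smul_add_latticeVec hε.ne', ← hK]
      refine integral_congr_ae ?_
      filter_upwards [hae m] with x hx
      rw [hx]
    rw [h2, inner_self_eq_norm_sq_to_K, norm_pow, RCLike.norm_ofReal, abs_norm] at h1
    rcases eq_or_ne K 0 with h0 | h0
    · rw [h0, norm_zero]
      simpa using hG0 m
    · have : 0 < ‖K‖ ^ 2 := by positivity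
      rw [sq (‖K‖ ^ 2)] at h1
      exact le_of_mul_le_mul_right h1 this
  have hPars := hasSum_sq_fc (hF ξ)
  simp only [hFf] at hPars
  calc ∑' m, ‖blochT P ε h (ξ + ε⁻¹ • latticeVec m)‖ₑ ^ 2
      ≤ ∑' m, ENNReal.ofReal (G m) := ENNReal.tsum_le_tsum fun m => by
        rw [enorm_sq_eq]
        exact ENNReal.ofReal_le_ofReal (hle m)
    _ = ENNReal.ofReal (∑' m, G m) := (ENNReal.ofReal_tsum_of_nonneg hG0 hGs).symm
    _ ≤ ENNReal.ofReal ((4 + 4 * b ^ 4 + 2 * b ^ 8) *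
          ∑' m, ‖𝓕 h (ξ + ε⁻¹ • latticeVec m)‖ ^ 2) := by
        rw [hPars.tsum_eq]
        exact ENNReal.ofReal_le_ofReal hGt
    _ = _ := by
        rw [ENNReal.ofReal_mul (by positivity),
          ENNReal.ofReal_tsum_of_nonneg (fun m => by positivity) hPars.summable]
        simp only [enorm_sq_eq]

end

end

end MaxwellHom

/-! ### Fourier calculus for test fields and weak differential identities. -/

namespace MaxwellHom

noncomputable section

open FourierTransform

/-! ### Fourier transforms of test fields -/

lemma integral_fourier_smul {E : Type*} [NormedAddCommGroup E] [NormedSpace ℂ E] [CompleteSpace E]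
    {f : R3 → ℂ} {g : R3 → E} (hf : Integrable f) (hg : Integrable g) :
    ∫ ξ, 𝓕 f ξ • g ξ = ∫ x, f x • 𝓕 g x := by
  have h := VectorFourier.integral_fourierIntegral_smul_eq_flip (L := innerₗ R3) (μ := volume)
    (ν := volume) Real.continuous_fourierChar continuous_inner hf hg
  rw [flip_innerₗ] at h
  exact h

lemma fourier_apply {f : R3 → C3} (hf : Integrable f) (ξ : R3) (j : Fin 3) :
    𝓕 f ξ j = 𝓕 (fun x => f x j) ξ := by
  rw [fourier_eq, fourier_eq]
  have hi : Integrable fun x => conj (ex ((2 * Real.pi) • ξ) x) • f x := by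
    have := MemLp.conj_ex_smul (memLp_one_iff_integrable.2 hf) ((2 * Real.pi) • ξ)
    exact memLp_one_iff_integrable.1 this
  exact ((EuclideanSpace.proj (𝕜 := ℂ) j).integral_comp_comm hi).symm

lemma hasCompactSupport_pd {φ : R3 → ℂ} (hs : HasCompactSupport φ) (j : Fin 3) :
    HasCompactSupport (pd j φ) :=
  (hs.fderiv ℝ).mono fun x hx hx' => hx (by rw [pd, hx']; rfl)

lemma hasCompactSupport_grad {φ : R3 → ℂ} (hs : HasCompactSupport φ) :
    HasCompactSupport (grad φ) :=
  (hs.fderiv ℝ).mono fun x hx hx' => hx (by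
    ext j
    change pd j φ x = 0
    rw [pd, hx']
    rfl)

lemma hasCompactSupport_apply {Φ : R3 → C3} (hs : HasCompactSupport Φ) (j : Fin 3) :
    HasCompactSupport fun x => Φ x j :=
  hs.mono fun x hx hx' => hx (by simp only [hx']; rfl)

lemma contDiff_apply' {Φ : R3 → C3} (h : ContDiff ℝ ∞ Φ) (j : Fin 3) :
    ContDiff ℝ ∞ fun x => Φ x j :=
  ((EuclideanSpace.proj (𝕜 := ℂ) j).restrictScalars ℝ).contDiff.comp h

lemma continuous_curl {Φ : R3 → C3} (h : ContDiff ℝ ∞ Φ) : Continuous (curl Φ) := by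
  have h' := fun i j => continuous_pd (contDiff_apply' h j) i
  refine (PiLp.continuous_toLp 2 _).comp (continuous_pi fun j => ?_)
  fin_cases j
  · exact (h' 1 2).sub (h' 2 1)
  · exact (h' 2 0).sub (h' 0 2)
  · exact (h' 0 1).sub (h' 1 0)

lemma hasCompactSupport_curl {Φ : R3 → C3} (hs : HasCompactSupport Φ) :
    HasCompactSupport (curl Φ) := by
  have hz : ∀ x, x ∉ tsupport Φ → ∀ i j, pd i (fun y => Φ y j) x = 0 := fun x hx i j => by
    have hsub : (Function.support fun y => Φ y j) ⊆ Function.support Φ := fun y hy hy' =>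
      hy (by simp only [hy']; rfl)
    have h1 : x ∉ tsupport fun y => Φ y j := fun h => hx (closure_mono hsub h)
    have h2 : fderiv ℝ (fun y => Φ y j) x = 0 := by
      by_contra h
      exact h1 (support_fderiv_subset ℝ h)
    rw [pd, h2]
    rfl
  refine HasCompactSupport.intro hs fun x hx => ?_
  ext j
  fin_cases j <;> simp [curl, hz x hx]

lemma fourier_pd {φ : R3 → ℂ} (h : ContDiff ℝ ∞ φ) (hs : HasCompactSupport φ) (j : Fin 3) (ξ : R3) :
    𝓕 (pd j φ) ξ = (2 * Real.pi * Complex.I) * (ξ j : ℂ) * 𝓕 φ ξ := by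
  have hi : Integrable (fderiv ℝ φ) :=
    (h.continuous_fderiv (by simp)).integrable_of_hasCompactSupport (hs.fderiv ℝ)
  have h1 := Real.fourier_fderiv (h.continuous.integrable_of_hasCompactSupport hs)
    (differentiable_of_contDiff h) hi
  have h2 := congrFun h1 ξ
  have h3 := congrArg (fun L : R3 →L[ℝ] ℂ => L (EuclideanSpace.single j 1)) h2
  rw [Real.fourier_continuousLinearMap_apply hi, VectorFourier.fourierSMulRight_apply] at h3
  refine h3.trans ?_
  have h4 : (innerSL ℝ ξ) (EuclideanSpace.single j 1) = ξ j := by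
    rw [innerSL_apply_apply, EuclideanSpace.inner_single_right]
    simp
  simp [mul_assoc, h4]

lemma integrable_grad {φ : R3 → ℂ} (h : ContDiff ℝ ∞ φ) (hs : HasCompactSupport φ) :
    Integrable (grad φ) :=
  (continuous_grad h).integrable_of_hasCompactSupport (hasCompactSupport_grad hs)

lemma fourier_grad {φ : R3 → ℂ} (h : ContDiff ℝ ∞ φ) (hs : HasCompactSupport φ) (ξ : R3) :
    𝓕 (grad φ) ξ = (2 * Real.pi * Complex.I * 𝓕 φ ξ) • cplx ξ := by
  ext j
  rw [fourier_apply (integrable_grad h hs)]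
  change 𝓕 (pd j φ) ξ = _
  rw [fourier_pd h hs, PiLp.smul_apply, cplx_apply, smul_eq_mul]
  ring

lemma fourier_curl {Φ : R3 → C3} (h : ContDiff ℝ ∞ Φ) (hs : HasCompactSupport Φ) (ξ : R3) :
    𝓕 (curl Φ) ξ = act (crossMatrix ((2 * Real.pi) • ξ)) (𝓕 Φ ξ) := by
  have hΦ : Integrable Φ := h.continuous.integrable_of_hasCompactSupport hs
  have hp : ∀ i j, Integrable (pd i fun y => Φ y j) volume := fun i j =>
    (continuous_pd (contDiff_apply' h j) i).integrable_of_hasCompactSupport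
      (hasCompactSupport_pd (hasCompactSupport_apply hs j) i)
  have hsub : ∀ i j k l, 𝓕 (fun x => pd i (fun y => Φ y j) x - pd k (fun y => Φ y l) x) ξ
      = (2 * Real.pi * Complex.I) * (ξ i * 𝓕 Φ ξ j - ξ k * 𝓕 Φ ξ l) := fun i j k l => by
    have e : 𝓕 (fun x => pd i (fun y => Φ y j) x - pd k (fun y => Φ y l) x) ξ
        = 𝓕 (pd i (fun y => Φ y j)) ξ - 𝓕 (pd k (fun y => Φ y l)) ξ := by
      have hi := fun i j => memLp_one_iff_integrable.1
        (MemLp.conj_ex_smul (memLp_one_iff_integrable.2 (hp i j)) ((2 * Real.pi) • ξ))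
      rw [fourier_eq, fourier_eq, fourier_eq, ← integral_sub (hi i j) (hi k l)]
      simp only [smul_sub]
    rw [e, fourier_pd (contDiff_apply' h j) (hasCompactSupport_apply hs j),
      fourier_pd (contDiff_apply' h l) (hasCompactSupport_apply hs l), fourier_apply hΦ,
      fourier_apply hΦ]
    ring
  ext j
  rw [fourier_apply ((continuous_curl h).integrable_of_hasCompactSupport
    (hasCompactSupport_curl hs)), act_apply, Fin.sum_univ_three]
  fin_cases j
  · refine (hsub 1 2 2 1).trans ?_
    simp [crossMatrix]; ring
  · refine (hsub 2 0 0 2).trans ?_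
    simp [crossMatrix]; ring
  · refine (hsub 0 1 1 0).trans ?_
    simp [crossMatrix]; ring

/-! ### The Fourier transform in `L²` -/

/-- Square integrable vector fields. -/
abbrev L2C3 : Type := Lp C3 2 (volume : Measure R3)

/-- The transform on `L²` and the integral formula are compared as tempered distributions: both
satisfy the multiplication formula against test functions. -/
lemma fourier_toLp_ae {f : R3 → C3} (h1 : Integrable f) (h2 : MemLp f 2 volume) :
    ⇑(𝓕 (h2.toLp f) : L2C3) =ᵐ[volume] 𝓕 f := by
  refine ae_eq_of_integral_contDiff_smul_eq
    ((Lp.memLp (𝓕 (h2.toLp f) : L2C3)).locallyIntegrable (by norm_num))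
    (continuous_fourier_of_integrable h1).locallyIntegrable fun φ hφ hφs => ?_
  have hφc : ContDiff ℝ ∞ fun x => (φ x : ℂ) := Complex.ofRealCLM.contDiff.comp hφ
  have hφcs : HasCompactSupport fun x => (φ x : ℂ) :=
    hφs.mono fun x hx hx' => hx (by simp only [hx', Complex.ofReal_zero])
  let ψ : SchwartzMap R3 ℂ := hφcs.toSchwartzMap hφc
  have hψ : ∀ x, ψ x = φ x := fun x => rfl
  have e1 := congrArg (fun L : TemperedDistribution R3 C3 => L ψ)
    (Lp.fourier_toTemperedDistribution_eq (h2.toLp f))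
  rw [TemperedDistribution.fourier_apply, Lp.toTemperedDistribution_apply,
    Lp.toTemperedDistribution_apply] at e1
  have e2 : ∀ (y : C3) x, φ x • y = ψ x • y := fun y x => by rw [hψ, Complex.coe_smul]
  simp only [e2]
  rw [← e1, ← integral_fourier_smul ψ.integrable h1]
  refine integral_congr_ae ?_
  filter_upwards [h2.coeFn_toLp] with x hx
  rw [hx]
  rfl

lemma integrable_of_test {h : R3 → C3} (hc : Continuous h) (hs : HasCompactSupport h) :
    Integrable h :=
  hc.integrable_of_hasCompactSupport hs

lemma memLp_of_test {h : R3 → C3} (hc : Continuous h) (hs : HasCompactSupport h) (p : ℝ≥0∞) :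
    MemLp h p volume :=
  hc.memLp_of_hasCompactSupport hs

lemma memLp_fourier {h : R3 → C3} (h1 : Integrable h) (h2 : MemLp h 2 volume) :
    MemLp (𝓕 h) 2 volume :=
  (Lp.memLp (𝓕 (h2.toLp h) : L2C3)).ae_eq (fourier_toLp_ae h1 h2)

lemma eLpNorm_fourier {h : R3 → C3} (h1 : Integrable h) (h2 : MemLp h 2 volume) :
    eLpNorm (𝓕 h) 2 volume = eLpNorm h 2 volume := by
  rw [← eLpNorm_congr_ae (fourier_toLp_ae h1 h2), ← eLpNorm_congr_ae h2.coeFn_toLp,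
    ← ENNReal.toReal_eq_toReal_iff' (Lp.eLpNorm_ne_top _) (Lp.eLpNorm_ne_top _), ← Lp.norm_def,
    ← Lp.norm_def, Lp.norm_fourier_eq]

lemma integral_inner_fourier {h : R3 → C3} (h1 : Integrable h) (h2 : MemLp h 2 volume)
    (U : L2C3) : ∫ x, inner ℂ (h x) (U x) = ∫ ξ, inner ℂ (𝓕 h ξ) ((𝓕 U : L2C3) ξ) := by
  have e := Lp.inner_fourier_eq (h2.toLp h) U
  rw [L2.inner_def, L2.inner_def] at e
  calc ∫ x, inner ℂ (h x) (U x) = ∫ x, inner ℂ (h2.toLp h x) (U x) := by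
        refine integral_congr_ae ?_
        filter_upwards [h2.coeFn_toLp] with x hx
        rw [hx]
    _ = _ := e.symm
    _ = _ := by
        refine integral_congr_ae ?_
        filter_upwards [fourier_toLp_ae h1 h2] with x hx
        rw [hx]

/-! ### Uniqueness -/

/-- Every test function is the transform of a Schwartz function, and the multiplication formula
moves the transform onto `G`. -/
lemma ae_eq_zero_of_fourier_eq_zero {G : R3 → ℂ} (hG : Integrable G) (h : ∀ a, 𝓕 G a = 0) :
    G =ᵐ[volume] 0 := by
  refine ae_eq_zero_of_integral_contDiff_smul_eq_zero hG.locallyIntegrable fun φ hφ hφs => ?_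
  have hφc : ContDiff ℝ ∞ fun x => (φ x : ℂ) := Complex.ofRealCLM.contDiff.comp hφ
  have hφcs : HasCompactSupport fun x => (φ x : ℂ) :=
    hφs.mono fun x hx hx' => hx (by simp only [hx', Complex.ofReal_zero])
  let ψ : SchwartzMap R3 ℂ := hφcs.toSchwartzMap hφc
  have hψ : ∀ x, φ x • G x = 𝓕 (⇑(𝓕⁻ ψ : SchwartzMap R3 ℂ)) x • G x := fun x => by
    rw [← SchwartzMap.fourier_coe, FourierTransform.fourier_fourierInv_eq]
    exact (Complex.coe_smul _ _).symm
  simp only [hψ]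
  rw [integral_fourier_smul (𝓕⁻ ψ : SchwartzMap R3 ℂ).integrable hG]
  simp [h]

/-- A function whose product with the transforms of all test functions integrates to zero. -/
lemma ae_eq_zero_of_integral_fourier_mul {f : R3 → ℂ}
    (h : ∀ φ : R3 → ℂ, ContDiff ℝ ∞ φ → HasCompactSupport φ →
      Integrable (fun ξ => conj (𝓕 φ ξ) * f ξ) ∧ ∫ ξ, conj (𝓕 φ ξ) * f ξ = 0) :
    f =ᵐ[volume] 0 := by
  have key : ∀ φ : R3 → ℂ, ContDiff ℝ ∞ φ → HasCompactSupport φ →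
      (fun ξ => conj (𝓕 φ ξ) * f ξ) =ᵐ[volume] 0 := fun φ hφ hφs => by
    refine ae_eq_zero_of_fourier_eq_zero (h φ hφ hφs).1 fun a => ?_
    -- Translating `φ` multiplies its transform by a character. The hypothesis for all translates
    -- says that the product has vanishing Fourier transform.
    have h1 := (h (fun x => φ (x + a)) (hφ.comp (contDiff_id.add contDiff_const))
      (hφs.comp_homeomorph (Homeomorph.addRight a))).2
    rw [fourier_eq, ← h1]
    refine integral_congr_ae (ae_of_all _ fun ξ => ?_)
    dsimp only
    have h2 : 𝓕 (fun x => φ (x + a)) ξ = ex ((2 * Real.pi) • a) ξ * 𝓕 φ ξ := by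
      have h3 : ex ((2 * Real.pi) • a) ξ = ex ((2 * Real.pi) • ξ) a := by
        rw [ex, ex, real_inner_smul_left, real_inner_smul_left, real_inner_comm]
      rw [fourier_eq, fourier_eq, h3, ← integral_const_mul,
        ← integral_add_right_eq_self (fun x => ex ((2 * Real.pi) • ξ) a *
          conj (ex ((2 * Real.pi) • ξ) x) • φ x) a]
      refine integral_congr_ae (ae_of_all _ fun x => ?_)
      dsimp only
      rw [ex_add_right, map_mul, smul_eq_mul, smul_eq_mul, ← mul_assoc, mul_left_comm,
        ex_mul_conj_ex, mul_one]
    rw [h2, map_mul, smul_eq_mul, mul_assoc]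
  refine measure_null_of_locally_null _ fun ξ₀ _ => ?_
  let β : ContDiffBump (0 : R3) := default
  -- A bump modulated to frequency `ξ₀` has transform `∫ β > 0` there, hence nonzero nearby, so the
  -- product can be divided out locally.
  let φ : R3 → ℂ := fun x => ex ((2 * Real.pi) • ξ₀) x * (β x : ℂ)
  have hφ : ContDiff ℝ ∞ φ :=
    (contDiff_ex _).mul (Complex.ofRealCLM.contDiff.comp β.contDiff)
  have hφs : HasCompactSupport φ :=
    β.hasCompactSupport.mono fun x hx hx' => hx (by simp [φ, hx'])
  have h0 : 𝓕 φ ξ₀ ≠ 0 := by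
    rw [fourier_eq]
    have : ∀ x, conj (ex ((2 * Real.pi) • ξ₀) x) • φ x = (β x : ℂ) := fun x => by
      simp only [φ]
      rw [smul_eq_mul, ← mul_assoc, conj_ex_mul_ex, one_mul]
    simp only [this]
    rw [integral_complex_ofReal]
    exact Complex.ofReal_ne_zero.2 β.integral_pos.ne'
  have hcont := continuous_fourier_of_integrable (hφ.continuous.integrable_of_hasCompactSupport hφs)
  refine ⟨_, inter_mem_nhdsWithin _ ((hcont.isOpen_preimage _ isOpen_ne).mem_nhds h0), ?_⟩
  refine measure_mono_null (fun ξ hξ => ?_) (key φ hφ hφs)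
  exact mul_ne_zero (star_ne_zero.2 hξ.2) hξ.1

lemma integrable_inner_fourier {h : R3 → C3} (hc : Continuous h) (hs : HasCompactSupport h)
    (U : L2C3) : Integrable (fun ξ => inner ℂ (𝓕 h ξ) (U ξ)) :=
  integrable_inner (memLp_fourier (integrable_of_test hc hs) (memLp_of_test hc hs 2)) (Lp.memLp U)

/-- Weakly divergence free fields have transversal Fourier transforms. -/
lemma inner_cplx_fourier_eq_zero {U : L2C3}
    (h : ∀ φ : R3 → ℂ, ContDiff ℝ ∞ φ → HasCompactSupport φ →
      ∫ x, inner ℂ (grad φ x) (U x) = 0) :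
    ∀ᵐ ξ, inner ℂ (cplx ξ) ((𝓕 U : L2C3) ξ) = 0 := by
  have h0 : (fun ξ => inner ℂ (cplx ξ) ((𝓕 U : L2C3) ξ)) =ᵐ[volume] 0 :=
    ae_eq_zero_of_integral_fourier_mul fun φ hφ hφs => by
      have hc := continuous_grad hφ
      have hs := hasCompactSupport_grad hφs
      have e : ∀ ξ, conj (𝓕 φ ξ) * inner ℂ (cplx ξ) ((𝓕 U : L2C3) ξ)
          = (conj (2 * Real.pi * Complex.I))⁻¹ * inner ℂ (𝓕 (grad φ) ξ) ((𝓕 U : L2C3) ξ) :=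
        fun ξ => by
          rw [fourier_grad hφ hφs, inner_smul_left, map_mul _ _ (𝓕 φ ξ),
            mul_assoc (conj (2 * Real.pi * Complex.I)), inv_mul_cancel_left₀]
          simp
      simp only [e]
      refine ⟨(integrable_inner_fourier hc hs _).const_mul _, ?_⟩
      rw [integral_const_mul, ← integral_inner_fourier (integrable_of_test hc hs)
        (memLp_of_test hc hs 2), h φ hφ hφs, mul_zero]
  exact h0

lemma conjTranspose_crossMatrix (θ : R3) : (crossMatrix θ)ᴴ = crossMatrix θ := by
  ext i j
  fin_cases i <;> fin_cases j <;> simp [crossMatrix]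

/-- The Fourier transform of the weak curl. -/
lemma act_crossMatrix_fourier_eq {U V : L2C3}
    (h : ∀ Φ : R3 → C3, ContDiff ℝ ∞ Φ → HasCompactSupport Φ →
      ∫ x, inner ℂ (curl Φ x) (U x) = ∫ x, inner ℂ (Φ x) (V x)) :
    ∀ᵐ ξ, act (crossMatrix ((2 * Real.pi) • ξ)) ((𝓕 U : L2C3) ξ) = (𝓕 V : L2C3) ξ := by
  have h0 : ∀ j : Fin 3, (fun ξ => act (crossMatrix ((2 * Real.pi) • ξ)) ((𝓕 U : L2C3) ξ) j
      - (𝓕 V : L2C3) ξ j) =ᵐ[volume] 0 := fun j =>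
    ae_eq_zero_of_integral_fourier_mul fun φ hφ hφs => by
      let Φ : R3 → C3 := fun x => φ x • EuclideanSpace.single j 1
      have hΦ : ContDiff ℝ ∞ Φ := hφ.smul contDiff_const
      have hΦs : HasCompactSupport Φ := hφs.smul_right
      have hF : ∀ ξ, 𝓕 Φ ξ = 𝓕 φ ξ • EuclideanSpace.single j 1 := fun ξ => by
        rw [fourier_eq, fourier_eq, ← integral_smul_const]
        simp only [Φ, smul_smul, smul_eq_mul]
      have hc := continuous_curl hΦ
      have hs := hasCompactSupport_curl hΦs
      have e : ∀ ξ, conj (𝓕 φ ξ) * (act (crossMatrix ((2 * Real.pi) • ξ)) ((𝓕 U : L2C3) ξ) j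
          - (𝓕 V : L2C3) ξ j) = inner ℂ (𝓕 (curl Φ) ξ) ((𝓕 U : L2C3) ξ)
            - inner ℂ (𝓕 Φ ξ) ((𝓕 V : L2C3) ξ) := fun ξ => by
        rw [fourier_curl hΦ hΦs, inner_act_left, conjTranspose_crossMatrix, hF, inner_smul_left,
          inner_smul_left, EuclideanSpace.inner_single_left, EuclideanSpace.inner_single_left]
        simp [mul_sub]
      simp only [e]
      have i1 := integrable_inner_fourier hc hs (𝓕 U : L2C3)
      have i2 := integrable_inner_fourier hΦ.continuous hΦs (𝓕 V : L2C3)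
      refine ⟨i1.sub i2, ?_⟩
      rw [integral_sub i1 i2, ← integral_inner_fourier (integrable_of_test hc hs)
        (memLp_of_test hc hs 2), ← integral_inner_fourier (integrable_of_test hΦ.continuous hΦs)
        (memLp_of_test hΦ.continuous hΦs 2), h Φ hΦ hΦs, sub_self]
  filter_upwards [h0 0, h0 1, h0 2] with ξ h1 h2 h3
  ext j
  fin_cases j
  · exact sub_eq_zero.1 h1
  · exact sub_eq_zero.1 h2
  · exact sub_eq_zero.1 h3

end

end MaxwellHom

/-! ### Superposition of corrected plane waves and the flux defect. -/

namespace MaxwellHom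

noncomputable section

open FourierTransform

/-! ### The operator of superposition of corrected plane waves -/

/-- Continuous compactly supported fields. -/
def testSpace : Submodule ℂ (R3 → C3) where
  carrier := {h | Continuous h ∧ HasCompactSupport h}
  add_mem' := fun h1 h2 => ⟨h1.1.add h2.1, h1.2.add h2.2⟩
  zero_mem' := ⟨continuous_const, HasCompactSupport.zero⟩
  smul_mem' := fun c _ h => ⟨h.1.const_smul c,
    h.2.mono fun x hx hx' => hx (by simp [Pi.smul_apply, hx'])⟩

lemma testSpace_memLp (h : testSpace) : MemLp (h : R3 → C3) 2 volume :=
  memLp_of_test h.2.1 h.2.2 2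

/-- The inclusion of test fields into `L²`. -/
def testToLp : testSpace →ₗ[ℂ] L2C3 where
  toFun h := (testSpace_memLp h).toLp _
  map_add' _ _ := rfl
  map_smul' _ _ := rfl

lemma denseRange_testToLp : DenseRange testToLp := fun f => by
  refine Metric.mem_closure_iff.2 fun ε hε => ?_
  obtain ⟨g, hgs, hg, hgc, hgm⟩ := (Lp.memLp f).exists_hasCompactSupport_eLpNorm_sub_le
    (by norm_num) (ε := ENNReal.ofReal (ε / 2)) (by simpa using hε)
  refine ⟨testToLp ⟨g, hgc, hgs⟩, ⟨_, rfl⟩, ?_⟩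
  have h1 : testToLp ⟨g, hgc, hgs⟩ = hgm.toLp g := rfl
  rw [h1, dist_eq_norm, ← Lp.toLp_coeFn f (Lp.memLp f), ← MemLp.toLp_sub, Lp.norm_toLp]
  calc _ ≤ (ENNReal.ofReal (ε / 2)).toReal := ENNReal.toReal_mono ENNReal.ofReal_ne_top hg
    _ = ε / 2 := ENNReal.toReal_ofReal (by positivity)
    _ < ε := by linarith

lemma eLpNorm_two_sq (f : R3 → C3) (μ : Measure R3) :
    eLpNorm f 2 μ ^ 2 = ∫⁻ x, ‖f x‖ₑ ^ 2 ∂μ := by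
  have := eLpNorm_nnreal_pow_eq_lintegral (f := f) (μ := μ) (p := 2) (by norm_num)
  simpa using this

lemma eLpNorm_le_of_lintegral_le {f g : R3 → C3} {c : ℝ} (hc : 0 ≤ c)
    (h : ∫⁻ x, ‖f x‖ₑ ^ 2 ≤ ENNReal.ofReal (c ^ 2) * ∫⁻ x, ‖g x‖ₑ ^ 2) :
    eLpNorm f 2 volume ≤ ENNReal.ofReal c * eLpNorm g 2 volume := by
  rw [← eLpNorm_two_sq, ← eLpNorm_two_sq, ENNReal.ofReal_pow hc, ← mul_pow] at h
  exact (ENNReal.pow_le_pow_left_iff two_ne_zero).1 h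

section

variable {S T : R3 → MatC} {b : ℝ} {P : R3 → Fin 3 → R3 → C3} {ε : ℝ}

/-- The norm bound of the Bloch transform. -/
def blochBound (b : ℝ) : ℝ := √(4 + 4 * b ^ 4 + 2 * b ^ 8)

lemma blochBound_nonneg (b : ℝ) : 0 ≤ blochBound b := Real.sqrt_nonneg _

lemma IsBlochFamily.eLpNorm_blochT_le (hW : IsWeight S T b) (hP : IsBlochFamily S P) (hε : 0 < ε)
    (h : testSpace) : eLpNorm (blochT P ε h) 2 volume
      ≤ ENNReal.ofReal (blochBound b) * eLpNorm (h : R3 → C3) 2 volume := by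
  have hb := hW.b_pos
  rw [← eLpNorm_fourier (integrable_of_test h.2.1 h.2.2) (testSpace_memLp h)]
  refine eLpNorm_le_of_lintegral_le (blochBound_nonneg b) ?_
  rw [blochBound, Real.sq_sqrt (by positivity)]
  exact hP.lintegral_blochT_le hW h.2.1 h.2.2 hε

lemma IsBlochFamily.memLp_blochT (hW : IsWeight S T b) (hP : IsBlochFamily S P) (hε : 0 < ε)
    (h : testSpace) : MemLp (blochT P ε h) 2 volume :=
  ⟨(hP.measurable_blochT hW h.2.1 h.2.2 hε).aestronglyMeasurable,
    (hP.eLpNorm_blochT_le hW hε h).trans_lt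
      (ENNReal.mul_lt_top ENNReal.ofReal_lt_top (testSpace_memLp h).2)⟩

/-- Additivity is proved on periodizations, where all pairings are between square integrable fields
on the cell; periodizations are identified by their Fourier coefficients. -/
lemma IsBlochFamily.blochT_add (hP : IsBlochFamily S P) (hε : 0 < ε) (g h : testSpace) :
    blochT P ε (g + h : R3 → C3) = blochT P ε g + blochT P ε h := by
  obtain ⟨F, hFc, hFf, hFi⟩ := exists_periodization g.2.1 g.2.2 hε
  obtain ⟨G, hGc, hGf, hGi⟩ := exists_periodization h.2.1 h.2.2 hε
  obtain ⟨K, hKc, hKf, hKi⟩ := exists_periodization (g + h).2.1 (g + h).2.2 hε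
  funext ξ
  refine ext_inner_right ℂ fun c => ?_
  have hF := continuous_section hFc
  have hG := continuous_section hGc
  have hK := continuous_section hKc
  have hFG : MemLp (fun y => F ξ y + G ξ y) 2 cellVol := (hF ξ).add (hG ξ)
  have hae : (fun y => K ξ y - (F ξ y + G ξ y)) =ᵐ[cellVol] 0 :=
    eq_zero_of_fc ((hK ξ).sub hFG) fun n => by
      rw [fc_sub (hK ξ) hFG, fc_add (hF ξ) (hG ξ), hFf, hGf, hKf, sub_eq_zero]
      have hi := fun k : testSpace => memLp_one_iff_integrable.1 (MemLp.conj_ex_smul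
        (memLp_one_iff_integrable.2 (integrable_of_test k.2.1 k.2.2))
        ((2 * Real.pi) • (ξ + ε⁻¹ • latticeVec n)))
      rw [fourier_eq, fourier_eq, fourier_eq, ← integral_add (hi g) (hi h)]
      simp only [← smul_add]
      rfl
  have hV := hP.memLp (ε • (2 * Real.pi) • ξ) c
  rw [Pi.add_apply, inner_add_left, hP.inner_blochT hF hFi, hP.inner_blochT hG hGi,
    ← integral_add (integrable_inner (hF ξ) hV) (integrable_inner (hG ξ) hV)]
  refine (hP.inner_blochT hK hKi ξ c).trans (integral_congr_ae ?_)
  filter_upwards [hae] with y hy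
  rw [sub_eq_zero.1 hy, inner_add_left]

lemma blochT_smul (P : R3 → Fin 3 → R3 → C3) (ε : ℝ) (c : ℂ) (h : R3 → C3) :
    blochT P ε (c • h) = c • blochT P ε h := by
  funext ξ
  ext j
  simp only [blochT, Pi.smul_apply, PiLp.smul_apply, inner_smul_left, integral_const_mul, map_mul,
    Complex.conj_conj, smul_eq_mul]

/-- The Bloch transform on test fields, as a linear map into `L²`. -/
def blochTest (hW : IsWeight S T b) (hP : IsBlochFamily S P) (hε : 0 < ε) :
    testSpace →ₗ[ℂ] L2C3 where
  toFun h := (hP.memLp_blochT hW hε h).toLp _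
  map_add' g h := by
    rw [← MemLp.toLp_add]
    exact MemLp.toLp_congr _ _ (ae_of_all _ fun ξ => congrFun (hP.blochT_add hε g h) ξ)
  map_smul' c h := by
    rw [RingHom.id_apply, ← MemLp.toLp_const_smul]
    exact MemLp.toLp_congr _ _ (ae_of_all _ fun ξ => congrFun (blochT_smul P ε c h) ξ)

lemma norm_blochTest_le (hW : IsWeight S T b) (hP : IsBlochFamily S P) (hε : 0 < ε)
    (h : testSpace) : ‖blochTest hW hP hε h‖ ≤ blochBound b * ‖testToLp h‖ := by
  have h1 : blochTest hW hP hε h = (hP.memLp_blochT hW hε h).toLp _ := rfl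
  have h2 : testToLp h = (testSpace_memLp h).toLp _ := rfl
  rw [h1, h2, Lp.norm_toLp, Lp.norm_toLp, ← ENNReal.toReal_ofReal (blochBound_nonneg b),
    ← ENNReal.toReal_mul]
  exact ENNReal.toReal_mono (ENNReal.mul_ne_top ENNReal.ofReal_ne_top (testSpace_memLp h).2.ne)
    (hP.eLpNorm_blochT_le hW hε h)

/-- The Bloch transform on `L²`. -/
def blochL (hW : IsWeight S T b) (hP : IsBlochFamily S P) (hε : 0 < ε) : L2C3 →L[ℂ] L2C3 :=
  (blochTest hW hP hε).extendOfNorm testToLp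

/-- The superposition of corrected plane waves with a square integrable density. -/
def synth (hW : IsWeight S T b) (hP : IsBlochFamily S P) (hε : 0 < ε) : L2C3 →L[ℂ] L2C3 :=
  ContinuousLinearMap.adjoint (blochL hW hP hε)

lemma norm_synth_le (hW : IsWeight S T b) (hP : IsBlochFamily S P) (hε : 0 < ε) (w : L2C3) :
    ‖synth hW hP hε w‖ ≤ blochBound b * ‖w‖ := by
  refine (ContinuousLinearMap.le_opNorm _ _).trans ?_
  rw [synth, LinearIsometryEquiv.norm_map]
  gcongr
  exact LinearMap.opNorm_extendOfNorm_le denseRange_testToLp (blochBound_nonneg b)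
    (norm_blochTest_le hW hP hε)

lemma inner_testToLp (h : testSpace) (U : L2C3) :
    inner ℂ (testToLp h) U = ∫ x, inner ℂ ((h : R3 → C3) x) (U x) := by
  rw [L2.inner_def]
  refine integral_congr_ae ?_
  filter_upwards [(testSpace_memLp h).coeFn_toLp] with x hx
  rw [← hx]
  rfl

lemma integrable_inner_blochT (hW : IsWeight S T b) (hP : IsBlochFamily S P) (hε : 0 < ε)
    {h : R3 → C3} (hc : Continuous h) (hs : HasCompactSupport h) (w : L2C3) :
    Integrable fun ξ => inner ℂ (blochT P ε h ξ) (w ξ) :=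
  integrable_inner (hP.memLp_blochT hW hε ⟨h, hc, hs⟩) (Lp.memLp w)

/-- The weak form of the superposition. Defining it as the adjoint of the extended Bloch transform
avoids any pointwise convergence of the frequency integral. -/
lemma integral_inner_synth (hW : IsWeight S T b) (hP : IsBlochFamily S P) (hε : 0 < ε)
    {h : R3 → C3} (hc : Continuous h) (hs : HasCompactSupport h) (w : L2C3) :
    ∫ x, inner ℂ (h x) (synth hW hP hε w x) = ∫ ξ, inner ℂ (blochT P ε h ξ) (w ξ) := by
  have h1 := inner_testToLp ⟨h, hc, hs⟩ (synth hW hP hε w)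
  have h2 : blochL hW hP hε (testToLp ⟨h, hc, hs⟩) = blochTest hW hP hε ⟨h, hc, hs⟩ :=
    LinearMap.extendOfNorm_eq denseRange_testToLp ⟨_, norm_blochTest_le hW hP hε⟩ _
  rw [← h1, synth, ContinuousLinearMap.adjoint_inner_right, h2, L2.inner_def]
  refine integral_congr_ae ?_
  filter_upwards [(hP.memLp_blochT hW hε ⟨h, hc, hs⟩).coeFn_toLp] with ξ hξ
  rw [← hξ]
  rfl

/-! ### The effective matrix as a multiplier -/

lemma IsBlochFamily.measurable_effMatrix (hW : IsWeight S T b) (hP : IsBlochFamily S P)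
    (i j : Fin 3) : Measurable fun κ => effMatrix S P κ i j := by
  have h1 := hW.measurable_integral_inner (w := cellModes) continuous_cellModes
    (F := fun _ _ => EuclideanSpace.single i 1) (p := fun κ => P κ j)
    continuous_const (EuclideanSpace.single j 1) (fun κ => hP.modal κ j) (fun κ => hP.orth κ j)
  convert h1 using 1
  funext κ
  have h2 := integral_inner_ex_smul (hP.orth κ j).1 0 (EuclideanSpace.single i 1)
  simp only [freq_zero, ex_zero, one_smul] at h2
  rw [EuclideanSpace.inner_single_left, map_one, one_mul] at h2
  refine h2.symm.trans (integral_congr_ae (ae_of_all _ fun x => ?_))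
  dsimp only
  rw [inner_act_left (S x), hW.hermS]

lemma IsBlochFamily.measurable_effMatrix_scale (hW : IsWeight S T b) (hP : IsBlochFamily S P)
    (ε : ℝ) (i j : Fin 3) :
    Measurable fun ξ : R3 => effMatrix S P (ε • (2 * Real.pi) • ξ) i j := by
  have : Measurable fun ξ : R3 => ε • (2 * Real.pi) • ξ := by fun_prop
  exact (hP.measurable_effMatrix hW i j).comp this

/-- Multiplication by the effective matrix in frequency space. -/
def effL (hW : IsWeight S T b) (hP : IsBlochFamily S P) (ε : ℝ) : L2C3 →L[ℂ] L2C3 :=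
  mulLp volume (hP.measurable_effMatrix_scale hW ε)
    (fun ξ v => hP.norm_act_effMatrix_le hW (ε • (2 * Real.pi) • ξ) v)

lemma coeFn_effL (hW : IsWeight S T b) (hP : IsBlochFamily S P) (ε : ℝ) (w : L2C3) :
    effL hW hP ε w =ᵐ[volume] fun ξ => act (effMatrix S P (ε • (2 * Real.pi) • ξ)) (w ξ) :=
  coeFn_mulLp _ _ _

lemma norm_mulLp_le {μ : Measure R3} {M : R3 → MatC} (hM : ∀ i j, Measurable fun y => M y i j)
    {b : ℝ} (h0 : 0 ≤ b) (hb : ∀ y v, ‖act (M y) v‖ ≤ b * ‖v‖) (f : Lp C3 2 μ) :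
    ‖mulLp μ hM hb f‖ ≤ b * ‖f‖ :=
  (ContinuousLinearMap.le_opNorm _ _).trans
    (by gcongr; exact LinearMap.mkContinuous_norm_le _ h0 _)

lemma IsWeight.continuous_scale (hW : IsWeight S T b) (ε : ℝ) :
    Continuous fun x : R3 => S (ε⁻¹ • x) :=
  hW.contS.comp (continuous_const_smul _)

/-- Multiplication by the weight `S` at scale `ε`. -/
def mulS (hW : IsWeight S T b) (ε : ℝ) : L2C3 →L[ℂ] L2C3 :=
  mulLp volume (measurable_entry (hW.continuous_scale ε)) (fun x v => hW.boundS (ε⁻¹ • x) v)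

lemma coeFn_mulS (hW : IsWeight S T b) (ε : ℝ) (f : L2C3) :
    mulS hW ε f =ᵐ[volume] fun x => act (S (ε⁻¹ • x)) (f x) :=
  coeFn_mulLp _ _ _

lemma inner_mulS (hW : IsWeight S T b) (ε : ℝ) (f g : L2C3) :
    inner ℂ (mulS hW ε f) g = inner ℂ f (mulS hW ε g) := by
  rw [L2.inner_def, L2.inner_def]
  refine integral_congr_ae ?_
  filter_upwards [coeFn_mulS hW ε f, coeFn_mulS hW ε g] with x h1 h2
  rw [h1, h2, inner_act_left, hW.hermS]

lemma norm_le_mulS (hW : IsWeight S T b) (ε : ℝ) (f : L2C3) : ‖f‖ ≤ b * ‖mulS hW ε f‖ := by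
  refine Lp.norm_le_mul_norm_of_ae_le_mul ?_
  filter_upwards [coeFn_mulS hW ε f] with x h1
  rw [h1]
  exact hW.norm_le _ _

lemma norm_mulS_le (hW : IsWeight S T b) (ε : ℝ) (f : L2C3) : ‖mulS hW ε f‖ ≤ b * ‖f‖ :=
  norm_mulLp_le _ hW.b_pos.le _ _

lemma integral_inner_mulS_mulS (hW : IsWeight S T b) (ε : ℝ) (h : R3 → C3) (U : L2C3) :
    ∫ x, inner ℂ (h x) (mulS hW ε (mulS hW ε U) x) = ∫ x, inner ℂ (weight S ε h x) (U x) := by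
  refine integral_congr_ae ?_
  filter_upwards [coeFn_mulS hW ε U, coeFn_mulS hW ε (mulS hW ε U)] with x h1 h2
  rw [h2, h1, weight, inner_act_left, inner_act_left, hW.hermS]

/-! ### The flux defect -/

/-- The difference of the flux of the synthesized field and of its homogenised flux. -/
def fluxDefect (hW : IsWeight S T b) (hP : IsBlochFamily S P) (hε : 0 < ε) (w : L2C3) : L2C3 :=
  mulS hW ε (mulS hW ε (synth hW hP hε w)) - 𝓕⁻ (effL hW hP ε w)

lemma fluxDefect_add (hW : IsWeight S T b) (hP : IsBlochFamily S P) (hε : 0 < ε) (w₁ w₂ : L2C3) :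
    fluxDefect hW hP hε (w₁ + w₂) = fluxDefect hW hP hε w₁ + fluxDefect hW hP hε w₂ := by
  simp only [fluxDefect, map_add, FourierTransform.fourierInv_add]
  abel

lemma norm_fluxDefect_le (hW : IsWeight S T b) (hP : IsBlochFamily S P) (hε : 0 < ε) (w : L2C3) :
    ‖fluxDefect hW hP hε w‖ ≤ (b ^ 2 * blochBound b + b ^ 2) * ‖w‖ := by
  have hb := hW.b_pos
  have h1 : ‖mulS hW ε (mulS hW ε (synth hW hP hε w))‖ ≤ b * (b * (blochBound b * ‖w‖)) := by
    refine (norm_mulS_le hW ε _).trans ?_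
    gcongr
    refine (norm_mulS_le hW ε _).trans ?_
    gcongr
    exact norm_synth_le hW hP hε w
  have h2 : ‖(𝓕⁻ (effL hW hP ε w) : L2C3)‖ ≤ b ^ 2 * ‖w‖ := by
    have : ‖(𝓕⁻ (effL hW hP ε w) : L2C3)‖ = ‖effL hW hP ε w‖ := by
      rw [← Lp.norm_fourier_eq, FourierTransform.fourier_fourierInv_eq]
    rw [this]
    exact norm_mulLp_le _ (by positivity) _ _
  calc _ ≤ _ := norm_sub_le _ _
    _ ≤ _ := add_le_add h1 h2
    _ = _ := by ring

lemma integral_inner_fluxDefect (hW : IsWeight S T b) (hP : IsBlochFamily S P) (hε : 0 < ε)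
    {h : R3 → C3} (hc : Continuous h) (hs : HasCompactSupport h) (w : L2C3) :
    ∫ x, inner ℂ (h x) (fluxDefect hW hP hε w x)
      = ∫ ξ, (inner ℂ (blochT P ε (weight S ε h) ξ) (w ξ)
        - inner ℂ (𝓕 h ξ) (act (effMatrix S P (ε • (2 * Real.pi) • ξ)) (w ξ))) := by
  have hm := memLp_of_test hc hs 2
  have i1 := integrable_inner_blochT hW hP hε (hW.continuous_weight (ε := ε) hc)
    (hasCompactSupport_weight (S := S) (ε := ε) hs) w
  have e2 : (fun ξ => inner ℂ (𝓕 h ξ) (effL hW hP ε w ξ)) =ᵐ[volume]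
      fun ξ => inner ℂ (𝓕 h ξ) (act (effMatrix S P (ε • (2 * Real.pi) • ξ)) (w ξ)) := by
    filter_upwards [coeFn_effL hW hP ε w] with ξ hξ
    rw [hξ]
  have i2 := (integrable_inner_fourier hc hs (effL hW hP ε w)).congr e2
  rw [integral_sub i1 i2, ← integral_inner_synth hW hP hε (hW.continuous_weight hc)
    (hasCompactSupport_weight hs), ← integral_inner_mulS_mulS hW, ← integral_congr_ae e2]
  have e3 := integral_inner_fourier (integrable_of_test hc hs) hm (𝓕⁻ (effL hW hP ε w) : L2C3)
  rw [FourierTransform.fourier_fourierInv_eq] at e3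
  rw [← e3, ← integral_sub (integrable_inner hm (Lp.memLp _)) (integrable_inner hm (Lp.memLp _))]
  refine integral_congr_ae ?_
  filter_upwards [Lp.coeFn_sub (mulS hW ε (mulS hW ε (synth hW hP hε w)))
    (𝓕⁻ (effL hW hP ε w) : L2C3)] with x hx
  rw [fluxDefect, hx, Pi.sub_apply, inner_sub_right]

end

end

end MaxwellHom

/-! ### The flux defect is divergence free and of high frequency. -/

namespace MaxwellHom

noncomputable section

open FourierTransform

/-! ### The cross product in frequency space -/

lemma act_crossMatrix_cplx (r : ℝ) (ξ : R3) : act (crossMatrix (r • ξ)) (cplx ξ) = 0 := by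
  ext i
  rw [act_apply, Fin.sum_univ_three]
  fin_cases i <;> simp [crossMatrix, cplx_apply] <;> ring

lemma inner_act_crossMatrix (θ : R3) (u v : C3) :
    inner ℂ (act (crossMatrix θ) u) v = inner ℂ u (act (crossMatrix θ) v) := by
  rw [inner_act_left, conjTranspose_crossMatrix]

lemma inner_cplx_act_crossMatrix (r : ℝ) (ξ : R3) (v : C3) :
    inner ℂ (cplx ξ) (act (crossMatrix (r • ξ)) v) = 0 := by
  rw [← inner_act_crossMatrix, act_crossMatrix_cplx, inner_zero_left]

section

variable {S T : R3 → MatC} {b : ℝ} {P : R3 → Fin 3 → R3 → C3} {ε : ℝ}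

/-- The weak curl of a synthesized field. -/
lemma integral_curl_synth (hW : IsWeight S T b) (hP : IsBlochFamily S P) (hε : 0 < ε) {w V : L2C3}
    (hV : ∀ᵐ ξ, V ξ = act (crossMatrix ((2 * Real.pi) • ξ)) (w ξ)) {Φ : R3 → C3}
    (hΦ : ContDiff ℝ ∞ Φ) (hΦs : HasCompactSupport Φ) :
    ∫ x, inner ℂ (curl Φ x) (synth hW hP hε w x)
      = ∫ x, inner ℂ (Φ x) ((𝓕⁻ V : L2C3) x) := by
  rw [integral_inner_synth hW hP hε (continuous_curl hΦ) (hasCompactSupport_curl hΦs),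
    integral_inner_fourier (integrable_of_test hΦ.continuous hΦs)
      (memLp_of_test hΦ.continuous hΦs 2), FourierTransform.fourier_fourierInv_eq]
  refine integral_congr_ae ?_
  filter_upwards [hV] with ξ hξ
  rw [hξ, hP.blochT_of_transversal (continuous_curl hΦ) (hasCompactSupport_curl hΦs) hε,
    fourier_curl hΦ hΦs, inner_act_crossMatrix]
  intro η
  rw [fourier_curl hΦ hΦs, inner_cplx_act_crossMatrix]

/-- The flux defect is divergence free. -/
lemma integral_grad_fluxDefect (hW : IsWeight S T b) (hP : IsBlochFamily S P) (hε : 0 < ε)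
    (w : L2C3) {φ : R3 → ℂ} (hφ : ContDiff ℝ ∞ φ) (hφs : HasCompactSupport φ) :
    ∫ x, inner ℂ (grad φ x) (fluxDefect hW hP hε w x) = 0 := by
  rw [integral_inner_fluxDefect hW hP hε (continuous_grad hφ) (hasCompactSupport_grad hφs),
    ← integral_zero R3 ℂ]
  refine integral_congr_ae (ae_of_all _ fun ξ => ?_)
  dsimp only
  rw [hP.inner_blochT_weight_of_longitudinal hW (continuous_grad hφ) (hasCompactSupport_grad hφs)
    hε, sub_self]
  intro η
  rw [fourier_grad hφ hφs]
  exact Submodule.smul_mem _ _ (Submodule.mem_span_singleton_self _)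

/-- At `ξ` in `lowFreq ε` the defect sees `𝓕 h` only at `ξ + ε⁻¹ n` with `n ≠ 0`, and all these
points lie outside `lowFreq ε`. Cauchy–Schwarz over the fundamental domain leaves the high-frequency
norm of `h` alone. -/
lemma enorm_integral_inner_fluxDefect_le (hW : IsWeight S T b) (hP : IsBlochFamily S P)
    (hε : 0 < ε) {h : R3 → C3} (hc : Continuous h) (hs : HasCompactSupport h) {w : L2C3}
    (hw : ∀ᵐ ξ, ξ ∉ lowFreq ε → w ξ = 0) :
    ‖∫ x, inner ℂ (h x) (fluxDefect hW hP hε w x)‖ₑ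
      ≤ ENNReal.ofReal (b ^ 2) * eLpNorm w 2 volume
        * eLpNorm (𝓕 h) 2 (volume.restrict (lowFreq ε)ᶜ) := by
  have hcont := continuous_fourier_of_integrable (integrable_of_test hc hs)
  -- Cutting off the low frequencies removes exactly the term `n = 0` from the sum over the coset of
  -- a low frequency.
  let g : R3 → ℝ≥0∞ := (lowFreq ε)ᶜ.indicator fun ξ => ‖𝓕 h ξ‖ₑ ^ 2
  have hg : Measurable g :=
    (hcont.measurable.enorm.pow_const 2).indicator (measurableSet_lowFreq ε).compl
  let G : R3 → ℝ≥0∞ := fun ξ => ∑' n, g (ξ + ε⁻¹ • latticeVec n)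
  have hG : Measurable G := Measurable.tsum fun n =>
    hg.comp (measurable_add_const (ε⁻¹ • latticeVec n))
  have hGi : ∫⁻ ξ in lowFreq ε, G ξ = eLpNorm (𝓕 h) 2 (volume.restrict (lowFreq ε)ᶜ) ^ 2 := by
    rw [eLpNorm_two_sq, ← lintegral_eq_tsum_lowFreq hg hε.ne',
      lintegral_indicator (measurableSet_lowFreq ε).compl]
  have hpt : ∀ᵐ ξ, ‖inner ℂ (blochT P ε (weight S ε h) ξ) (w ξ)
        - inner ℂ (𝓕 h ξ) (act (effMatrix S P (ε • (2 * Real.pi) • ξ)) (w ξ))‖ₑ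
      ≤ (lowFreq ε).indicator (fun ξ => ENNReal.ofReal (b ^ 2) *
          (‖w ξ‖ₑ * G ξ ^ (1 / 2 : ℝ))) ξ := by
    filter_upwards [hw] with ξ hξ
    have h1 := hP.flux_pairing_sub_le hW hc hs hε ξ (w ξ)
    by_cases hlow : ξ ∈ lowFreq ε
    · rw [Set.indicator_of_mem hlow]
      have h2 : ∑' n : Fin 3 → ℤ, (if n = 0 then 0 else ‖𝓕 h (ξ + ε⁻¹ • latticeVec n)‖ₑ ^ 2)
          = G ξ := by
        refine tsum_congr fun n => ?_
        split_ifs with hn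
        · rw [hn, latticeVec_zero, smul_zero, add_zero]
          exact (Set.indicator_of_notMem (s := (lowFreq ε)ᶜ) (not_not.2 hlow) _).symm
        · exact (Set.indicator_of_mem (s := (lowFreq ε)ᶜ)
            (add_notMem_lowFreq hε.ne' hlow hn) fun ξ => ‖𝓕 h ξ‖ₑ ^ 2).symm
      rw [h2] at h1
      refine (ENNReal.pow_le_pow_left_iff two_ne_zero).1 (h1.trans (le_of_eq ?_))
      rw [mul_pow, mul_pow, ← ENNReal.ofReal_pow (by positivity), ← pow_mul,
        ← ENNReal.rpow_natCast (G ξ ^ (1 / 2 : ℝ)), ← ENNReal.rpow_mul, mul_assoc]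
      norm_num
    · rw [hξ hlow, act_zero, inner_zero_right, inner_zero_right, sub_zero, enorm_zero]
      exact zero_le
  rw [integral_inner_fluxDefect hW hP hε hc hs]
  calc _ ≤ _ := enorm_integral_le_lintegral_enorm _
    _ ≤ ∫⁻ ξ in lowFreq ε, ENNReal.ofReal (b ^ 2) * (‖w ξ‖ₑ * G ξ ^ (1 / 2 : ℝ)) := by
        rw [← lintegral_indicator (measurableSet_lowFreq ε)]
        exact lintegral_mono_ae hpt
    _ = ENNReal.ofReal (b ^ 2) * ∫⁻ ξ in lowFreq ε, ‖w ξ‖ₑ * G ξ ^ (1 / 2 : ℝ) :=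
        lintegral_const_mul' _ _ ENNReal.ofReal_ne_top
    _ ≤ ENNReal.ofReal (b ^ 2) * ((∫⁻ ξ in lowFreq ε, ‖w ξ‖ₑ ^ (2 : ℝ)) ^ (1 / 2 : ℝ)
          * (∫⁻ ξ in lowFreq ε, (G ξ ^ (1 / 2 : ℝ)) ^ (2 : ℝ)) ^ (1 / 2 : ℝ)) := by
        gcongr
        exact ENNReal.lintegral_mul_le_Lp_mul_Lq _ Real.HolderConjugate.two_two
          (Lp.stronglyMeasurable w).measurable.enorm.aemeasurable (hG.pow_const _).aemeasurable
    _ ≤ _ := by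
        rw [mul_assoc]
        gcongr
        · have : eLpNorm w 2 volume = (∫⁻ ξ, ‖w ξ‖ₑ ^ (2 : ℝ)) ^ (1 / 2 : ℝ) := by
            rw [eLpNorm_eq_lintegral_rpow_enorm_toReal (by norm_num) (by norm_num)]
            simp
          rw [this]
          gcongr
          exact Measure.restrict_le_self
        · have h1 : ∀ ξ, (G ξ ^ (1 / 2 : ℝ)) ^ (2 : ℝ) = G ξ := fun ξ => by
            rw [← ENNReal.rpow_mul]; norm_num
          simp only [h1]
          rw [hGi, ← ENNReal.rpow_natCast, ← ENNReal.rpow_mul]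
          norm_num

/-- Both sides are continuous in `f` on `L²`, so density of the test fields suffices. -/
lemma norm_inner_fluxDefect_le (hW : IsWeight S T b) (hP : IsBlochFamily S P)
    (hε : 0 < ε) {w : L2C3} (hw : ∀ᵐ ξ, ξ ∉ lowFreq ε → w ξ = 0) (f : L2C3) :
    ‖inner ℂ f (fluxDefect hW hP hε w)‖ ≤ b ^ 2 * ‖w‖
      * ‖LpToLpRestrictCLM R3 C3 ℂ volume 2 (lowFreq ε)ᶜ (𝓕 f)‖ := by
  have hcF : Continuous fun f : L2C3 => (𝓕 f : L2C3) := FourierTransform.continuous_fourier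
  refine isClosed_property (p := fun f : L2C3 => ‖inner ℂ f (fluxDefect hW hP hε w)‖
    ≤ b ^ 2 * ‖w‖ * ‖LpToLpRestrictCLM R3 C3 ℂ volume 2 (lowFreq ε)ᶜ (𝓕 f)‖)
    denseRange_testToLp (isClosed_le ?_ ?_) (fun h => ?_) f
  · exact (continuous_id.inner continuous_const).norm
  · exact continuous_const.mul (((LpToLpRestrictCLM R3 C3 ℂ volume 2 _).continuous.comp hcF).norm)
  · have h1 := enorm_integral_inner_fluxDefect_le hW hP hε h.2.1 h.2.2 hw
    rw [← inner_testToLp] at h1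
    have hF : eLpNorm (𝓕 (h : R3 → C3)) 2 (volume.restrict (lowFreq ε)ᶜ)
        = ‖LpToLpRestrictCLM R3 C3 ℂ volume 2 (lowFreq ε)ᶜ (𝓕 (testToLp h))‖ₑ := by
      rw [Lp.enorm_def]
      refine eLpNorm_congr_ae ?_
      refine EventuallyEq.trans ?_ (LpToLpRestrictCLM_coeFn ℂ _ _).symm
      exact ae_restrict_of_ae
        (fourier_toLp_ae (integrable_of_test h.2.1 h.2.2) (testSpace_memLp h)).symm
    rw [hF, ← Lp.enorm_def, ← ofReal_norm, ← ofReal_norm, ← ofReal_norm,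
      ← ENNReal.ofReal_mul (by positivity), ← ENNReal.ofReal_mul (by positivity)] at h1
    exact (ENNReal.ofReal_le_ofReal_iff (by positivity)).1 h1

/-- The flux defect of a low frequency field contains high frequencies only. -/
lemma fourier_fluxDefect_eq_zero (hW : IsWeight S T b) (hP : IsBlochFamily S P)
    (hε : 0 < ε) {w : L2C3} (hw : ∀ᵐ ξ, ξ ∉ lowFreq ε → w ξ = 0) :
    ∀ᵐ ξ, ξ ∈ lowFreq ε → (𝓕 (fluxDefect hW hP hε w) : L2C3) ξ = 0 := by
  set R : L2C3 := 𝓕 (fluxDefect hW hP hε w) with hR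
  have hm : MemLp ((lowFreq ε).indicator R) 2 volume :=
    (Lp.memLp R).indicator (measurableSet_lowFreq ε)
  -- The defect is tested with its own low-frequency part, which has no high-frequency norm; that
  -- part must vanish.
  have h1 := norm_inner_fluxDefect_le hW hP hε hw (𝓕⁻ (hm.toLp _) : L2C3)
  rw [← Lp.inner_fourier_eq, FourierTransform.fourier_fourierInv_eq, ← hR] at h1
  have h2 : LpToLpRestrictCLM R3 C3 ℂ volume 2 (lowFreq ε)ᶜ (hm.toLp _) = 0 := by
    refine Lp.ext ?_
    refine (LpToLpRestrictCLM_coeFn ℂ _ _).trans ?_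
    filter_upwards [ae_restrict_mem (measurableSet_lowFreq ε).compl,
      ae_restrict_of_ae hm.coeFn_toLp, Lp.coeFn_zero C3 2 (volume.restrict (lowFreq ε)ᶜ)]
      with ξ hξ h1 h2
    rw [h1, h2, Set.indicator_of_notMem hξ]
    rfl
  rw [h2, norm_zero, mul_zero] at h1
  have h3 : inner ℂ (hm.toLp _) R = inner ℂ (hm.toLp _) (hm.toLp _) := by
    rw [L2.inner_def, L2.inner_def]
    refine integral_congr_ae ?_
    filter_upwards [hm.coeFn_toLp] with ξ hξ
    rw [hξ]
    by_cases hlow : ξ ∈ lowFreq ε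
    · rw [Set.indicator_of_mem hlow]
    · rw [Set.indicator_of_notMem hlow, inner_zero_left, inner_zero_left]
  rw [h3] at h1
  have h4 : hm.toLp _ = 0 := inner_self_eq_zero.1 (norm_le_zero_iff.1 h1)
  have h5 := hm.coeFn_toLp
  rw [h4] at h5
  filter_upwards [h5, Lp.coeFn_zero C3 2 (volume : Measure R3)] with ξ hξ h0 hlow
  rw [Set.indicator_of_mem hlow, h0] at hξ
  exact hξ.symm

lemma norm_ge_of_notMem_lowFreq (hε : 0 < ε) {ξ : R3} (h : ξ ∉ lowFreq ε) : 1 / 2 ≤ ε * ‖ξ‖ := by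
  by_contra! hlt
  refine h fun i => ?_
  have h1 : |ε * ξ i| < 1 / 2 := by
    rw [abs_mul, abs_of_pos hε]
    exact (mul_le_mul_of_nonneg_left (PiLp.norm_apply_le ξ i) hε.le).trans_lt hlt
  have h2 := abs_lt.1 h1
  simp only [PiLp.add_apply, PiLp.smul_apply, smul_eq_mul]
  constructor <;> linarith

end

end

end MaxwellHom

/-! ### Coercivity and decay of the homogenised Maxwell symbol. -/

namespace MaxwellHom

noncomputable section

/-! ### The homogenised symbol -/

lemma act_crossMatrix_sq (θ : R3) (v : C3) :
    act (crossMatrix θ * crossMatrix θ) v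
      = ((‖θ‖ ^ 2 : ℝ) : ℂ) • v - inner ℂ (cplx θ) v • cplx θ := by
  have h : ((‖θ‖ ^ 2 : ℝ) : ℂ) = (θ 0 : ℂ) ^ 2 + (θ 1 : ℂ) ^ 2 + (θ 2 : ℂ) ^ 2 := by
    rw [EuclideanSpace.norm_sq_eq, Fin.sum_univ_three]
    simp only [Real.norm_eq_abs, sq_abs]
    push_cast
    ring
  have hi : inner ℂ (cplx θ) v = (θ 0 : ℂ) * v 0 + (θ 1 : ℂ) * v 1 + (θ 2 : ℂ) * v 2 := by
    rw [inner_C3, Fin.sum_univ_three]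
    simp [cplx_apply]
  rw [h, hi, act_mul]
  have hI := Complex.I_sq
  ext i
  simp only [PiLp.sub_apply, PiLp.smul_apply, smul_eq_mul, act_apply, Fin.sum_univ_three, cplx_apply]
  fin_cases i <;> simp [crossMatrix] <;> ring_nf <;> rw [hI] <;> ring

lemma norm_act_crossMatrix {θ : R3} {v : C3} (h : inner ℂ (cplx θ) v = 0) :
    ‖act (crossMatrix θ) v‖ = ‖θ‖ * ‖v‖ := by
  have h1 : inner ℂ (act (crossMatrix θ) v) (act (crossMatrix θ) v)
      = ((‖θ‖ ^ 2 : ℝ) : ℂ) * inner ℂ v v := by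
    rw [inner_act_crossMatrix, ← act_mul, act_crossMatrix_sq, h, zero_smul, sub_zero,
      inner_smul_right]
  rw [inner_self_eq_norm_sq_to_K, inner_self_eq_norm_sq_to_K] at h1
  have h2 : ‖act (crossMatrix θ) v‖ ^ 2 = (‖θ‖ * ‖v‖) ^ 2 := by
    rw [mul_pow]
    apply Complex.ofReal_injective
    rw [Complex.ofReal_pow] at h1
    push_cast
    exact h1
  exact (sq_eq_sq₀ (norm_nonneg _) (by positivity)).1 h2

/-- Pairing with a transversal vector is controlled by the cross product. -/
lemma norm_mul_norm_inner_le {θ : R3} {u v : C3} (h : inner ℂ (cplx θ) v = 0) :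
    ‖θ‖ * ‖inner ℂ u v‖ ≤ ‖act (crossMatrix θ) u‖ * ‖v‖ := by
  rcases eq_or_ne θ 0 with rfl | hθ
  · rw [norm_zero, zero_mul]
    positivity
  have hpos : 0 < ‖θ‖ := norm_pos_iff.2 hθ
  have h1 : ((‖θ‖ ^ 2 : ℝ) : ℂ) * inner ℂ u v
      = inner ℂ (act (crossMatrix θ) u) (act (crossMatrix θ) v) := by
    rw [inner_act_crossMatrix, ← act_mul, act_crossMatrix_sq, h, zero_smul, sub_zero,
      inner_smul_right]
  have h2 := congrArg norm h1
  rw [norm_mul, Complex.norm_real, norm_pow, norm_norm] at h2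
  have h3 := norm_inner_le_norm (𝕜 := ℂ) (act (crossMatrix θ) u) (act (crossMatrix θ) v)
  rw [← h2, norm_act_crossMatrix h] at h3
  refine le_of_mul_le_mul_left ?_ hpos
  calc ‖θ‖ * (‖θ‖ * ‖inner ℂ u v‖) = ‖θ‖ ^ 2 * ‖inner ℂ u v‖ := by ring
    _ ≤ _ := h3
    _ = _ := by ring

lemma inner_act_crossMatrix_sq (θ : R3) (u : C3) :
    inner ℂ u (act (crossMatrix θ * crossMatrix θ) u)
      = ((‖act (crossMatrix θ) u‖ ^ 2 : ℝ) : ℂ) := by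
  rw [act_mul, ← inner_act_crossMatrix, inner_self_eq_norm_sq_to_K]
  norm_cast

lemma isUnit_det_of_coercive {M : MatC} {b : ℝ}
    (h : ∀ c, ‖c‖ ^ 2 ≤ b ^ 2 * (inner ℂ c (act M c)).re) : IsUnit M.det := by
  rw [← Matrix.isUnit_iff_isUnit_det, ← Matrix.mulVec_injective_iff_isUnit]
  intro u v huv
  have h1 : act M (WithLp.toLp 2 (u - v)) = 0 := by
    rw [act]
    simp only [Matrix.mulVec_sub]
    rw [huv, sub_self]
    rfl
  have h2 := h (WithLp.toLp 2 (u - v))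
  rw [h1, inner_zero_right, Complex.zero_re, mul_zero] at h2
  have h3 : ‖WithLp.toLp 2 (u - v)‖ = 0 := by
    have := norm_nonneg (WithLp.toLp 2 (u - v))
    nlinarith
  have h4 := congrArg WithLp.ofLp (norm_eq_zero.1 h3)
  exact sub_eq_zero.1 h4

section

variable {H : MatC} {b : ℝ}

lemma re_inner_symbol (H : MatC) (θ : R3) (c : C3) :
    (inner ℂ c (act (crossMatrix θ * crossMatrix θ + H) c)).re
      = ‖act (crossMatrix θ) c‖ ^ 2 + (inner ℂ c (act H c)).re := by
  rw [act_add_left, inner_add_right, inner_act_crossMatrix_sq, Complex.add_re, Complex.ofReal_re]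

lemma isUnit_det_symbol (hH : ∀ c, ‖c‖ ^ 2 ≤ b ^ 2 * (inner ℂ c (act H c)).re) (θ : R3)
    : IsUnit (crossMatrix θ * crossMatrix θ + H).det :=
  isUnit_det_of_coercive fun c => (hH c).trans (by
    rw [re_inner_symbol]
    gcongr
    nlinarith [sq_nonneg ‖act (crossMatrix θ) c‖])

lemma act_symbol_inv (hH : ∀ c, ‖c‖ ^ 2 ≤ b ^ 2 * (inner ℂ c (act H c)).re) (θ : R3)
    (v : C3) :
    act (crossMatrix θ * crossMatrix θ + H) (act (crossMatrix θ * crossMatrix θ + H)⁻¹ v) = v := by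
  rw [← act_mul, Matrix.mul_nonsing_inv _ (isUnit_det_symbol hH θ), act_one]

/-- Turns the product in the theorem into the inverse of the coercive matrix `iθ × iθ × + Â`, so
that it can be estimated by its quadratic form. -/
lemma inv_mul_symbol_inv (hH : ∀ c, ‖c‖ ^ 2 ≤ b ^ 2 * (inner ℂ c (act H c)).re) (θ : R3)
    : H⁻¹ * (crossMatrix θ * crossMatrix θ * H⁻¹ + 1)⁻¹
    = (crossMatrix θ * crossMatrix θ + H)⁻¹ := by
  rw [← Matrix.mul_inv_rev, add_mul, one_mul, mul_assoc,
    Matrix.nonsing_inv_mul _ (isUnit_det_of_coercive hH), mul_one]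

lemma norm_sq_symbol_inv_le (hH : ∀ c, ‖c‖ ^ 2 ≤ b ^ 2 * (inner ℂ c (act H c)).re) (θ : R3)
    (v : C3) :
    ‖act (crossMatrix θ) (act (crossMatrix θ * crossMatrix θ + H)⁻¹ v)‖ ^ 2
      + (inner ℂ (act (crossMatrix θ * crossMatrix θ + H)⁻¹ v)
        (act H (act (crossMatrix θ * crossMatrix θ + H)⁻¹ v))).re
      ≤ ‖inner ℂ (act (crossMatrix θ * crossMatrix θ + H)⁻¹ v) v‖ := by
  rw [← re_inner_symbol, act_symbol_inv hH]
  exact Complex.re_le_norm _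

lemma norm_symbol_inv_le (hH : ∀ c, ‖c‖ ^ 2 ≤ b ^ 2 * (inner ℂ c (act H c)).re) (θ : R3)
    (v : C3) :
    ‖act (crossMatrix θ * crossMatrix θ + H)⁻¹ v‖ ≤ b ^ 2 * ‖v‖ := by
  have h1 := norm_sq_symbol_inv_le hH θ v
  set w := act (crossMatrix θ * crossMatrix θ + H)⁻¹ v
  have h2 := hH w
  have h3 := norm_inner_le_norm (𝕜 := ℂ) w v
  rcases eq_or_ne w 0 with h0 | h0
  · rw [h0, norm_zero]
    positivity
  refine le_of_mul_le_mul_left ?_ (norm_pos_iff.2 h0)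
  calc ‖w‖ * ‖w‖ = ‖w‖ ^ 2 := by ring
    _ ≤ _ := h2
    _ ≤ b ^ 2 * (‖w‖ * ‖v‖) := by
        gcongr
        nlinarith [sq_nonneg ‖act (crossMatrix θ) w‖]
    _ = _ := by ring

/-- Uniformity in `θ` of this bound makes the curl of the superposition square integrable for every
datum in `L²`. -/
lemma norm_cross_symbol_inv_le (hH : ∀ c, ‖c‖ ^ 2 ≤ b ^ 2 * (inner ℂ c (act H c)).re) (θ : R3)
    (hb : 0 ≤ b) (v : C3) :
    ‖act (crossMatrix θ) (act (crossMatrix θ * crossMatrix θ + H)⁻¹ v)‖ ≤ b * ‖v‖ := by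
  have h1 := norm_sq_symbol_inv_le hH θ v
  have h4 := norm_symbol_inv_le hH θ v
  set w := act (crossMatrix θ * crossMatrix θ + H)⁻¹ v
  have h2 := hH w
  have h3 := norm_inner_le_norm (𝕜 := ℂ) w v
  have h5 : 0 ≤ (inner ℂ w (act H w)).re := by
    rcases eq_or_ne w 0 with h0 | h0
    · rw [h0, inner_zero_left, Complex.zero_re]
    · have : 0 < ‖w‖ ^ 2 := by positivity
      exact (pos_of_mul_pos_right (this.trans_le h2) (sq_nonneg b)).le
  refine (sq_le_sq₀ (norm_nonneg _) (by positivity)).1 ?_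
  calc _ ≤ ‖w‖ * ‖v‖ := by linarith
    _ ≤ b ^ 2 * ‖v‖ * ‖v‖ := by gcongr
    _ = _ := by ring

/-- For transversal `v` the pairing of the solution `w` with `v` is controlled by `iθ × w`, at the
gain of `1/|θ|`, and the quadratic form controls `iθ × w`. The resulting decay relies on the data
being divergence free. -/
lemma norm_mul_norm_symbol_inv_le (hH : ∀ c, ‖c‖ ^ 2 ≤ b ^ 2 * (inner ℂ c (act H c)).re) (θ : R3)
    (hb : 0 ≤ b) {v : C3} (hv : inner ℂ (cplx θ) v = 0) :
    ‖θ‖ * ‖act (crossMatrix θ * crossMatrix θ + H)⁻¹ v‖ ≤ b * ‖v‖ := by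
  have h1 := norm_sq_symbol_inv_le hH θ v
  set w := act (crossMatrix θ * crossMatrix θ + H)⁻¹ v
  have h2 := hH w
  have h3 := norm_mul_norm_inner_le (u := w) hv
  have hθ := norm_nonneg θ
  set t := ‖act (crossMatrix θ) w‖
  set q := (inner ℂ w (act H w)).re
  set n := ‖inner ℂ w v‖
  refine (sq_le_sq₀ (by positivity) (by positivity)).1 ?_
  -- From `(|θ| t)² + |θ|² q ≤ |θ| t |v|`, by completing the square.
  have h4 : ‖θ‖ ^ 2 * q ≤ ‖v‖ ^ 2 := by
    have h5 : ‖θ‖ ^ 2 * (t ^ 2 + q) ≤ ‖θ‖ * (t * ‖v‖) :=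
      calc _ ≤ ‖θ‖ ^ 2 * n := by gcongr
        _ = ‖θ‖ * (‖θ‖ * n) := by ring
        _ ≤ _ := by gcongr
    nlinarith [sq_nonneg (‖θ‖ * t - ‖v‖), sq_nonneg (‖θ‖ * t), sq_nonneg ‖v‖]
  calc (‖θ‖ * ‖w‖) ^ 2 = ‖θ‖ ^ 2 * ‖w‖ ^ 2 := by ring
    _ ≤ ‖θ‖ ^ 2 * (b ^ 2 * q) := by gcongr
    _ = b ^ 2 * (‖θ‖ ^ 2 * q) := by ring
    _ ≤ b ^ 2 * ‖v‖ ^ 2 := by gcongr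
    _ = _ := by ring

end

lemma measurable_inv_entry {α : Type*} [MeasurableSpace α] {M : α → MatC}
    (hM : ∀ i j, Measurable fun a => M a i j) (i j : Fin 3) :
    Measurable fun a => (M a)⁻¹ i j := by
  have hdet : Measurable fun a => (M a).det := by
    simp only [Matrix.det_fin_three]
    fun_prop
  have hadj : Measurable fun a => (M a).adjugate i j := by
    simp only [Matrix.adjugate_fin_three]
    fin_cases i <;> fin_cases j <;> simp <;> fun_prop
  simp only [Matrix.inv_def, Matrix.smul_apply, smul_eq_mul, Ring.inverse_eq_inv']
  exact hdet.inv.mul hadj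

lemma measurable_crossMatrix (i j : Fin 3) : Measurable fun θ : R3 => crossMatrix θ i j := by
  have h : ∀ k, Measurable fun θ : R3 => (θ k : ℂ) := fun k =>
    Complex.measurable_ofReal.comp (EuclideanSpace.proj (𝕜 := ℝ) k).measurable
  fin_cases i <;> fin_cases j <;> simp [crossMatrix] <;> fun_prop

lemma measurable_symbol {H : R3 → MatC} (hH : ∀ i j, Measurable fun ξ => H ξ i j) (r : ℝ)
    (i j : Fin 3) :
    Measurable fun ξ : R3 => (crossMatrix (r • ξ) * crossMatrix (r • ξ) + H ξ) i j := by
  have h : ∀ i j, Measurable fun ξ : R3 => crossMatrix (r • ξ) i j := fun i j =>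
    (measurable_crossMatrix i j).comp (measurable_const_smul r)
  simp only [Matrix.add_apply, Matrix.mul_apply]
  exact (Finset.measurable_fun_sum _ fun k _ => (h i k).mul (h k j)).add (hH i j)

end

end MaxwellHom

/-! ### The energy estimate. -/

namespace MaxwellHom

noncomputable section

open FourierTransform

/-! ### The energy estimate -/

/-- Cauchy–Schwarz for the scalar functions of norms, embedded into the first component so that the
vector-valued inequality applies. -/
lemma integral_norm_mul_norm_le (f g : L2C3) : ∫ ξ, ‖f ξ‖ * ‖g ξ‖ ≤ ‖f‖ * ‖g‖ := by
  have he : ∀ f : L2C3, MemLp (fun ξ => (EuclideanSpace.single 0 (‖f ξ‖ : ℂ) : C3)) 2 volume :=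
    fun f => by
      refine (Lp.memLp f).of_le ?_ (ae_of_all _ fun ξ => by simp)
      refine aestronglyMeasurable_C3 fun i => ?_
      have h1 : AEStronglyMeasurable (fun ξ => (‖f ξ‖ : ℂ)) volume :=
        Complex.continuous_ofReal.comp_aestronglyMeasurable (Lp.aestronglyMeasurable f).norm
      by_cases hi : i = 0
      · subst hi
        simpa using h1
      · simpa [hi] using aestronglyMeasurable_const
  have h := norm_integral_inner_sq_le (he f) (he g)
  have h1 : ∀ ξ, inner ℂ (EuclideanSpace.single 0 (‖f ξ‖ : ℂ) : C3)
      (EuclideanSpace.single 0 (‖g ξ‖ : ℂ)) = ((‖f ξ‖ * ‖g ξ‖ : ℝ) : ℂ) := fun ξ => by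
    rw [EuclideanSpace.inner_single_left]
    simp
  have h2 : ∀ f : L2C3, ∫ ξ, ‖(EuclideanSpace.single 0 (‖f ξ‖ : ℂ) : C3)‖ ^ 2 = ‖f‖ ^ 2 :=
    fun f => by
      have := norm_toLp_sq (Lp.memLp f)
      rw [Lp.toLp_coeFn] at this
      rw [this]
      simp
  simp only [h1, h2] at h
  rw [integral_complex_ofReal, Complex.norm_real, ← mul_pow] at h
  exact (le_abs_self _).trans ((sq_le_sq₀ (norm_nonneg _) (by positivity)).1 h)

section

variable {S T : R3 → MatC} {b : ℝ} {P : R3 → Fin 3 → R3 → C3} {ε : ℝ}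

/-- The matrix `(iθ × iθ × + Â)⁻¹` at `θ = 2πξ`. -/
def symbInv (S : R3 → MatC) (P : R3 → Fin 3 → R3 → C3) (ε : ℝ) (ξ : R3) : MatC :=
  (crossMatrix ((2 * Real.pi) • ξ) * crossMatrix ((2 * Real.pi) • ξ)
    + effMatrix S P (ε • (2 * Real.pi) • ξ))⁻¹

lemma measurable_symbInv (hW : IsWeight S T b) (hP : IsBlochFamily S P) (ε : ℝ) (i j : Fin 3) :
    Measurable fun ξ => symbInv S P ε ξ i j :=
  measurable_inv_entry (measurable_symbol (hP.measurable_effMatrix_scale hW ε) _) i j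

/-- The density of the superposition, in terms of the Fourier transform of the datum. -/
def density (hW : IsWeight S T b) (hP : IsBlochFamily S P) (ε : ℝ) : L2C3 →L[ℂ] L2C3 :=
  mulLp volume (measurable_symbInv hW hP ε)
    (fun ξ v => norm_symbol_inv_le (hP.norm_sq_le_inner hW _) ((2 * Real.pi) • ξ) v)

lemma coeFn_density (hW : IsWeight S T b) (hP : IsBlochFamily S P) (ε : ℝ) (f : L2C3) :
    density hW hP ε f =ᵐ[volume] fun ξ => act (symbInv S P ε ξ) (f ξ) :=
  coeFn_mulLp _ _ _

lemma norm_density_le (hW : IsWeight S T b) (hP : IsBlochFamily S P) (ε : ℝ) (f : L2C3) :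
    ‖density hW hP ε f‖ ≤ b ^ 2 * ‖f‖ :=
  norm_mulLp_le _ (by positivity) _ _

lemma exists_cross_density (hW : IsWeight S T b) (hP : IsBlochFamily S P) (ε : ℝ) (f : L2C3) :
    ∃ V : L2C3, ∀ᵐ ξ, V ξ = act (crossMatrix ((2 * Real.pi) • ξ)) (density hW hP ε f ξ) := by
  have hm : MemLp (fun ξ => act (crossMatrix ((2 * Real.pi) • ξ)) (density hW hP ε f ξ)) 2
      volume := by
    refine (Lp.memLp f).of_le_mul (c := b) ?_ ?_
    · exact aestronglyMeasurable_act (fun i j => ((measurable_crossMatrix i j).comp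
        (measurable_const_smul (2 * Real.pi))).aestronglyMeasurable) (Lp.aestronglyMeasurable _)
    · filter_upwards [coeFn_density hW hP ε f] with ξ hξ
      rw [hξ]
      exact norm_cross_symbol_inv_le (hP.norm_sq_le_inner hW _) _ hW.b_pos.le _
  exact ⟨hm.toLp _, hm.coeFn_toLp⟩

/-- The splitting of the density into low and high frequencies. -/
lemma exists_split_density (hW : IsWeight S T b) (hP : IsBlochFamily S P) (hε : 0 < ε) {f : L2C3}
    (hf : ∀ᵐ ξ, inner ℂ (cplx ξ) (f ξ) = 0) :
    ∃ w₁ w₂ : L2C3, density hW hP ε f = w₁ + w₂ ∧ (∀ᵐ ξ, ξ ∉ lowFreq ε → w₁ ξ = 0) ∧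
      ‖w₁‖ ≤ b ^ 2 * ‖f‖ ∧ ‖w₂‖ ≤ b * ε * ‖f‖ := by
  set w := density hW hP ε f with hw
  have m1 := (Lp.memLp w).indicator (measurableSet_lowFreq ε)
  have m2 := (Lp.memLp w).indicator (measurableSet_lowFreq ε).compl
  refine ⟨m1.toLp _, m2.toLp _, ?_, ?_, ?_, ?_⟩
  · rw [← MemLp.toLp_add]
    conv_lhs => rw [← Lp.toLp_coeFn w (Lp.memLp w)]
    exact MemLp.toLp_congr _ _ (ae_of_all _ fun ξ =>
      (congrFun (Set.indicator_self_add_compl (lowFreq ε) w) ξ).symm)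
  · filter_upwards [m1.coeFn_toLp] with ξ hξ hlow
    rw [hξ, Set.indicator_of_notMem hlow]
  · refine le_trans (Lp.norm_le_norm_of_ae_le ?_) (norm_density_le hW hP ε f)
    filter_upwards [m1.coeFn_toLp] with ξ hξ
    rw [hξ]
    exact norm_indicator_le_norm_self _ _
  · refine Lp.norm_le_mul_norm_of_ae_le_mul ?_
    filter_upwards [m2.coeFn_toLp, coeFn_density hW hP ε f, hf] with ξ hξ h1 h2
    rw [hξ]
    have hb := hW.b_pos
    by_cases hlow : ξ ∈ lowFreq ε
    · rw [Set.indicator_of_notMem (not_not.2 hlow), norm_zero]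
      positivity
    · rw [Set.indicator_of_mem (show ξ ∈ (lowFreq ε)ᶜ from hlow), hw, h1]
      have h3 : inner ℂ (cplx ((2 * Real.pi) • ξ)) (f ξ) = 0 := by
        rw [cplx_smul, inner_smul_left, h2, mul_zero]
      have h4 := norm_mul_norm_symbol_inv_le (hP.norm_sq_le_inner hW (ε • (2 * Real.pi) • ξ))
        ((2 * Real.pi) • ξ) hb.le h3
      have h5 := norm_ge_of_notMem_lowFreq hε hlow
      rw [norm_smul, Real.norm_of_nonneg (by positivity)] at h4
      -- Outside `lowFreq ε` one has `ε |ξ| ≥ 1/2`, hence `ε |θ| ≥ π ≥ 1` for `θ = 2πξ`.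
      have h6 : 1 ≤ ε * (2 * Real.pi * ‖ξ‖) := by
        nlinarith [Real.pi_gt_three]
      calc ‖act (symbInv S P ε ξ) (f ξ)‖
          ≤ ε * (2 * Real.pi * ‖ξ‖) * ‖act (symbInv S P ε ξ) (f ξ)‖ :=
            le_mul_of_one_le_left (norm_nonneg _) h6
        _ = ε * (2 * Real.pi * ‖ξ‖ * ‖act (symbInv S P ε ξ) (f ξ)‖) := by ring
        _ ≤ ε * (b * ‖f ξ‖) := mul_le_mul_of_nonneg_left h4 hε.le
        _ = _ := by ring

/-- The pairing with a transversal field of high frequencies. -/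
lemma norm_inner_le_of_highFreq (hε : 0 < ε) {Z V R : L2C3}
    (hV : ∀ᵐ ξ, act (crossMatrix ((2 * Real.pi) • ξ)) ((𝓕 Z : L2C3) ξ) = (𝓕 V : L2C3) ξ)
    (hR : ∀ᵐ ξ, inner ℂ (cplx ξ) ((𝓕 R : L2C3) ξ) = 0)
    (hlow : ∀ᵐ ξ, ξ ∈ lowFreq ε → (𝓕 R : L2C3) ξ = 0) :
    ‖inner ℂ Z R‖ ≤ ε * (‖V‖ * ‖R‖) := by
  rw [← Lp.inner_fourier_eq, ← Lp.norm_fourier_eq V, ← Lp.norm_fourier_eq R, L2.inner_def]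
  calc _ ≤ ∫ ξ, ε * (‖(𝓕 V : L2C3) ξ‖ * ‖(𝓕 R : L2C3) ξ‖) := by
        refine norm_integral_le_of_norm_le ?_ ?_
        · exact ((Lp.memLp (𝓕 V : L2C3)).norm.integrable_mul
            (Lp.memLp (𝓕 R : L2C3)).norm).const_mul ε
        · filter_upwards [hV, hR, hlow] with ξ h1 h2 h3
          by_cases hξ : ξ ∈ lowFreq ε
          · rw [h3 hξ, inner_zero_right, norm_zero, norm_zero, mul_zero, mul_zero]
          · have h4 : inner ℂ (cplx ((2 * Real.pi) • ξ)) ((𝓕 R : L2C3) ξ) = 0 := by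
              rw [cplx_smul, inner_smul_left, h2, mul_zero]
            -- Pairing with a transversal vector costs only the curl of `Z`, with the gain `1/|θ| ≤
            -- ε`.
            have h5 := norm_mul_norm_inner_le (u := (𝓕 Z : L2C3) ξ) h4
            rw [h1, norm_smul, Real.norm_of_nonneg (by positivity)] at h5
            have h6 := norm_ge_of_notMem_lowFreq hε hξ
            have h7 : 1 ≤ ε * (2 * Real.pi * ‖ξ‖) := by
              nlinarith [Real.pi_gt_three]
            calc _ ≤ ε * (2 * Real.pi * ‖ξ‖) * ‖inner ℂ ((𝓕 Z : L2C3) ξ) ((𝓕 R : L2C3) ξ)‖ :=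
                  le_mul_of_one_le_left (norm_nonneg _) h7
              _ = ε * (2 * Real.pi * ‖ξ‖ * ‖inner ℂ ((𝓕 Z : L2C3) ξ) ((𝓕 R : L2C3) ξ)‖) := by
                  ring
              _ ≤ _ := by gcongr
    _ = ε * ∫ ξ, ‖(𝓕 V : L2C3) ξ‖ * ‖(𝓕 R : L2C3) ξ‖ := integral_const_mul _ _
    _ ≤ _ := by gcongr; exact integral_norm_mul_norm_le _ _

/-- With `t = b³ K ε G` the energy inequality times `b²` becomes `z² + (b s)² ≤ t z + t (b s)`. The
quadratic in `b s` absorbs its linear term at the cost `t²/4`, and `z > 2t` is then impossible. -/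
lemma le_of_energy_le {b K ε G z s m : ℝ} (hb : 0 ≤ b) (hK : 0 ≤ K) (hε : 0 ≤ ε) (hG : 0 ≤ G)
    (hz : 0 ≤ z) (h : s ^ 2 + m ^ 2 ≤ ε * (s * (K * (b ^ 2 * G))) + z * (K * (b * ε * G)))
    (hzm : z ≤ b * m) : z ≤ 2 * (b ^ 3 * K * ε * G) := by
  have ht0 : 0 ≤ b ^ 3 * K * ε * G := by positivity
  have hz2 : z ^ 2 ≤ b ^ 2 * m ^ 2 := by
    rw [← mul_pow]
    gcongr
  have fin : z ^ 2 + (b * s) ^ 2 ≤ (b ^ 3 * K * ε * G) * z + (b ^ 3 * K * ε * G) * (b * s) := by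
    calc z ^ 2 + (b * s) ^ 2 ≤ b ^ 2 * m ^ 2 + (b * s) ^ 2 := by gcongr
      _ = b ^ 2 * (s ^ 2 + m ^ 2) := by ring
      _ ≤ b ^ 2 * (ε * (s * (K * (b ^ 2 * G))) + z * (K * (b * ε * G))) := by gcongr
      _ = _ := by ring
  generalize b ^ 3 * K * ε * G = t at ht0 fin
  by_contra! hlt
  have h1 : 0 < (z - 2 * t) * z := mul_pos (by linarith) (by linarith)
  nlinarith [sq_nonneg (b * s - t / 2), mul_nonneg ht0 (sub_nonneg.2 hlt.le)]

/-- The constant of the energy estimate. -/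
def energyConst (b : ℝ) : ℝ := 2 * b ^ 3 * (b ^ 2 * blochBound b + b ^ 2)

lemma energyConst_pos (hb : 0 < b) : 0 < energyConst b := by
  have := blochBound_nonneg b
  rw [energyConst]
  positivity

/-- The density solves `(iθ × iθ × + Â) w = ĝ`, so the second curl of the superposition is `g` minus
the homogenised flux. -/
lemma integral_curl_fourierInv (hW : IsWeight S T b) (hP : IsBlochFamily S P) (ε : ℝ)
    {g V : L2C3} (hV : ∀ᵐ ξ, V ξ
      = act (crossMatrix ((2 * Real.pi) • ξ)) (density hW hP ε (𝓕 g) ξ)) {Φ : R3 → C3}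
    (hΦ : ContDiff ℝ ∞ Φ) (hΦs : HasCompactSupport Φ) :
    ∫ x, inner ℂ (curl Φ x) ((𝓕⁻ V : L2C3) x) = ∫ x, inner ℂ (Φ x)
      ((g - 𝓕⁻ (effL hW hP ε (density hW hP ε (𝓕 g))) : L2C3) x) := by
  rw [integral_inner_fourier (integrable_of_test (continuous_curl hΦ) (hasCompactSupport_curl hΦs))
      (memLp_of_test (continuous_curl hΦ) (hasCompactSupport_curl hΦs) 2),
    integral_inner_fourier (integrable_of_test hΦ.continuous hΦs)
      (memLp_of_test hΦ.continuous hΦs 2), FourierTransform.fourier_fourierInv_eq,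
    sub_eq_add_neg, FourierTransform.fourier_add, FourierTransform.fourier_neg,
    FourierTransform.fourier_fourierInv_eq, ← sub_eq_add_neg]
  refine integral_congr_ae ?_
  filter_upwards [hV, coeFn_density hW hP ε (𝓕 g), coeFn_effL hW hP ε (density hW hP ε (𝓕 g)),
    Lp.coeFn_sub (𝓕 g : L2C3) (effL hW hP ε (density hW hP ε (𝓕 g)))] with ξ h1 h2 h3 h4
  have h5 := act_symbol_inv (hP.norm_sq_le_inner hW (ε • (2 * Real.pi) • ξ))
    ((2 * Real.pi) • ξ) ((𝓕 g : L2C3) ξ)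
  change act _ (act (symbInv S P ε ξ) _) = _ at h5
  rw [← h2, act_add_left, act_mul] at h5
  rw [h4, Pi.sub_apply, h3, h1, fourier_curl hΦ hΦs, inner_act_crossMatrix]
  conv_rhs => rw [← h5, add_sub_cancel_right]

/-- The energy estimate for the discrepancy between the solution and the superposition of
corrected plane waves. -/
theorem norm_add_synth_le (hW : IsWeight S T b) (hP : IsBlochFamily S P) (hε : 0 < ε)
    {g B v : L2C3} (hg : ∀ φ : R3 → ℂ, ContDiff ℝ ∞ φ → HasCompactSupport φ →
      ∫ x, inner ℂ (grad φ x) (g x) = 0)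
    (hB : ∀ Φ : R3 → C3, ContDiff ℝ ∞ Φ → HasCompactSupport Φ →
      ∫ x, inner ℂ (curl Φ x) (B x) = ∫ x, inner ℂ (Φ x) (v x))
    (hv : ∀ Φ : R3 → C3, ContDiff ℝ ∞ Φ → HasCompactSupport Φ →
      (∫ x, inner ℂ (curl Φ x) (v x)) + ∫ x, inner ℂ (Φ x) (mulS hW ε (mulS hW ε B) x)
        = -∫ x, inner ℂ (Φ x) (g x)) :
    ‖B + synth hW hP hε (density hW hP ε (𝓕 g))‖ ≤ energyConst b * ε * ‖g‖ := by
  have hb := hW.b_pos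
  have hgF := inner_cplx_fourier_eq_zero hg
  obtain ⟨V, hV⟩ := exists_cross_density hW hP ε (𝓕 g)
  obtain ⟨w₁, w₂, hw, hw₁, hn₁, hn₂⟩ := exists_split_density hW hP hε hgF
  set w := density hW hP ε (𝓕 g) with hwdef
  set U := synth hW hP hε w with hU
  set R := fluxDefect hW hP hε w with hR
  set Z := B + U with hZ
  set vZ := v + 𝓕⁻ V with hvZ
  have pair : ∀ {h : R3 → C3} (hc : Continuous h) (hs : HasCompactSupport h) (f : L2C3),
      ∫ x, inner ℂ (h x) (f x) = inner ℂ (testToLp ⟨h, hc, hs⟩) f := fun hc hs f =>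
    (inner_testToLp ⟨_, hc, hs⟩ f).symm
  have weak1 : ∀ᵐ ξ, act (crossMatrix ((2 * Real.pi) • ξ)) ((𝓕 Z : L2C3) ξ)
      = (𝓕 vZ : L2C3) ξ := act_crossMatrix_fourier_eq fun Φ hΦ hΦs => by
    have e1 := hB Φ hΦ hΦs
    have e2 := integral_curl_synth hW hP hε hV hΦ hΦs
    rw [pair (continuous_curl hΦ) (hasCompactSupport_curl hΦs), pair hΦ.continuous hΦs] at e1 e2 ⊢
    rw [hZ, hvZ, inner_add_right, inner_add_right, e1, e2]
  -- The sum of the exact equation for `B` and the equation of `U`: the data `∓g` cancel and only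
  -- the defect remains.
  have weak2 : ∀ᵐ ξ, act (crossMatrix ((2 * Real.pi) • ξ)) ((𝓕 vZ : L2C3) ξ)
      = (𝓕 (R - mulS hW ε (mulS hW ε Z)) : L2C3) ξ :=
    act_crossMatrix_fourier_eq fun Φ hΦ hΦs => by
      have e1 := hv Φ hΦ hΦs
      have hc := continuous_curl hΦ
      have hs := hasCompactSupport_curl hΦs
      have e2 := integral_curl_fourierInv hW hP ε hV hΦ hΦs
      rw [pair hc hs, pair hΦ.continuous hΦs] at e2
      rw [pair hc hs, pair hΦ.continuous hΦs, pair hΦ.continuous hΦs] at e1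
      rw [pair hc hs, pair hΦ.continuous hΦs, hvZ, inner_add_right, e2, hR, fluxDefect, ← hU, hZ,
        map_add, map_add, ← hwdef]
      simp only [inner_sub_right, inner_add_right]
      linear_combination e1
  -- Testing with `Z` itself is done in frequency space, where both weak equations hold pointwise
  -- and the cross matrix is Hermitian; no approximation of `Z` by test fields is needed.
  have energy : ((‖vZ‖ ^ 2 : ℝ) : ℂ) + ((‖mulS hW ε Z‖ ^ 2 : ℝ) : ℂ) = inner ℂ Z R := by
    have e1 : inner ℂ (𝓕 vZ : L2C3) (𝓕 vZ : L2C3)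
        = inner ℂ (𝓕 Z : L2C3) (𝓕 (R - mulS hW ε (mulS hW ε Z)) : L2C3) := by
      rw [L2.inner_def, L2.inner_def]
      refine integral_congr_ae ?_
      filter_upwards [weak1, weak2] with ξ h1 h2
      rw [← h2, ← inner_act_crossMatrix, h1]
    rw [Lp.inner_fourier_eq, Lp.inner_fourier_eq, inner_sub_right, ← inner_mulS,
      inner_self_eq_norm_sq_to_K, inner_self_eq_norm_sq_to_K] at e1
    rw [Complex.ofReal_pow, Complex.ofReal_pow]
    exact eq_sub_iff_add_eq.1 e1
  set R₁ := fluxDefect hW hP hε w₁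
  set R₂ := fluxDefect hW hP hε w₂
  have hR12 : R = R₁ + R₂ := by rw [hR, hw, fluxDefect_add]
  set K := b ^ 2 * blochBound b + b ^ 2 with hK
  have hK0 : 0 ≤ K := by
    have := blochBound_nonneg b
    positivity
  have hgn : ‖(𝓕 g : L2C3)‖ = ‖g‖ := Lp.norm_fourier_eq g
  rw [hgn] at hn₁ hn₂
  have b1 : ‖R₁‖ ≤ K * (b ^ 2 * ‖g‖) :=
    (norm_fluxDefect_le hW hP hε w₁).trans (by gcongr)
  have b2 : ‖R₂‖ ≤ K * (b * ε * ‖g‖) :=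
    (norm_fluxDefect_le hW hP hε w₂).trans (by gcongr)
  have p1 : ‖inner ℂ Z R₁‖ ≤ ε * (‖vZ‖ * ‖R₁‖) :=
    norm_inner_le_of_highFreq hε weak1
      (inner_cplx_fourier_eq_zero fun φ hφ hφs => integral_grad_fluxDefect hW hP hε w₁ hφ hφs)
      (fourier_fluxDefect_eq_zero hW hP hε hw₁)
  have p2 := norm_inner_le_norm (𝕜 := ℂ) Z R₂
  have total : ‖vZ‖ ^ 2 + ‖mulS hW ε Z‖ ^ 2
      ≤ ε * (‖vZ‖ * (K * (b ^ 2 * ‖g‖))) + ‖Z‖ * (K * (b * ε * ‖g‖)) := by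
    have h1 : ‖inner ℂ Z R‖ = ‖vZ‖ ^ 2 + ‖mulS hW ε Z‖ ^ 2 := by
      rw [← energy, ← Complex.ofReal_add, Complex.norm_real, Real.norm_of_nonneg (by positivity)]
    rw [← h1, hR12, inner_add_right]
    calc _ ≤ _ := norm_add_le _ _
      _ ≤ ε * (‖vZ‖ * ‖R₁‖) + ‖Z‖ * ‖R₂‖ := add_le_add p1 p2
      _ ≤ _ := by gcongr
  have hZS := norm_le_mulS hW ε Z
  have hc : energyConst b * ε * ‖g‖ = 2 * (b ^ 3 * K * ε * ‖g‖) := by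
    rw [energyConst, hK]
    ring
  rw [hc]
  exact le_of_energy_le hb.le hK0 hε.le (norm_nonneg g) (norm_nonneg Z) total hZS

end

end

end MaxwellHom

/-! ### Identification with the pseudo-differential operator of the theorem. -/

namespace MaxwellHom

noncomputable section

open FourierTransform

/-! ### The Fourier transform of the datum -/

lemma tendsto_eLpNorm_sub_indicator_ball {g : R3 → C3} (hg : MemLp g 2 volume) :
    Tendsto (fun n : ℕ => eLpNorm (fun x => g x - (Metric.ball (0 : R3) n).indicator g x) 2 volume)
      atTop (𝓝 0) := by
  have h1 : Tendsto (fun n : ℕ => ∫⁻ x, ‖g x - (Metric.ball (0 : R3) n).indicator g x‖ₑ ^ 2)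
      atTop (𝓝 (∫⁻ _ : R3, 0)) := by
    refine tendsto_lintegral_of_dominated_convergence' (fun x => ‖g x‖ₑ ^ 2) (fun n => ?_)
      (fun n => ae_of_all _ fun x => ?_) ?_ (ae_of_all _ fun x => ?_)
    · exact (hg.1.sub (hg.1.indicator measurableSet_ball)).enorm.pow_const 2
    · by_cases hx : x ∈ Metric.ball (0 : R3) n
      · simp [Set.indicator_of_mem hx]
      · simp [Set.indicator_of_notMem hx]
    · rw [← eLpNorm_two_sq]
      exact ENNReal.pow_ne_top hg.2.ne
    · obtain ⟨N, hN⟩ := exists_nat_gt ‖x‖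
      refine tendsto_const_nhds.congr' ?_
      filter_upwards [eventually_ge_atTop N] with n hn
      have hx : x ∈ Metric.ball (0 : R3) n := by
        rw [mem_ball_zero_iff]
        exact hN.trans_le (by exact_mod_cast hn)
      simp [Set.indicator_of_mem hx]
  rw [lintegral_zero] at h1
  have h2 := (ENNReal.continuous_rpow_const (y := 1 / 2)).tendsto 0 |>.comp h1
  rw [ENNReal.zero_rpow_of_pos (by norm_num)] at h2
  refine h2.congr fun n => ?_
  rw [Function.comp_apply, ← eLpNorm_two_sq, ← ENNReal.rpow_natCast, ← ENNReal.rpow_mul]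
  norm_num

lemma eLpNorm_comp_smul_le {f : R3 → C3} (hf : AEStronglyMeasurable f volume) {r : ℝ}
    (hr : r ≠ 0) : eLpNorm (fun θ => f (r • θ)) 2 volume
      = ENNReal.ofReal |(r ^ 3)⁻¹| ^ (1 / 2 : ℝ) * eLpNorm f 2 volume := by
  have hfin : Module.finrank ℝ R3 = 3 := by simp
  have hmap := Measure.map_addHaar_smul (volume : Measure R3) hr
  rw [hfin] at hmap
  have h1 := eLpNorm_map_measure (p := 2) (μ := (volume : Measure R3)) (f := fun x : R3 => r • x)
    (g := f) (by rw [hmap]; exact hf.smul_measure _) (measurable_const_smul r).aemeasurable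
  rw [hmap, eLpNorm_smul_measure_of_ne_top (by norm_num)] at h1
  rw [← Function.comp_def f (fun θ => r • θ), ← h1]
  simp

/-- The normalisation factor `(2π)^{-3/2}`. -/
def fourierConst : ℝ := (2 * Real.pi) ^ (-(3 / 2) : ℝ)

lemma fourierConst_sq : fourierConst * fourierConst = ((2 * Real.pi) ^ 3)⁻¹ := by
  rw [fourierConst, ← Real.rpow_add (by positivity), ← Real.rpow_natCast,
    ← Real.rpow_neg (by positivity)]
  norm_num

/-- After the change of variables `θ = 2πξ`, Plancherel's identity bounds the error on every ball by
a constant multiple of the `L²` tail of `g`. -/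
lemma isFourierTransform_fourier {g : R3 → C3} (hg : MemLp g 2 volume) :
    IsFourierTransform volume g
      (fun θ => fourierConst • (𝓕 (hg.toLp g) : L2C3) ((2 * Real.pi)⁻¹ • θ)) := by
  have hr : (2 * Real.pi)⁻¹ ≠ 0 := by positivity
  set G : L2C3 := 𝓕 (hg.toLp g) with hG
  have hqmp : Measure.QuasiMeasurePreserving (fun θ : R3 => (2 * Real.pi)⁻¹ • θ) volume volume := by
    refine ⟨measurable_const_smul _, ?_⟩
    rw [Measure.map_addHaar_smul _ hr]
    exact Measure.smul_absolutelyContinuous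
  refine ⟨((Lp.aestronglyMeasurable G).comp_quasiMeasurePreserving hqmp).const_smul fourierConst,
    fun r => ?_⟩
  let gn : ℕ → R3 → C3 := fun n => (Metric.ball (0 : R3) n).indicator g
  have hgn : ∀ n, MemLp (gn n) 2 volume := fun n => hg.indicator measurableSet_ball
  have hgi : ∀ n, Integrable (gn n) := fun n => by
    rw [integrable_indicator_iff measurableSet_ball]
    have : IsFiniteMeasure (volume.restrict (Metric.ball (0 : R3) n)) :=
      ⟨by simpa using measure_ball_lt_top (μ := (volume : Measure R3)) (x := 0) (r := n)⟩
    exact memLp_one_iff_integrable.1 ((hg.restrict _).mono_exponent (by norm_num))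
  have htrunc : ∀ (n : ℕ) (θ : R3), ∫ x in Metric.ball (0 : R3) n, conj (ex θ x) • g x
      = 𝓕 (gn n) ((2 * Real.pi)⁻¹ • θ) := fun n θ => by
    rw [fourier_eq, smul_smul, mul_inv_cancel₀ (by positivity), one_smul,
      ← integral_indicator measurableSet_ball]
    refine integral_congr_ae (ae_of_all _ fun x => ?_)
    exact Set.indicator_smul_apply _ _ _ _
  have hbound : ∀ n : ℕ, eLpNorm (fun θ => fourierConst • G ((2 * Real.pi)⁻¹ • θ) - fourierConst •
      ∫ x in Metric.ball (0 : R3) n, conj (ex θ x) • g x) 2 (volume.restrict (Metric.ball (0 : R3) r))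
      ≤ ‖fourierConst‖ₑ * (ENNReal.ofReal |((2 * Real.pi)⁻¹ ^ 3)⁻¹| ^ (1 / 2 : ℝ) *
        eLpNorm (fun x => g x - gn n x) 2 volume) := fun n => by
    have hm : AEStronglyMeasurable (fun ξ => G ξ - 𝓕 (gn n) ξ) volume :=
      (Lp.aestronglyMeasurable G).sub (continuous_fourier_of_integrable (hgi n)).aestronglyMeasurable
    have hpl : eLpNorm (fun ξ => G ξ - 𝓕 (gn n) ξ) 2 volume
        = eLpNorm (fun x => g x - gn n x) 2 volume := by
      have e1 : (fun ξ => G ξ - 𝓕 (gn n) ξ) =ᵐ[volume]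
          (𝓕 (hg.toLp g - (hgn n).toLp (gn n)) : L2C3) := by
        rw [sub_eq_add_neg (hg.toLp g), FourierTransform.fourier_add,
          FourierTransform.fourier_neg, ← sub_eq_add_neg]
        filter_upwards [fourier_toLp_ae (hgi n) (hgn n),
          Lp.coeFn_sub (𝓕 (hg.toLp g) : L2C3) (𝓕 ((hgn n).toLp (gn n)))] with ξ h1 h2
        rw [h2, Pi.sub_apply, h1]
      have e2 : (fun x => g x - gn n x) =ᵐ[volume] ⇑(hg.toLp g - (hgn n).toLp (gn n)) := by
        filter_upwards [hg.coeFn_toLp, (hgn n).coeFn_toLp,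
          Lp.coeFn_sub (hg.toLp g) ((hgn n).toLp (gn n))] with x h1 h2 h3
        rw [h3, Pi.sub_apply, h1, h2]
      rw [eLpNorm_congr_ae e1, eLpNorm_congr_ae e2, ← Lp.enorm_def, ← Lp.enorm_def, ← ofReal_norm,
        ← ofReal_norm, Lp.norm_fourier_eq]
    rw [← hpl, ← eLpNorm_comp_smul_le hm hr, ← eLpNorm_const_smul]
    refine (eLpNorm_mono_measure _ Measure.restrict_le_self).trans (le_of_eq ?_)
    refine congrArg (fun F => eLpNorm F 2 volume) (funext fun θ => ?_)
    rw [htrunc, ← smul_sub]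
    rfl
  have hlim := tendsto_eLpNorm_sub_indicator_ball hg
  have hlim2 : Tendsto (fun n => ‖fourierConst‖ₑ *
      (ENNReal.ofReal |((2 * Real.pi)⁻¹ ^ 3)⁻¹| ^ (1 / 2 : ℝ) *
        eLpNorm (fun x => g x - gn n x) 2 volume)) atTop (𝓝 0) := by
    have h1 := ENNReal.Tendsto.const_mul (a := ENNReal.ofReal |((2 * Real.pi)⁻¹ ^ 3)⁻¹| ^ (1 / 2 : ℝ))
      hlim (Or.inr (ENNReal.rpow_ne_top_of_nonneg (by norm_num) ENNReal.ofReal_ne_top))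
    have h2 := ENNReal.Tendsto.const_mul (a := ‖fourierConst‖ₑ) h1 (Or.inr enorm_ne_top)
    simpa using h2
  exact tendsto_of_tendsto_of_tendsto_of_le_of_le tendsto_const_nhds hlim2 (fun _ => zero_le)
    hbound

/-! ### The two-scale symbol -/

lemma homMatrix_eq {A : R3 → MatR} (hpos : ∀ y, (A y).PosDef)
    {P : R3 → Fin 3 → R3 → C3}
    (hP : IsBlochFamily (fun y => (sqrtC A y)⁻¹) P) (κ : R3) :
    homMatrix volume A P κ = effMatrix (fun y => (sqrtC A y)⁻¹) P κ := by
  ext i j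
  rw [effMatrix, Matrix.of_apply, fc_apply (hP.orth κ j).1, homMatrix, Matrix.of_apply]
  refine integral_congr_ae (ae_of_all _ fun y => ?_)
  dsimp only
  rw [freq_zero, ex_zero, map_one, one_smul, ← single_act_cellMatrix, ← act_mul, ← act_mul,
    ← invC_eq hpos, act_apply, Finset.sum_eq_single j]
  · simp
  · intro k _ hk
    simp [hk]
  · simp

section

variable {A : R3 → MatR} {b : ℝ} {P : R3 → Fin 3 → R3 → C3} {ε : ℝ}

lemma act_twoScaleSymbol (hpos : ∀ y, (A y).PosDef)
    (hW : IsWeight (fun y => (sqrtC A y)⁻¹) (sqrtC A) b)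
    (hP : IsBlochFamily (fun y => (sqrtC A y)⁻¹) P) (ξ x : R3) (v : C3) :
    act (twoScaleSymbol volume A P ε ((2 * Real.pi) • ξ) x) v
      = act ((sqrtC A (ε⁻¹ • x))⁻¹) (act (cellMatrix P (ε • (2 * Real.pi) • ξ) (ε⁻¹ • x))
        (act (symbInv (fun y => (sqrtC A y)⁻¹) P ε ξ) v)) := by
  rw [twoScaleSymbol, homSymbol, homMatrix_eq hpos hP, mul_assoc,
    inv_mul_symbol_inv (hP.norm_sq_le_inner hW _), act_mul, act_mul, symbInv]

/-- The superposition of corrected plane waves is the pseudo-differential image of the datum. -/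
lemma isPseudoDiffImage_synth (hpos : ∀ y, (A y).PosDef)
    (hW : IsWeight (fun y => (sqrtC A y)⁻¹) (sqrtC A) b)
    (hP : IsBlochFamily (fun y => (sqrtC A y)⁻¹) P) (hε : 0 < ε) {g : R3 → C3}
    (hg : MemLp g 2 volume) :
    IsPseudoDiffImage volume (fun θ x => -twoScaleSymbol volume A P ε θ x) g
      (fun x => -(mulS hW ε (synth hW hP hε (density hW hP ε (𝓕 (hg.toLp g))))) x) := by
  refine ⟨_, isFourierTransform_fourier hg, fun h hc hs => ?_⟩
  set S : R3 → MatC := fun y => (sqrtC A y)⁻¹ with hS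
  set G : L2C3 := 𝓕 (hg.toLp g) with hG
  -- The outer factor `A^{-1/2}` is Hermitian and is moved onto the test field.
  let k : R3 → C3 := fun x => act (S (ε⁻¹ • x)) (h x)
  have hk : Continuous k := Continuous.act (hW.continuous_scale ε) hc.continuous
  have hks : HasCompactSupport k := hasCompactSupport_act hs
  let I : R3 → ℂ := fun ξ => inner ℂ (blochT P ε k ξ) (act (symbInv S P ε ξ) (G ξ))
  have hIae : (fun ξ => inner ℂ (blochT P ε k ξ) (density hW hP ε G ξ)) =ᵐ[volume] I := by
    filter_upwards [coeFn_density hW hP ε G] with ξ hξ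
    rw [hξ]
  have hI : Integrable I := (integrable_inner_blochT hW hP hε hk hks _).congr hIae
  have hIint : ∫ ξ, I ξ = ∫ x, inner ℂ (h x) (mulS hW ε (synth hW hP hε (density hW hP ε G)) x) := by
    rw [← integral_congr_ae hIae, ← integral_inner_synth hW hP hε hk hks]
    refine integral_congr_ae ?_
    filter_upwards [coeFn_mulS hW ε (synth hW hP hε (density hW hP ε G))] with x hx
    rw [hx, inner_act_left, hW.hermS]
  have hpt : ∀ θ : R3, ∫ x, inner ℂ (h x) (ex θ x • act (-twoScaleSymbol volume A P ε θ x)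
      (fourierConst • G ((2 * Real.pi)⁻¹ • θ)))
      = -(fourierConst : ℂ) * I ((2 * Real.pi)⁻¹ • θ) := fun θ => by
    set ξ := (2 * Real.pi)⁻¹ • θ with hξ
    have hθ : θ = (2 * Real.pi) • ξ := by
      rw [hξ, smul_smul, mul_inv_cancel₀ (by positivity), one_smul]
    simp only [I]
    rw [hP.inner_blochT_eq hk hks hε, ← integral_const_mul]
    refine integral_congr_ae (ae_of_all _ fun x => ?_)
    dsimp only
    rw [hθ, act_neg_left, act_twoScaleSymbol hpos hW hP, ← Complex.coe_smul, act_smul, act_smul,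
      act_smul, smul_neg, inner_neg_right, smul_comm, inner_smul_right, inner_act_left, hW.hermS,
      act_smul, neg_mul]
  have hr : (2 * Real.pi)⁻¹ ≠ 0 := by positivity
  have hcoe : ∀ f : R3 → ℂ, ∫ θ, f ((2 * Real.pi)⁻¹ • θ) = ((2 * Real.pi) ^ 3 : ℝ) • ∫ ξ, f ξ :=
    fun f => by
      rw [Measure.integral_comp_smul]
      have hfin : Module.finrank ℝ R3 = 3 := by simp
      rw [hfin, inv_pow, inv_inv, abs_of_pos (by positivity)]
  simp only [hpt]
  refine ⟨(hI.comp_smul hr).const_mul _, ?_⟩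
  rw [integral_const_mul, hcoe I, hIint]
  simp only [inner_neg_right]
  rw [integral_neg]
  change _ = fourierConst • _
  rw [Complex.real_smul, Complex.real_smul]
  -- One factor `(2π)^{-3/2}` comes from the transform of `g`, one from the superposition, and the
  -- Jacobian `(2π)³` cancels both.
  have hcc : (fourierConst : ℂ) * fourierConst * ((2 * Real.pi) ^ 3 : ℝ) = 1 := by
    rw [← Complex.ofReal_mul, ← Complex.ofReal_mul, fourierConst_sq,
      inv_mul_cancel₀ (by positivity), Complex.ofReal_one]
  linear_combination (∫ x, inner ℂ (h x)
    (mulS hW ε (synth hW hP hε (density hW hP ε G)) x)) * hcc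

end

end

end MaxwellHom

/-! ### From weak solutions to the curl-curl equation. -/

namespace MaxwellHom

noncomputable section

open FourierTransform

/-! ### Solutions of the Maxwell problem -/

/-- The curl is symmetric on test fields. -/
lemma integral_inner_curl {Φ Ψ : R3 → C3} (hΦ : ContDiff ℝ ∞ Φ) (hΦs : HasCompactSupport Φ)
    (hΨ : ContDiff ℝ ∞ Ψ) (hΨs : HasCompactSupport Ψ) :
    ∫ x, inner ℂ (curl Φ x) (Ψ x) = ∫ x, inner ℂ (Φ x) (curl Ψ x) := by
  have key : ∀ {f g : R3 → C3}, Continuous f → HasCompactSupport f → Continuous g →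
      HasCompactSupport g → ∫ x, inner ℂ (f x) (g x) = ∫ ξ, inner ℂ (𝓕 f ξ) (𝓕 g ξ) :=
    fun {f g} hf hfs hg hgs => by
      have hm := memLp_of_test hg hgs 2
      have h1 := integral_inner_fourier (integrable_of_test hf hfs) (memLp_of_test hf hfs 2)
        (hm.toLp g)
      have e1 : ∫ x, inner ℂ (f x) (hm.toLp g x) = ∫ x, inner ℂ (f x) (g x) := by
        refine integral_congr_ae ?_
        filter_upwards [hm.coeFn_toLp] with x hx
        rw [hx]
      rw [← e1, h1]
      refine integral_congr_ae ?_
      filter_upwards [fourier_toLp_ae (integrable_of_test hg hgs) hm] with x hx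
      rw [hx]
  rw [key (continuous_curl hΦ) (hasCompactSupport_curl hΦs) hΨ.continuous hΨs,
    key hΦ.continuous hΦs (continuous_curl hΨ) (hasCompactSupport_curl hΨs)]
  refine integral_congr_ae (ae_of_all _ fun ξ => ?_)
  dsimp only
  rw [fourier_curl hΦ hΦs, fourier_curl hΨ hΨs, inner_act_crossMatrix]

lemma tendsto_integral_inner {f u : R3 → C3} {un : ℕ → R3 → C3} (hf : MemLp f 2 volume)
    (hu : MemLp u 2 volume) (hun : ∀ n, MemLp (un n) 2 volume)
    (h : Tendsto (fun n => eLpNorm (fun x => u x - un n x) 2 volume) atTop (𝓝 0)) :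
    Tendsto (fun n => ∫ x, inner ℂ (f x) (un n x)) atTop (𝓝 (∫ x, inner ℂ (f x) (u x))) := by
  have h1 : Tendsto (fun n => (hun n).toLp (un n)) atTop (𝓝 (hu.toLp u)) := by
    rw [Lp.tendsto_Lp_iff_tendsto_eLpNorm'' _ hun]
    refine h.congr fun n => ?_
    exact eLpNorm_sub_comm u (un n) 2 volume
  have h2 := (tendsto_const_nhds (x := hf.toLp f)).inner (𝕜 := ℂ) h1
  simpa only [inner_toLp] using h2

section

variable {A : R3 → MatR} {b : ℝ} {ε : ℝ}

lemma IsWeight.memLp_scaleT {S T : R3 → MatC} (hW : IsWeight S T b) (ε : ℝ) {f : R3 → C3}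
    (hf : MemLp f 2 volume) : MemLp (fun x => act (T (ε⁻¹ • x)) (f x)) 2 volume :=
  MemLp.act (hW.contT.comp (continuous_const_smul _)) (fun _ v => hW.boundT _ v) hf

lemma IsWeight.memLp_scaleS {S T : R3 → MatC} (hW : IsWeight S T b) (ε : ℝ) {f : R3 → C3}
    (hf : MemLp f 2 volume) : MemLp (fun x => act (S (ε⁻¹ • x)) (f x)) 2 volume :=
  MemLp.act (hW.contS.comp (continuous_const_smul _)) (fun _ v => hW.boundS _ v) hf

/-- The second component of a pair in the graph closure is the weak curl. -/
lemma IsHCurlPair.integral_curl {S T : R3 → MatC} (hW : IsWeight S T b) {u v : R3 → C3}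
    (h : IsHCurlPair volume (fun x => T (ε⁻¹ • x)) u v) {Φ : R3 → C3} (hΦ : ContDiff ℝ ∞ Φ)
    (hΦs : HasCompactSupport Φ) :
    ∫ x, inner ℂ (curl Φ x) (act (T (ε⁻¹ • x)) (u x)) = ∫ x, inner ℂ (Φ x) (v x) := by
  obtain ⟨hu, hv, φ, hφ, hlim, hlimc⟩ := h
  have hm : ∀ k, MemLp (fun x => act (T (ε⁻¹ • x)) (φ k x)) 2 volume := fun k =>
    memLp_of_test (hφ k).1.continuous (hφ k).2 2
  have hmc : ∀ k, MemLp (curl fun z => act (T (ε⁻¹ • z)) (φ k z)) 2 volume := fun k =>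
    memLp_of_test (continuous_curl (hφ k).1) (hasCompactSupport_curl (hφ k).2) 2
  have hlimT : Tendsto (fun k => eLpNorm (fun x => act (T (ε⁻¹ • x)) (u x)
      - act (T (ε⁻¹ • x)) (φ k x)) 2 volume) atTop (𝓝 0) := by
    have h1 : Tendsto (fun k => ENNReal.ofReal b * eLpNorm (fun x => u x - φ k x) 2 volume) atTop
        (𝓝 0) := by
      simpa using ENNReal.Tendsto.const_mul hlim (Or.inr ENNReal.ofReal_ne_top)
    refine tendsto_of_tendsto_of_tendsto_of_le_of_le tendsto_const_nhds h1 (fun _ => zero_le)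
      fun k => ?_
    refine eLpNorm_le_mul_eLpNorm_of_ae_le_mul (ae_of_all _ fun x => ?_) 2
    rw [← act_sub]
    exact hW.boundT _ _
  have l1 := tendsto_integral_inner (memLp_of_test (continuous_curl hΦ)
    (hasCompactSupport_curl hΦs) 2) (hW.memLp_scaleT ε hu) hm hlimT
  have l2 := tendsto_integral_inner (memLp_of_test hΦ.continuous hΦs 2) hv hmc hlimc
  refine tendsto_nhds_unique l1 (l2.congr fun k => ?_)
  exact (integral_inner_curl hΦ hΦs (hφ k).1 (hφ k).2).symm

/-- Provides the test pairs of the weak formulation: `A^{-1/2} Φ` is admissible because `A^{1/2}`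
turns it back into the smooth field `Φ`, and a constant sequence approximates it. -/
lemma isHCurlPair_of_test {S T : R3 → MatC} (hW : IsWeight S T b) (ε : ℝ) {Φ : R3 → C3}
    (hΦ : ContDiff ℝ ∞ Φ) (hΦs : HasCompactSupport Φ) :
    IsHCurlPair volume (fun x => T (ε⁻¹ • x)) (fun x => act (S (ε⁻¹ • x)) (Φ x)) (curl Φ) := by
  have e : ∀ x, act (T (ε⁻¹ • x)) (act (S (ε⁻¹ • x)) (Φ x)) = Φ x := fun x => by
    rw [← act_mul, hW.mulTS, act_one]
  refine ⟨hW.memLp_scaleS ε (memLp_of_test hΦ.continuous hΦs 2),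
    memLp_of_test (continuous_curl hΦ) (hasCompactSupport_curl hΦs) 2,
    fun _ x => act (S (ε⁻¹ • x)) (Φ x), fun _ => ?_, ?_, ?_⟩
  · simp only [e]
    exact ⟨hΦ, hΦs⟩
  · simp
  · simp [e]

/-- The solution is close to the superposition of corrected plane waves. -/
lemma IsMaxwellSolution.eLpNorm_sub_le {S T : R3 → MatC} (hW : IsWeight S T b)
    {P : R3 → Fin 3 → R3 → C3} (hP : IsBlochFamily S P) (hε : 0 < ε) {g D v : R3 → C3}
    (hg : MemLp g 2 volume) (hdiv : IsDivFree volume g)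
    (h : IsMaxwellSolution volume (fun x => T (ε⁻¹ • x)) g D v) :
    eLpNorm (fun x => D x
        - -(mulS hW ε (synth hW hP hε (density hW hP ε (𝓕 (hg.toLp g))))) x) 2 volume
      ≤ ENNReal.ofReal (b * energyConst b * ε) * eLpNorm g 2 volume := by
  obtain ⟨hpair, hsol⟩ := h
  have hD := hpair.1
  have hv := hpair.2.1
  have hTD := hW.memLp_scaleT ε hD
  -- `B = A^{1/2} D` is the unknown of the energy estimate, and `D = A^{-1/2} B` is recovered from
  -- it.
  have hSTD : mulS hW ε (hTD.toLp _) =ᵐ[volume] D := by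
    filter_upwards [coeFn_mulS hW ε (hTD.toLp _), hTD.coeFn_toLp] with x h1 h2
    rw [h1, h2, ← act_mul, hW.mulST, act_one]
  have congr_toLp : ∀ {f u : R3 → C3} (hu : MemLp u 2 volume),
      ∫ x, inner ℂ (f x) (hu.toLp u x) = ∫ x, inner ℂ (f x) (u x) := fun {f u} hu => by
    refine integral_congr_ae ?_
    filter_upwards [hu.coeFn_toLp] with x hx
    rw [hx]
  have hmain := norm_add_synth_le hW hP hε (g := hg.toLp g) (B := hTD.toLp _) (v := hv.toLp v)
    (fun φ hφ hφs => by rw [congr_toLp]; exact hdiv φ hφ hφs)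
    (fun Φ hΦ hΦs => by rw [congr_toLp, congr_toLp]; exact hpair.integral_curl hW hΦ hΦs)
    (fun Φ hΦ hΦs => by
      -- The test pair `(A^{-1/2} Φ, curl Φ)` turns the weak formulation into `curl curl B + A^{-1}
      -- B = -g`.
      have h1 := hsol _ _ (isHCurlPair_of_test hW ε hΦ hΦs)
      rw [congr_toLp, congr_toLp]
      have e1 : ∫ x, inner ℂ (Φ x) (mulS hW ε (mulS hW ε (hTD.toLp _)) x)
          = ∫ x, inner ℂ (act (S (ε⁻¹ • x)) (Φ x)) (D x) := by
        refine integral_congr_ae ?_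
        filter_upwards [coeFn_mulS hW ε (mulS hW ε (hTD.toLp _)), hSTD] with x h1 h2
        rw [h1, h2, inner_act_left, hW.hermS]
      have e2 : ∫ x, inner ℂ (act (S (ε⁻¹ • x)) (Φ x)) (act (T (ε⁻¹ • x)) (g x))
          = ∫ x, inner ℂ (Φ x) (g x) := by
        refine integral_congr_ae (ae_of_all _ fun x => ?_)
        dsimp only
        rw [inner_act_left, hW.hermS, ← act_mul, hW.mulST, act_one]
      rw [e1, ← e2]
      exact h1)
  set U := synth hW hP hε (density hW hP ε (𝓕 (hg.toLp g)))
  have hae : (fun x => D x - -(mulS hW ε U) x) =ᵐ[volume] mulS hW ε (hTD.toLp _ + U) := by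
    rw [map_add]
    filter_upwards [hSTD, Lp.coeFn_add (mulS hW ε (hTD.toLp _)) (mulS hW ε U)] with x h1 h2
    rw [h2, Pi.add_apply, h1, sub_neg_eq_add]
  have hb := hW.b_pos
  -- The extra factor `b` in the final constant comes from multiplying the estimate for `B` by
  -- `A^{-1/2}`.
  have hfin : ‖mulS hW ε (hTD.toLp _ + U)‖ ≤ b * energyConst b * ε * ‖hg.toLp g‖ := by
    refine (norm_mulS_le hW ε _).trans ?_
    calc b * _ ≤ b * (energyConst b * ε * ‖hg.toLp g‖) := by gcongr
      _ = _ := by ring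
  have hC := energyConst_pos hb
  rw [eLpNorm_congr_ae hae, ← eLpNorm_congr_ae hg.coeFn_toLp, ← Lp.enorm_def, ← Lp.enorm_def,
    ← ofReal_norm, ← ofReal_norm, ← ENNReal.ofReal_mul (by positivity)]
  exact ENNReal.ofReal_le_ofReal hfin

end

end

end MaxwellHom

/-! ### Conclusion. -/

theorem mainTheorem3
    (μ : MeasureTheory.Measure MaxwellHom.R3)
    (hμ_per : MaxwellHom.IsPeriodicMeasure μ)
    (hμ_cell : μ MaxwellHom.cell = 1)
    (hμ_grad : ∀ φ : MaxwellHom.R3 → ℂ, MaxwellHom.IsSmoothPeriodic φ →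
      ∀ j : Fin 3, ∫ y in MaxwellHom.cell, MaxwellHom.pd j φ y ∂μ = 0)
    (A : MaxwellHom.R3 → MaxwellHom.MatR)
    (hA_diff : ∀ i j : Fin 3, Differentiable ℝ (fun y => A y i j))
    (hA_per : MaxwellHom.IsPeriodicFun A)
    (hA_pos : ∀ y, (A y).PosDef) :
    -- the cell problems are solvable for every quasimomentum
    (∃ Ψ P, MaxwellHom.IsCellFamily μ A Ψ P) ∧
    ∃ C : ℝ, 0 < C ∧ ∀ Ψ P, MaxwellHom.IsCellFamily μ A Ψ P →
      ∀ ε : ℝ, 0 < ε → ∀ g : MaxwellHom.R3 → MaxwellHom.C3,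
        MemLp g 2 (MaxwellHom.scaledMeasure μ ε) →
        MaxwellHom.IsDivFree (MaxwellHom.scaledMeasure μ ε) g →
        ∀ D v : MaxwellHom.R3 → MaxwellHom.C3,
          MaxwellHom.IsMaxwellSolution (MaxwellHom.scaledMeasure μ ε)
            (fun x => MaxwellHom.sqrtC A (ε⁻¹ • x)) g D v →
          ∃ u : MaxwellHom.R3 → MaxwellHom.C3,
            MemLp u 2 (MaxwellHom.scaledMeasure μ ε) ∧
            MaxwellHom.IsPseudoDiffImage (MaxwellHom.scaledMeasure μ ε)
              (fun θ x => - MaxwellHom.twoScaleSymbol μ A P ε θ x) g u ∧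
            eLpNorm (fun x => D x - u x) 2 (MaxwellHom.scaledMeasure μ ε)
              ≤ ENNReal.ofReal (C * ε) * eLpNorm g 2 (MaxwellHom.scaledMeasure μ ε) := by
  -- From here on all measures are Lebesgue measure, and `hμ_grad` becomes integration by parts on
  -- the cell.
  obtain rfl := MaxwellHom.eq_volume_of_integral_pd hμ_per hμ_cell hμ_grad
  obtain ⟨b, hW⟩ := MaxwellHom.exists_isWeight hA_diff hA_per hA_pos
  have hb := hW.b_pos
  refine ⟨MaxwellHom.exists_isCellFamily hμ_grad hA_pos hW, b * MaxwellHom.energyConst b,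
    mul_pos hb (MaxwellHom.energyConst_pos hb), fun Ψ P hΨ ε hε => ?_⟩
  rw [MaxwellHom.scaledMeasure_volume hε]
  intro g hg hdiv D v hsol
  have hP := hΨ.isBlochFamily hμ_grad hA_pos hW
  exact ⟨_, (Lp.memLp _).neg, MaxwellHom.isPseudoDiffImage_synth hA_pos hW hP hε hg,
    hsol.eLpNorm_sub_le hW hP hε hg hdiv⟩
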